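/- Let $a,b\ge 1$, $q\ge 1$, $N\ge 1$ be integers and $\sigma>0$. Let $u=(u_{i,j,k})$, with $1\le i\le b$, $1\le j\le a$ and $k=(k_1,k_2)\in\{0,\dots,q-1\}^2$, be i.i.d. real random variables with law $\mathcal N(0,\sigma^2)$. Let $U\in\mathbb R^{bN^2\times aN^2}$ be the (random) matrix of the 2D convolutional layer with $a$ input channels, $b$ output channels, $q\times q$ filters $u_{i,j,\cdot}$ and $N\times N$ feature maps, i.e. the matrix of the linear map sending $(F_j)_{1\le j\le a}$, $F_j:(\mathbb Z/N\mathbb Z)^2\to\mathbb R$, to the $b$ feature maps $$(UF)_i(x_1,x_2)=\sum_{j=1}^{a}\ \sum_{k_1=0}^{q-1}\sum_{k_2=0}^{q-1}u_{i,j,(k_1,k_2)}\,F_j(x_1-k_1,\,x_2-k_2),\qquad 1\le i\le b,$$ where the pixel coordinates are taken modulo $N$ (circular convolution). Then for every $t\ge 0$ the spectral norm (the $\ell_2\to\ell_2$ operator norm) of $U$ satisfies $$\mathbb P\Big(\|U\|_2\ \ge\ \sigma\big(q(\sqrt a+\sqrt b)+t\big)\Big)\ \le\ 2N^2\,e^{-t^2/(2q^2)}.$$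 -/

import Mathlib

open MeasureTheory ProbabilityTheory
open scoped Matrix.Norms.L2Operator

/-- An `N × N` feature map, with pixel coordinates taken modulo `N`. -/
abbrev FeatureMap (N : ℕ) : Type := ZMod N × ZMod N → ℝ

/-- 2D circular convolution of an `N × N` feature map `F` with a `q × q` filter `f`:
`(f ∗ F)(x₁, x₂) = ∑_{k₁, k₂ < q} f(k₁, k₂) F(x₁ - k₁, x₂ - k₂)`, coordinates modulo `N`. -/
def circConv {q N : ℕ} (f : Fin q × Fin q → ℝ) (F : FeatureMap N) : FeatureMap N :=
  fun x => ∑ k : Fin q × Fin q, f k * F (x.1 - (k.1 : ℕ), x.2 - (k.2 : ℕ))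

/-- The matrix of a 2D convolutional layer with `a` input channels, `b` output channels, `q × q`
filters and `N × N` feature maps. Its `(i, j)` block, `i < b`, `j < a`, is the `N² × N²` matrix of
the circular convolution with the filter `u (i, j, ·)`. The weights are shared: each number
`u (i, j, k)` appears once (added in) in every row and every column of the block `(i, j)`. -/
def convLayerMatrix {a b q : ℕ} (N : ℕ) (u : Fin b × Fin a × (Fin q × Fin q) → ℝ) :
    Matrix (Fin b × (ZMod N × ZMod N)) (Fin a × (ZMod N × ZMod N)) ℝ :=
  Matrix.of fun r c => ∑ k : Fin q × Fin q,
    if c.2 = (r.2.1 - (k.1 : ℕ), r.2.2 - (k.2 : ℕ)) then u (r.1, c.1, k) else 0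

/-- The layer matrix acts as the layer does: output channel `i` is the sum over the input
channels `j` of the convolutions of channel `j` with the filter `u (i, j, ·)`. -/
theorem convLayerMatrix_mulVec {a b q N : ℕ} [NeZero N]
    (u : Fin b × Fin a × (Fin q × Fin q) → ℝ) (F : Fin a × (ZMod N × ZMod N) → ℝ)
    (i : Fin b) (x : ZMod N × ZMod N) :
    (convLayerMatrix N u).mulVec F (i, x) =
      ∑ j : Fin a, circConv (fun k => u (i, j, k)) (fun y => F (j, y)) x := by
  simp only [convLayerMatrix, circConv, Matrix.mulVec, dotProduct, Matrix.of_apply,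
    Fintype.sum_prod_type (α₁ := Fin a), Finset.sum_mul]
  refine Finset.sum_congr rfl fun j _ => ?_
  rw [Finset.sum_comm]
  refine Finset.sum_congr rfl fun k _ => ?_
  simp

/-! The characters of `ZMod N × ZMod N` block-diagonalise the layer. By Parseval its norm is at most
the largest norm of the `N ^ 2` symbols `∑ₖ u (·, ·, k) χ (s k)` (`norm_groupConvMatrix_le`), so
after a union bound only one symbol is left: a complex Gaussian matrix whose real and imaginary
parts are correlated. A scalar phase, which does not change the norm, decorrelates them. The law
becomes that of `q (cos θ X + i sin θ Y)` times the scale `σ`, with `X`, `Y` independent standard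
real Gaussian matrices and `θ ∈ [0, π/4]` (`exists_phase_rotation`).

The heart of the matter is that the average of `cosh (l ‖cos θ X + i sin θ Y‖)` on this range is
largest at `θ = 0` (`integral_cosh_norm_rotScale_le`). Since `cosh` has nonnegative Taylor
coefficients, even moments of the norm suffice, and these are limits of averages of `(tr (AᴴA)^(k+2)
+ ε)^s` with `s = p / (k + 2)`. By Gaussian integration by parts the derivative in `θ` is `-cos θ
sin θ` times a nonnegative multiple of the average of `laplaceDefect`. That average is nonnegative
for the following reason. For `θ ≤ π/4` the matrix is an independent real matrix plus `sin θ` times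
a circular complex Gaussian matrix. The real matrix may be taken diagonal by a real singular value
decomposition, and Cameron–Martin trades it for an exponential weight. Averaging over unitary
rotations of the complex matrix, phases kill most of the moments. The surviving ones are nonnegative
because the exponential of a positive kernel is positive, and they come with nonnegative
coefficients (`integral_phaseWeight_laplaceDefect_nonneg`).

At `θ = 0` the matrix is real. Chevet's comparison in exponential form
(`exp_mul_integral_exp_norm_le`) and a sharp bound for the exponential moments of the length of a
Gaussian vector (`integral_exp_mul_sqrt_sum_sq_le`) give `exp (l (√a + √b) + l² / 2)`. Markov's
inequality for `cosh` then yields the tail, with the factor `2` coming from `exp z / 2 ≤ cosh z`. -/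

/-! ### Standard Gaussian measures and functions of exponential growth. -/

/-- The law of a standard Gaussian vector indexed by a finite type. -/
noncomputable def gaussPi (ι : Type*) [Fintype ι] : Measure (ι → ℝ) :=
  Measure.pi fun _ => gaussianReal 0 1

instance (ι : Type*) [Fintype ι] : IsProbabilityMeasure (gaussPi ι) := by
  unfold gaussPi; infer_instance

/-- Growth at most exponential in the `ℓ¹` norm. -/
def ExpGrowth {ι E : Type*} [Fintype ι] [NormedAddCommGroup E] (f : (ι → ℝ) → E) : Prop :=
  ∃ C : ℝ, ∀ x, ‖f x‖ ≤ C * Real.exp (C * ∑ i, |x i|)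

namespace ExpGrowth

variable {ι E : Type*} [Fintype ι] [NormedAddCommGroup E] {f g : (ι → ℝ) → E}

theorem mono_const {C D : ℝ} (h : C ≤ D) (hC : 0 ≤ C) (x : ι → ℝ) :
    C * Real.exp (C * ∑ i, |x i|) ≤ D * Real.exp (D * ∑ i, |x i|) := by
  have : 0 ≤ ∑ i, |x i| := Finset.sum_nonneg fun _ _ => abs_nonneg _
  gcongr
  linarith

theorem exists_nonneg (hf : ExpGrowth f) :
    ∃ C : ℝ, 0 ≤ C ∧ ∀ x, ‖f x‖ ≤ C * Real.exp (C * ∑ i, |x i|) := by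
  obtain ⟨C, hC⟩ := hf
  refine ⟨C, ?_, hC⟩
  have h := (norm_nonneg _).trans (hC 0)
  by_contra hneg
  have := mul_neg_of_neg_of_pos (not_le.1 hneg) (Real.exp_pos (C * ∑ i, |(0 : ι → ℝ) i|))
  linarith

theorem of_norm_le {F : Type*} [NormedAddCommGroup F] {g : (ι → ℝ) → F} (hg : ExpGrowth g)
    (h : ∀ x, ‖f x‖ ≤ ‖g x‖) : ExpGrowth f :=
  let ⟨C, hC⟩ := hg
  ⟨C, fun x => (h x).trans (hC x)⟩

theorem of_le_add_exp (A B D : ℝ) (hA : 0 ≤ A)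
    (h : ∀ x, ‖f x‖ ≤ A * Real.exp (B * ∑ i, |x i| + D)) : ExpGrowth f := by
  refine ⟨max (A * Real.exp D) B, fun x => (h x).trans ?_⟩
  have h0 : 0 ≤ ∑ i, |x i| := Finset.sum_nonneg fun _ _ => abs_nonneg _
  rw [Real.exp_add, mul_comm (Real.exp _), ← mul_assoc]
  gcongr
  · exact le_max_left _ _
  · exact le_max_right _ _

theorem const (c : E) : ExpGrowth (fun _ : ι → ℝ => c) :=
  of_le_add_exp ‖c‖ 0 0 (norm_nonneg _) (by simp)

theorem add (hf : ExpGrowth f) (hg : ExpGrowth g) : ExpGrowth (fun x => f x + g x) := by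
  obtain ⟨C, hC0, hC⟩ := hf.exists_nonneg
  obtain ⟨D, hD0, hD⟩ := hg.exists_nonneg
  refine of_le_add_exp (C + D) (C + D) 0 (by positivity) fun x => ?_
  refine (norm_add_le _ _).trans ((add_le_add (hC x) (hD x)).trans ?_)
  have h0 : 0 ≤ ∑ i, |x i| := Finset.sum_nonneg fun _ _ => abs_nonneg _
  rw [add_mul, add_zero]
  gcongr <;> linarith

theorem neg (hf : ExpGrowth f) : ExpGrowth (fun x => -f x) := hf.of_norm_le (by simp)

theorem sub (hf : ExpGrowth f) (hg : ExpGrowth g) : ExpGrowth (fun x => f x - g x) := by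
  simpa [sub_eq_add_neg] using hf.add hg.neg

theorem sum {κ : Type*} (s : Finset κ) {f : κ → (ι → ℝ) → E} (hf : ∀ k ∈ s, ExpGrowth (f k)) :
    ExpGrowth (fun x => ∑ k ∈ s, f k x) := by
  classical
  induction s using Finset.induction_on with
  | empty => simpa using const (ι := ι) (0 : E)
  | insert a s ha ih =>
    simp only [Finset.sum_insert ha]
    exact (hf a (by simp)).add (ih fun k hk => hf k (by simp [hk]))

theorem smul {𝕜 : Type*} [NormedField 𝕜] [NormedSpace 𝕜 E] {c : (ι → ℝ) → 𝕜} (hc : ExpGrowth c)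
    (hf : ExpGrowth f) : ExpGrowth (fun x => c x • f x) := by
  obtain ⟨C, hC0, hC⟩ := hc.exists_nonneg
  obtain ⟨D, hD0, hD⟩ := hf.exists_nonneg
  refine of_le_add_exp (C * D) (C + D) 0 (by positivity) fun x => ?_
  rw [norm_smul]
  refine (mul_le_mul (hC x) (hD x) (norm_nonneg _) (by positivity)).trans (le_of_eq ?_)
  rw [add_zero, add_mul, Real.exp_add]
  ring

theorem mul {R : Type*} [NormedField R] {f g : (ι → ℝ) → R} (hf : ExpGrowth f)
    (hg : ExpGrowth g) : ExpGrowth (fun x => f x * g x) := hf.smul hg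

theorem eval (i : ι) : ExpGrowth (fun x : ι → ℝ => x i) := by
  refine of_le_add_exp 1 1 0 zero_le_one fun x => ?_
  rw [Real.norm_eq_abs, one_mul, one_mul, add_zero]
  have : |x i| ≤ ∑ i, |x i| :=
    Finset.single_le_sum (f := fun i => |x i|) (fun _ _ => abs_nonneg _) (Finset.mem_univ i)
  linarith [Real.add_one_le_exp (∑ i, |x i|)]

theorem exp_sum (c : ι → ℝ) : ExpGrowth (fun x : ι → ℝ => Real.exp (∑ i, c i * x i)) := by
  refine of_le_add_exp 1 (∑ i, |c i|) 0 zero_le_one fun x => ?_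
  rw [Real.norm_eq_abs, Real.abs_exp, one_mul, add_zero, Finset.mul_sum]
  refine Real.exp_le_exp.2 (Finset.sum_le_sum fun i _ => ?_)
  calc c i * x i ≤ |c i| * |x i| := by rw [← abs_mul]; exact le_abs_self _
    _ ≤ _ := by
      gcongr
      exact Finset.single_le_sum (f := fun i => |c i|) (fun _ _ => abs_nonneg _) (Finset.mem_univ i)

theorem comp {κ : Type*} [Fintype κ] (hf : ExpGrowth f) {T : (κ → ℝ) → ι → ℝ} (A B : ℝ)
    (hT : ∀ x, ∑ i, |T x i| ≤ A * ∑ k, |x k| + B) :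
    ExpGrowth (fun x => f (T x)) := by
  obtain ⟨C, hC0, hC⟩ := hf.exists_nonneg
  refine of_le_add_exp C (C * A) (C * B) hC0 fun x => (hC _).trans ?_
  gcongr
  nlinarith [mul_le_mul_of_nonneg_left (hT x) hC0]

theorem integrable_exp_abs (C : ℝ) :
    Integrable (fun x : ι → ℝ => Real.exp (C * ∑ i, |x i|)) (gaussPi ι) := by
  have h1 : Integrable (fun x : ℝ => Real.exp (C * |x|)) (gaussianReal 0 1) :=
    integrable_exp_mul_abs (integrable_exp_mul_gaussianReal C)
      (by simpa using integrable_exp_mul_gaussianReal (-C))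
  have := Integrable.fintype_prod (μ := fun _ : ι => gaussianReal 0 1)
    (f := fun _ x => Real.exp (C * |x|)) fun _ => h1
  simpa [Finset.mul_sum, Real.exp_sum, gaussPi] using this

theorem integrable (hf : ExpGrowth f) (hm : AEStronglyMeasurable f (gaussPi ι)) :
    Integrable f (gaussPi ι) := by
  obtain ⟨C, hC⟩ := hf
  exact ((integrable_exp_abs C).const_mul C).mono' hm (Filter.Eventually.of_forall hC)

theorem integrable_of_continuous (hf : ExpGrowth f) (hm : Continuous f) :
    Integrable f (gaussPi ι) :=
  hf.integrable (by
    have := hm.stronglyMeasurable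
    exact this.aestronglyMeasurable)

end ExpGrowth

/-! ### Shifts, integration by parts and rescaling for Gaussian averages. -/

section CameronMartin

variable {ι : Type*} [Fintype ι]

theorem gaussianReal_map_add_eq_withDensity (v : ℝ) :
    gaussianReal v 1 =
      (gaussianReal 0 1).withDensity fun x => ENNReal.ofReal (Real.exp (v * x - v ^ 2 / 2)) := by
  rw [gaussianReal_of_var_ne_zero _ one_ne_zero, gaussianReal_of_var_ne_zero _ one_ne_zero,
    ← withDensity_mul _ (measurable_gaussianPDF _ _) (by fun_prop)]
  congr 1
  ext x
  simp only [Pi.mul_apply, gaussianPDF, gaussianPDFReal]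
  rw [← ENNReal.ofReal_mul (by positivity), mul_assoc _ (Real.exp _), ← Real.exp_add]
  congr 3
  simp
  ring

/-- The density factorises over the coordinates, so it is enough to compare both measures on boxes,
where the integral is a product of one-dimensional ones. -/
theorem gaussPi_map_add (v : ι → ℝ) :
    (gaussPi ι).map (fun x => x + v) = (gaussPi ι).withDensity
      fun x => ENNReal.ofReal (Real.exp (∑ i, (v i * x i - v i ^ 2 / 2))) := by
  have h1 : (gaussPi ι).map (fun x => x + v) = Measure.pi fun i => gaussianReal (v i) 1 := by
    have := Measure.pi_map_pi (μ := fun _ : ι => gaussianReal 0 1) (f := fun i x => x + v i)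
      (fun i => by fun_prop)
    simp only [gaussianReal_map_add_const, zero_add] at this
    exact this
  rw [h1]
  refine Measure.pi_eq fun s hs => ?_
  have hint : ∀ i, Integrable (fun y : ℝ => Real.exp (v i * y - v i ^ 2 / 2))
      (gaussianReal 0 1) := fun i => by
    simp only [Real.exp_sub]
    exact (integrable_exp_mul_gaussianReal (v i)).div_const _
  have hprod : ∀ x : ι → ℝ, (Set.univ.pi s).indicator
      (fun x => Real.exp (∑ i, (v i * x i - v i ^ 2 / 2))) x =
      ∏ i, (s i).indicator (fun y => Real.exp (v i * y - v i ^ 2 / 2)) (x i) := fun x => by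
    by_cases hx : x ∈ Set.univ.pi s
    · rw [Set.indicator_of_mem hx, Real.exp_sum]
      exact Finset.prod_congr rfl fun i _ => by
        rw [Set.indicator_of_mem (hx i trivial)]
    · rw [Set.indicator_of_notMem hx]
      obtain ⟨i, hi⟩ : ∃ i, x i ∉ s i := by simpa [Set.mem_pi] using hx
      exact (Finset.prod_eq_zero (Finset.mem_univ i) (Set.indicator_of_notMem hi _)).symm
  have hS : MeasurableSet (Set.univ.pi s) := MeasurableSet.univ_pi hs
  have hintS : Integrable (fun x : ι → ℝ => (Set.univ.pi s).indicator
      (fun x => Real.exp (∑ i, (v i * x i - v i ^ 2 / 2))) x) (gaussPi ι) := by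
    simp only [hprod]
    exact Integrable.fintype_prod fun i => (hint i).indicator (hs i)
  rw [withDensity_apply _ hS, ← lintegral_indicator hS]
  have e1 : ∀ x : ι → ℝ, (Set.univ.pi s).indicator
      (fun x => ENNReal.ofReal (Real.exp (∑ i, (v i * x i - v i ^ 2 / 2)))) x =
      ENNReal.ofReal ((Set.univ.pi s).indicator
        (fun x => Real.exp (∑ i, (v i * x i - v i ^ 2 / 2))) x) := fun x => by
    by_cases hx : x ∈ Set.univ.pi s <;> simp [hx]
  simp only [e1]
  rw [← ofReal_integral_eq_lintegral_ofReal hintS (Filter.Eventually.of_forall fun x =>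
    Set.indicator_nonneg (fun _ _ => (Real.exp_pos _).le) x)]
  simp only [hprod]
  rw [gaussPi, integral_fintype_prod_eq_prod, ENNReal.ofReal_prod_of_nonneg]
  · refine Finset.prod_congr rfl fun i _ => ?_
    rw [gaussianReal_map_add_eq_withDensity (v i), withDensity_apply _ (hs i), integral_indicator (hs i),
      ofReal_integral_eq_lintegral_ofReal (hint i).integrableOn
        (Filter.Eventually.of_forall fun x => (Real.exp_pos _).le)]
  · exact fun i _ => integral_nonneg fun x =>
      Set.indicator_nonneg (fun _ _ => (Real.exp_pos _).le) x

/-- The Cameron–Martin formula for a standard Gaussian vector. -/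
theorem integral_gaussPi_add {E : Type*} [NormedAddCommGroup E] [NormedSpace ℝ E]
    {f : (ι → ℝ) → E} (hf : StronglyMeasurable f) (v : ι → ℝ) :
    ∫ x, f (x + v) ∂gaussPi ι =
      ∫ x, Real.exp (∑ i, (v i * x i - v i ^ 2 / 2)) • f x ∂gaussPi ι := by
  have h := integral_map (μ := gaussPi ι) (φ := fun x => x + v) (f := f) (by fun_prop)
    hf.aestronglyMeasurable
  rw [← h, gaussPi_map_add, integral_withDensity_eq_integral_toReal_smul (by fun_prop) (by simp)]
  simp [ENNReal.toReal_ofReal (Real.exp_pos _).le]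

/-- Exponentials of the `ℓ¹` norm are Gaussian-integrable, so one such bound, uniform over
parameters within distance one, justifies differentiating under the integral. -/
theorem hasDerivAt_integral_gaussPi {F F' : ℝ → (ι → ℝ) → ℝ} {s₀ : ℝ}
    (hF : ∀ s, Continuous (F s)) (hF' : Continuous (F' s₀)) (gF : ExpGrowth (F s₀))
    (C : ℝ) (hb : ∀ s ∈ Metric.ball s₀ 1, ∀ x, |F' s x| ≤ C * Real.exp (C * ∑ i, |x i|))
    (hd : ∀ s ∈ Metric.ball s₀ 1, ∀ x, HasDerivAt (fun s => F s x) (F' s x) s) :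
    HasDerivAt (fun s => ∫ x, F s x ∂gaussPi ι) (∫ x, F' s₀ x ∂gaussPi ι) s₀ :=
  (hasDerivAt_integral_of_dominated_loc_of_deriv_le (μ := gaussPi ι)
    (bound := fun x => C * Real.exp (C * ∑ i, |x i|)) (Metric.ball_mem_nhds s₀ one_pos)
    (Filter.Eventually.of_forall fun s => (hF s).stronglyMeasurable.aestronglyMeasurable)
    (gF.integrable_of_continuous (hF s₀)) hF'.stronglyMeasurable.aestronglyMeasurable
    (Filter.Eventually.of_forall fun x s hs => hb s hs x)
    ((ExpGrowth.integrable_exp_abs C).const_mul C)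
    (Filter.Eventually.of_forall fun x s hs => hd s hs x)).2

theorem sum_abs_add_single_le [DecidableEq ι] (x : ι → ℝ) (c : ι) (t : ℝ) :
    ∑ i, |(x + Pi.single c t : ι → ℝ) i| ≤ ∑ i, |x i| + |t| := by
  calc ∑ i, |(x + Pi.single c t : ι → ℝ) i| ≤ ∑ i, (|x i| + |(Pi.single c t : ι → ℝ) i|) :=
        Finset.sum_le_sum fun i _ => abs_add_le _ _
    _ = _ := by
        rw [Finset.sum_add_distrib]
        congr 1
        rw [Finset.sum_eq_single c]
        · simp
        · intro i _ hi; simp [hi]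
        · simp

/-- Gaussian integration by parts. -/
theorem integral_gaussPi_coord_mul [DecidableEq ι] {f f' : (ι → ℝ) → ℝ} (c : ι)
    (hf : Continuous f) (hf' : Continuous f') (gf : ExpGrowth f) (gf' : ExpGrowth f')
    (hd : ∀ x, HasDerivAt (fun t : ℝ => f (x + Pi.single c t)) (f' x) 0) :
    ∫ x, x c * f x ∂gaussPi ι = ∫ x, f' x ∂gaussPi ι := by
  have hd' : ∀ (x : ι → ℝ) (t : ℝ), HasDerivAt (fun t : ℝ => f (x + Pi.single c t)) (f' (x + Pi.single c t)) t := by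
    intro x t
    have h := (HasDerivAt.comp_sub_const (f := fun s : ℝ => f (x + Pi.single c t + Pi.single c s))
      t t (by simpa using hd (x + Pi.single c t)))
    refine h.congr_of_eventuallyEq (Filter.Eventually.of_forall fun s => ?_)
    simp only [add_assoc, ← Pi.single_add]
    ring_nf
  have hsum : ∀ (s : ℝ) (x : ι → ℝ), ∑ i, ((Pi.single c s : ι → ℝ) i * x i -
      (Pi.single c s : ι → ℝ) i ^ 2 / 2) = s * x c - s ^ 2 / 2 := fun s x => by
    rw [Finset.sum_eq_single c]
    · simp
    · intro i _ hi; simp [hi]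
    · simp
  obtain ⟨C', hC0', hC'⟩ := gf'.exists_nonneg
  obtain ⟨C, hC0, hC⟩ := gf.exists_nonneg
  -- `h1` and `h2` differentiate the same function of the shift `s`: first by moving the argument of
  -- `f`, then, after Cameron–Martin, by reweighting. Uniqueness of the derivative is the claim.
  have h1 : HasDerivAt (fun s => ∫ x, f (x + Pi.single c s) ∂gaussPi ι) (∫ x, f' x ∂gaussPi ι) 0 := by
    have := hasDerivAt_integral_gaussPi (ι := ι) (F := fun s x => f (x + Pi.single c s))
      (F' := fun s x => f' (x + Pi.single c s)) (s₀ := 0) (fun s => by fun_prop) (by simpa using hf')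
      (by simpa using gf) (C' * Real.exp C') (fun s hs x => ?_) (fun s _ x => hd' x s)
    · simpa using this
    · rw [mem_ball_zero_iff, Real.norm_eq_abs] at hs
      refine (hC' _).trans ?_
      have h0 : 0 ≤ ∑ i, |x i| := Finset.sum_nonneg fun _ _ => abs_nonneg _
      rw [mul_assoc, ← Real.exp_add]
      refine mul_le_mul_of_nonneg_left (Real.exp_le_exp.2 ?_) hC0'
      have h2 : C' ≤ C' * Real.exp C' := by nlinarith [Real.add_one_le_exp C']
      have := sum_abs_add_single_le x c s
      nlinarith [mul_le_mul_of_nonneg_left (this.trans (add_le_add_right hs.le _)) hC0',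
        mul_le_mul_of_nonneg_right h2 h0]
  have h2 : HasDerivAt (fun s => ∫ x, Real.exp (s * x c - s ^ 2 / 2) * f x ∂gaussPi ι)
      (∫ x, x c * f x ∂gaussPi ι) 0 := by
    have := hasDerivAt_integral_gaussPi (ι := ι) (F := fun s x => Real.exp (s * x c - s ^ 2 / 2) * f x)
      (F' := fun s x => Real.exp (s * x c - s ^ 2 / 2) * (x c - s) * f x) (s₀ := 0)
      (fun s => by fun_prop) (by fun_prop) (by simpa using gf) (C + 2) (fun s hs x => ?_)
      (fun s _ x => ?_)
    · simpa using this
    · rw [mem_ball_zero_iff, Real.norm_eq_abs] at hs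
      have h0 : |x c| ≤ ∑ i, |x i| :=
        Finset.single_le_sum (f := fun i => |x i|) (fun _ _ => abs_nonneg _) (Finset.mem_univ c)
      have h00 : 0 ≤ |x c| := abs_nonneg _
      rw [abs_mul, abs_mul, Real.abs_exp]
      -- For `|s| < 1` the weight and the factor `x c - s` each cost at most one `exp (∑ |x i|)`,
      -- which explains the constant `C + 2`.
      have e1 : Real.exp (s * x c - s ^ 2 / 2) ≤ Real.exp (∑ i, |x i|) := by
        refine Real.exp_le_exp.2 ?_
        have : s * x c ≤ |s| * |x c| := by rw [← abs_mul]; exact le_abs_self _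
        nlinarith [sq_nonneg s]
      have e2 : |x c - s| ≤ Real.exp (∑ i, |x i|) := by
        have := abs_sub (x c) s
        linarith [Real.add_one_le_exp (∑ i, |x i|)]
      calc _ ≤ Real.exp (∑ i, |x i|) * Real.exp (∑ i, |x i|) * (C * Real.exp (C * ∑ i, |x i|)) := by
            gcongr; exact hC x
        _ = C * Real.exp ((C + 2) * ∑ i, |x i|) := by
            rw [add_mul, two_mul, Real.exp_add, Real.exp_add]; ring
        _ ≤ _ := by gcongr; linarith
    · have h : HasDerivAt (fun s : ℝ => s * x c - s ^ 2 / 2) (x c - s) s := by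
        have := ((hasDerivAt_id s).mul_const (x c)).sub ((hasDerivAt_pow 2 s).div_const 2)
        refine this.congr_deriv ?_
        simp
      exact h.exp.mul_const _
  have heq : (fun s => ∫ x, f (x + Pi.single c s) ∂gaussPi ι) =
      fun s => ∫ x, Real.exp (s * x c - s ^ 2 / 2) * f x ∂gaussPi ι := by
    ext s
    rw [integral_gaussPi_add hf.stronglyMeasurable]
    simp only [hsum, smul_eq_mul]
  rw [heq] at h1
  exact h2.unique h1

/-- Differentiating a Gaussian average in the scale of each coordinate. -/
theorem hasDerivAt_integral_gaussPi_scale [DecidableEq ι] {f : (ι → ℝ) → ℝ}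
    {f1 f2 : ι → (ι → ℝ) → ℝ} (hf : Differentiable ℝ f) (gf : ExpGrowth f)
    (h1 : ∀ c, Continuous (f1 c)) (h2 : ∀ c, Continuous (f2 c))
    (g1 : ∀ c, ExpGrowth (f1 c)) (g2 : ∀ c, ExpGrowth (f2 c))
    (d1 : ∀ c x, HasDerivAt (fun t : ℝ => f (x + Pi.single c t)) (f1 c x) 0)
    (d2 : ∀ c x, HasDerivAt (fun t : ℝ => f1 c (x + Pi.single c t)) (f2 c x) 0)
    {w w' : ℝ → ι → ℝ} (hw : ∀ θ c, HasDerivAt (fun θ => w θ c) (w' θ c) θ)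
    (bw : ∀ θ c, |w θ c| ≤ 1) (bw' : ∀ θ c, |w' θ c| ≤ 1) (θ : ℝ) :
    HasDerivAt (fun θ => ∫ x, f (w θ * x) ∂gaussPi ι)
      (∑ c, w θ c * w' θ c * ∫ x, f2 c (w θ * x) ∂gaussPi ι) θ := by
  -- All coordinates are rescaled at once, so the chain rule needs the full derivative, assembled
  -- here from the partial ones.
  have hfd : ∀ x v, fderiv ℝ f x v = ∑ c, v c * f1 c x := by
    intro x v
    have e : ∀ c, fderiv ℝ f x (Pi.single c 1) = f1 c x := fun c => by
      have hl : HasDerivAt (fun t : ℝ => x + Pi.single c t) (Pi.single c (1 : ℝ)) 0 := by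
        refine HasDerivAt.const_add x ?_
        rw [hasDerivAt_pi]
        intro i
        by_cases hi : i = c
        · subst hi; simpa using hasDerivAt_id' (0 : ℝ)
        · simpa [hi] using hasDerivAt_const (0 : ℝ) (0 : ℝ)
      have := (hf (x + Pi.single c (0 : ℝ))).hasFDerivAt.comp_hasDerivAt (0 : ℝ) hl
      simpa using this.unique (d1 c x)
    conv_lhs => rw [← Finset.univ_sum_single v]
    rw [map_sum]
    refine Finset.sum_congr rfl fun c _ => ?_
    rw [← e c, ← smul_eq_mul, ← map_smul]
    congr 1
    simp [← Pi.single_smul]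
  have hscale : ∀ θ (x : ι → ℝ), ∑ i, |(w θ * x) i| ≤ 1 * ∑ i, |x i| + 0 := fun θ x => by
    rw [one_mul, add_zero]
    refine Finset.sum_le_sum fun i _ => ?_
    rw [Pi.mul_apply, abs_mul]
    exact mul_le_of_le_one_left (abs_nonneg _) (bw θ i)
  have hcont : ∀ θ, Continuous fun x : ι → ℝ => w θ * x := fun θ => by fun_prop
  choose C hC0 hC using fun c => (g1 c).exists_nonneg
  obtain ⟨D, hDdef⟩ : ∃ D, D = ∑ c, C c := ⟨_, rfl⟩
  have hD : ∀ c, C c ≤ D := fun c => hDdef ▸ Finset.single_le_sum (fun c _ => hC0 c) (Finset.mem_univ c)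
  have hD0 : 0 ≤ D := hDdef ▸ Finset.sum_nonneg fun c _ => hC0 c
  have key : HasDerivAt (fun θ => ∫ x, f (w θ * x) ∂gaussPi ι)
      (∫ x, ∑ c, w' θ c * x c * f1 c (w θ * x) ∂gaussPi ι) θ := by
    refine hasDerivAt_integral_gaussPi (F := fun θ x => f (w θ * x))
      (F' := fun θ x => ∑ c, w' θ c * x c * f1 c (w θ * x))
      (fun s => hf.continuous.comp (hcont s)) ?_ (gf.comp 1 0 (hscale θ)) ((1 + D))
      (fun s _ x => ?_) (fun s _ x => ?_)
    · exact continuous_finsetSum _ fun c _ => by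
        have := (h1 c).comp (hcont θ)
        fun_prop
    · have h0 : 0 ≤ ∑ i, |x i| := Finset.sum_nonneg fun _ _ => abs_nonneg _
      calc |∑ c, w' s c * x c * f1 c (w s * x)| ≤ ∑ c, |w' s c * x c * f1 c (w s * x)| :=
            Finset.abs_sum_le_sum_abs _ _
        _ ≤ ∑ c, |x c| * (D * Real.exp (D * ∑ i, |x i|)) := by
            refine Finset.sum_le_sum fun c _ => ?_
            rw [abs_mul, abs_mul]
            gcongr
            · exact mul_le_of_le_one_left (abs_nonneg _) (bw' s c)
            · refine (hC c _).trans ((ExpGrowth.mono_const (hD c) (hC0 c) _).trans ?_)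
              have := hscale s x
              rw [one_mul, add_zero] at this
              exact mul_le_mul_of_nonneg_left (Real.exp_le_exp.2
                (mul_le_mul_of_nonneg_left this hD0)) hD0
        _ = (∑ c, |x c|) * (D * Real.exp (D * ∑ i, |x i|)) := by rw [Finset.sum_mul]
        _ ≤ Real.exp (∑ i, |x i|) * (D * Real.exp (D * ∑ i, |x i|)) := by
            gcongr
            linarith [Real.add_one_le_exp (∑ i, |x i|)]
        _ = D * Real.exp ((1 + D) * ∑ i, |x i|) := by rw [add_mul, one_mul, Real.exp_add]; ring
        _ ≤ _ := by gcongr; linarith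
    · have hl : HasDerivAt (fun θ => w θ * x) (w' s * x) s := by
        rw [hasDerivAt_pi]
        exact fun i => (hw s i).mul_const (x i)
      have := (hf (w s * x)).hasFDerivAt.comp_hasDerivAt s hl
      rw [hfd] at this
      exact this
  refine key.congr_deriv ?_
  -- Integration by parts removes the factor `x c` at the price of a second derivative; the chain
  -- rule contributes another `w θ c`.
  have hint : ∀ c, ∫ x, x c * f1 c (w θ * x) ∂gaussPi ι =
      ∫ x, w θ c * f2 c (w θ * x) ∂gaussPi ι := fun c => by
    refine integral_gaussPi_coord_mul c ((h1 c).comp (hcont θ))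
      (((h2 c).comp (hcont θ)).const_mul _) ((g1 c).comp 1 0 (hscale θ))
      ((ExpGrowth.const _).mul ((g2 c).comp 1 0 (hscale θ))) fun x => ?_
    have h := (d2 c (w θ * x))
    have hl : HasDerivAt (fun t : ℝ => w θ c * t) (w θ c) 0 := by
      simpa using (hasDerivAt_id (0 : ℝ)).const_mul (w θ c)
    have h' := HasDerivAt.comp (0 : ℝ) (h₂ := fun t : ℝ => f1 c (w θ * x + Pi.single c t))
      (h := fun t => w θ c * t) (by simpa using h) hl
    rw [mul_comm]
    refine h'.congr_of_eventuallyEq (Filter.Eventually.of_forall fun t => ?_)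
    simp only [Function.comp]
    congr 1
    ext i
    by_cases hi : i = c
    · subst hi; simp; ring
    · simp [hi]
  rw [integral_finsetSum]
  · refine Finset.sum_congr rfl fun c _ => ?_
    simp only [mul_assoc]
    rw [integral_const_mul, hint, integral_const_mul]
    ring
  · intro c _
    have hc := ((ExpGrowth.const (w' θ c)).mul (ExpGrowth.eval c)).mul ((g1 c).comp 1 0 (hscale θ))
    refine hc.integrable_of_continuous ?_
    have := (h1 c).comp (hcont θ)
    fun_prop

end CameronMartin

/-! ### Linear images of Gaussian vectors. -/

section Law

variable {ι κ : Type*} [Fintype ι] [Fintype κ]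

theorem integral_cexp_gaussPi (w : ι → ℝ) :
    ∫ x, Complex.exp ((∑ i, w i * x i : ℝ) * Complex.I) ∂gaussPi ι =
      Complex.exp (-(∑ i, w i ^ 2 : ℝ) / 2) := by
  have h : ∀ x : ι → ℝ, Complex.exp ((∑ i, w i * x i : ℝ) * Complex.I) =
      ∏ i, Complex.exp (w i * x i * Complex.I) := fun x => by
    rw [← Complex.exp_sum]
    push_cast
    rw [Finset.sum_mul]
  simp only [h]
  rw [gaussPi, integral_fintype_prod_eq_prod (fun i (y : ℝ) => Complex.exp (w i * y * Complex.I))]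
  have h1 : ∀ i, ∫ y : ℝ, Complex.exp (w i * y * Complex.I) ∂gaussianReal 0 1 =
      Complex.exp (-(w i : ℂ) ^ 2 / 2) := fun i => by
    have := charFun_gaussianReal (μ := 0) (v := 1) (w i)
    rw [charFun_apply_real] at this
    rw [this]
    congr 1
    simp
    ring
  simp only [h1]
  rw [← Complex.exp_sum]
  congr 1
  push_cast
  rw [← Finset.sum_neg_distrib, Finset.sum_div]

theorem measurable_mulVec (M : Matrix ι κ ℝ) : Measurable (fun x : κ → ℝ => M.mulVec x) :=
  (Continuous.matrix_mulVec continuous_const continuous_id).measurable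

theorem charFunDual_gaussPi_map_mulVec [DecidableEq ι] (M : Matrix ι κ ℝ) (L : (ι → ℝ) →L[ℝ] ℝ) :
    charFunDual ((gaussPi κ).map (fun x => M.mulVec x)) L =
      Complex.exp (-((fun i => L (Pi.single i 1)) ⬝ᵥ
        (M * M.transpose).mulVec (fun i => L (Pi.single i 1)) : ℝ) / 2) := by
  have hL : ∀ v : ι → ℝ, L v = (fun i => L (Pi.single i 1)) ⬝ᵥ v := fun v => by
    conv_lhs => rw [← Finset.univ_sum_single v]
    rw [map_sum, dotProduct]
    refine Finset.sum_congr rfl fun c _ => ?_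
    rw [mul_comm, ← smul_eq_mul, ← map_smul]
    congr 1
    simp [← Pi.single_smul]
  have hm := measurable_mulVec M
  rw [charFunDual_apply, integral_map hm.aemeasurable
    (Continuous.aestronglyMeasurable (by fun_prop))]
  set ℓ : ι → ℝ := fun i => L (Pi.single i 1)
  have : ∀ x : κ → ℝ, L (M.mulVec x) = ∑ j, (M.transpose.mulVec ℓ) j * x j := fun x => by
    rw [hL, Matrix.dotProduct_mulVec, ← Matrix.mulVec_transpose]
    rfl
  simp only [this]
  rw [integral_cexp_gaussPi]
  congr 4
  rw [← Matrix.mulVec_mulVec, Matrix.dotProduct_mulVec, ← Matrix.mulVec_transpose, dotProduct]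
  exact Finset.sum_congr rfl fun i _ => sq _

/-- The law of a linear image of a standard Gaussian vector depends on the covariance only. -/
theorem gaussPi_map_mulVec_eq {κ' : Type*} [Fintype κ'] (M : Matrix ι κ ℝ) (M' : Matrix ι κ' ℝ)
    (h : M * M.transpose = M' * M'.transpose) :
    (gaussPi κ).map (fun x => M.mulVec x) = (gaussPi κ').map (fun x => M'.mulVec x) := by
  classical
  have := Measure.isProbabilityMeasure_map (μ := gaussPi κ) (measurable_mulVec M).aemeasurable
  have := Measure.isProbabilityMeasure_map (μ := gaussPi κ') (measurable_mulVec M').aemeasurable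
  refine Measure.ext_of_charFunDual ?_
  ext L
  rw [charFunDual_gaussPi_map_mulVec, charFunDual_gaussPi_map_mulVec, h]

end Law

/-! ### Haar probability measure on the unitary group. -/

section UnitaryHaar

variable {n : Type*} [Fintype n] [DecidableEq n]

noncomputable instance : MeasurableSpace (Matrix.unitaryGroup n ℂ) := borel _
instance : BorelSpace (Matrix.unitaryGroup n ℂ) := ⟨rfl⟩

instance : CompactSpace (Matrix.unitaryGroup n ℂ) := by
  refine isCompact_iff_compactSpace.1 ?_
  refine Metric.isCompact_of_isClosed_isBounded (isClosed_unitary (R := Matrix n n ℂ)) ?_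
  rw [Metric.isBounded_iff_subset_closedBall 0]
  refine ⟨1, fun U hU => ?_⟩
  rw [mem_closedBall_zero_iff]
  rcases isEmpty_or_nonempty n with h | h
  · rw [Subsingleton.elim U 0]; simp
  · exact (CStarRing.norm_of_mem_unitary (hU : U ∈ unitary (Matrix n n ℂ))).le

/-- The Haar probability measure on the unitary group. -/
noncomputable def unitaryHaar (n : Type*) [Fintype n] [DecidableEq n] :
    Measure (Matrix.unitaryGroup n ℂ) := Measure.haarMeasure ⊤

instance : IsProbabilityMeasure (unitaryHaar n) := ⟨Measure.haarMeasure_self (K₀ := ⊤)⟩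
instance : (unitaryHaar n).IsHaarMeasure := by unfold unitaryHaar; infer_instance
-- A right translate of the Haar measure is again a left-invariant probability measure, hence equal
-- to it by uniqueness.
instance : (unitaryHaar n).IsMulRightInvariant where
  map_mul_right_eq_self g := by
    have := Measure.isProbabilityMeasure_map (μ := unitaryHaar n) (f := (· * g)) (by fun_prop)
    have : ((unitaryHaar n).map (· * g)).IsHaarMeasure := by infer_instance
    exact Measure.isHaarMeasure_eq_of_isProbabilityMeasure _ _

end UnitaryHaar

theorem Continuous.integrable_of_compactSpace {X E : Type*} [TopologicalSpace X] [CompactSpace X]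
    [MeasurableSpace X] [OpensMeasurableSpace X] [SecondCountableTopology X] {μ : Measure X}
    [IsFiniteMeasure μ] [NormedAddCommGroup E] [SecondCountableTopologyEither X E]
    {f : X → E} (hf : Continuous f) :
    Integrable f μ := by
  obtain ⟨C, hC⟩ := isCompact_univ.exists_bound_of_continuousOn hf.continuousOn
  exact Integrable.of_bound hf.aestronglyMeasurable C
    (Filter.Eventually.of_forall fun x => hC x (Set.mem_univ x))

/-! ### Positivity of powers and exponentials of positive kernels. -/

section PositiveKernel

open scoped ComplexOrder

variable {X ι : Type*} [TopologicalSpace X] [CompactSpace X] [SecondCountableTopology X]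
  [MeasurableSpace X] [BorelSpace X] {μ : Measure X} [IsFiniteMeasure μ] [Fintype ι]

/-- The Schur product theorem in integral form: expanding one factor of the kernel gives the same
integral with a lower power and `f` replaced by `φ w * f`. The induction ends at `|∫ f|²`. -/
theorem integral_pow_kernel_nonneg {φ : ι → X → ℝ} (hφ : ∀ w, Continuous (φ w)) (m : ℕ)
    {f : X → ℂ} (hf : Continuous f) :
    0 ≤ ∫ p, ((∑ w, φ w p.1 * φ w p.2 : ℝ) : ℂ) ^ m * (f p.1 * star (f p.2)) ∂(μ.prod μ) := by
  induction m generalizing f with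
  | zero =>
    simp only [pow_zero, one_mul]
    rw [integral_prod_mul (f := f) (g := fun x => star (f x))]
    have : ∫ x, star (f x) ∂μ = star (∫ x, f x ∂μ) := integral_conj
    rw [this]
    exact mul_star_self_nonneg _
  | succ m ih =>
    have h : ∀ p : X × X, ((∑ w, φ w p.1 * φ w p.2 : ℝ) : ℂ) ^ (m + 1) * (f p.1 * star (f p.2)) =
        ∑ w, ((∑ w, φ w p.1 * φ w p.2 : ℝ) : ℂ) ^ m *
          ((φ w p.1 * f p.1) * star (φ w p.2 * f p.2)) := fun p => by
      rw [pow_succ, mul_assoc, ← Finset.mul_sum]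
      congr 1
      push_cast
      rw [Finset.sum_mul]
      refine Finset.sum_congr rfl fun w _ => ?_
      simp
      ring
    simp only [h]
    rw [integral_finsetSum]
    · exact Finset.sum_nonneg fun w _ => ih (f := fun x => φ w x * f x) (by fun_prop)
    · intro w _
      exact Continuous.integrable_of_compactSpace (by fun_prop)

/-- The exponential series has nonnegative coefficients, so this is a dominated limit of nonnegative
combinations of the integrals for powers. -/
theorem integral_exp_kernel_nonneg {φ : ι → X → ℝ} (hφ : ∀ w, Continuous (φ w))
    {f : X → ℂ} (hf : Continuous f) :
    0 ≤ ∫ p, ((Real.exp (∑ w, φ w p.1 * φ w p.2) : ℝ) : ℂ) * (f p.1 * star (f p.2))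
      ∂(μ.prod μ) := by
  have hS : Continuous fun p : X × X => ∑ w, φ w p.1 * φ w p.2 := by fun_prop
  obtain ⟨C, hC⟩ := isCompact_univ.exists_bound_of_continuousOn hS.continuousOn
  obtain ⟨D, hD⟩ := isCompact_univ.exists_bound_of_continuousOn
    (f := fun p : X × X => f p.1 * star (f p.2)) (Continuous.continuousOn (by fun_prop))
  have hlim : Filter.Tendsto (fun N => ∫ p, (∑ m ∈ Finset.range N,
      ((∑ w, φ w p.1 * φ w p.2 : ℝ) : ℂ) ^ m / (m.factorial : ℂ)) * (f p.1 * star (f p.2))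
      ∂(μ.prod μ)) Filter.atTop
      (nhds (∫ p, ((Real.exp (∑ w, φ w p.1 * φ w p.2) : ℝ) : ℂ) * (f p.1 * star (f p.2))
      ∂(μ.prod μ))) := by
    refine tendsto_integral_of_dominated_convergence (fun _ => Real.exp C * D) ?_
      (integrable_const _) ?_ ?_
    · exact fun N => Continuous.aestronglyMeasurable (by fun_prop)
    · refine fun N => Filter.Eventually.of_forall fun p => ?_
      rw [norm_mul]
      refine mul_le_mul ?_ (hD p trivial) (norm_nonneg _) (Real.exp_pos _).le
      refine (norm_sum_le _ _).trans ?_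
      have hC0 : 0 ≤ C := (norm_nonneg _).trans (hC p trivial)
      refine le_trans (Finset.sum_le_sum fun m _ => ?_) (Real.sum_le_exp_of_nonneg hC0 N)
      rw [norm_div, norm_pow, Complex.norm_natCast, Complex.norm_real]
      gcongr
      exact hC p trivial
    · refine Filter.Eventually.of_forall fun p => Filter.Tendsto.mul_const _ ?_
      rw [Complex.ofReal_exp, Complex.exp_eq_exp_ℂ]
      exact (NormedSpace.expSeries_div_hasSum_exp _).tendsto_sum_nat
  refine ge_of_tendsto' hlim fun N => ?_
  simp only [Finset.sum_mul]
  rw [integral_finsetSum]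
  · refine Finset.sum_nonneg fun m _ => ?_
    have := integral_pow_kernel_nonneg (μ := μ) hφ m hf
    simp only [div_mul_eq_mul_div, integral_div]
    exact div_nonneg this (by positivity)
  · intro m _
    exact Continuous.integrable_of_compactSpace (by fun_prop)

end PositiveKernel

/-! ### Moments of a pair of unitary matrices under an exponential weight. -/

section Phases

variable {n r : Type*} [Fintype n] [DecidableEq n]

theorem continuous_unitaryGroup_apply (i j : n) :
    Continuous fun U : Matrix.unitaryGroup n ℂ => (U : Matrix n n ℂ) i j :=
  continuous_subtype_val.matrix_elem i j

/-- The exponential weight `exp (Re ∑ x_l (U B Vᴴ)_{ll})`. -/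
noncomputable def phaseWeight (x : n → ℝ) (B : Matrix n n ℂ)
    (p : Matrix.unitaryGroup n ℂ × Matrix.unitaryGroup n ℂ) : ℝ :=
  Real.exp (∑ l, x l * (((p.1 : Matrix n n ℂ) * B * (p.2 : Matrix n n ℂ).conjTranspose) l l).re)

theorem continuous_mul_mul_conjTranspose (Y : Matrix n n ℂ) :
    Continuous fun p : Matrix.unitaryGroup n ℂ × Matrix.unitaryGroup n ℂ =>
      (p.1 : Matrix n n ℂ) * Y * (p.2 : Matrix n n ℂ).conjTranspose :=
  ((continuous_subtype_val.comp continuous_fst).matrix_mul continuous_const).matrix_mul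
    (continuous_subtype_val.comp continuous_snd).matrix_conjTranspose

theorem continuous_phaseWeight (x : n → ℝ) (B : Matrix n n ℂ) : Continuous (phaseWeight x B) := by
  have h : ∀ l, Continuous fun p : Matrix.unitaryGroup n ℂ × Matrix.unitaryGroup n ℂ =>
      ((p.1 : Matrix n n ℂ) * B * (p.2 : Matrix n n ℂ).conjTranspose) l l :=
    fun l => (continuous_mul_mul_conjTranspose B).matrix_elem l l
  unfold phaseWeight
  fun_prop

/-- The diagonal unitary matrix with entry `I` at `i` and `1` elsewhere. -/
noncomputable def phaseAt (i : n) : Matrix.unitaryGroup n ℂ :=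
  ⟨Matrix.diagonal (Function.update 1 i Complex.I), by
    rw [Matrix.mem_unitaryGroup_iff, Matrix.star_eq_conjTranspose, Matrix.diagonal_conjTranspose,
      Matrix.diagonal_mul_diagonal, ← Matrix.diagonal_one]
    congr 1
    ext j
    by_cases h : j = i
    · subst h; simp
    · simp [h]⟩

theorem phaseAt_mul_apply (i : n) (Y : Matrix n r ℂ) (k : n) (l : r) :
    ((phaseAt i : Matrix n n ℂ) * Y) k l = (if k = i then Complex.I else 1) * Y k l := by
  rw [phaseAt, Matrix.diagonal_mul]
  by_cases h : k = i
  · subst h; simp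
  · simp [h]

theorem mul_phaseAt_apply (i : n) (Y : Matrix r n ℂ) (k : r) (l : n) :
    (Y * (phaseAt i : Matrix n n ℂ)) k l = Y k l * (if l = i then Complex.I else 1) := by
  rw [phaseAt, Matrix.mul_diagonal]
  by_cases h : l = i
  · subst h; simp
  · simp [h]

theorem mul_phaseAt_conjTranspose_apply (i : n) (Y : Matrix r n ℂ) (k : r) (l : n) :
    (Y * (phaseAt i : Matrix n n ℂ).conjTranspose) k l =
      Y k l * (if l = i then -Complex.I else 1) := by
  rw [phaseAt, Matrix.diagonal_conjTranspose, Matrix.mul_diagonal]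
  by_cases h : l = i
  · subst h; simp
  · simp [h]

/-- The weight sees only diagonal entries, and conjugation by a diagonal unitary fixes these: the
phases `I` and `-I` cancel. -/
theorem phaseWeight_phaseAt_mul (x : n → ℝ) (B : Matrix n n ℂ) (i : n)
    (p : Matrix.unitaryGroup n ℂ × Matrix.unitaryGroup n ℂ) :
    phaseWeight x B ((phaseAt i, phaseAt i) * p) = phaseWeight x B p := by
  unfold phaseWeight
  congr 1
  refine Finset.sum_congr rfl fun l _ => ?_
  congr 2
  simp only [Prod.fst_mul, Prod.snd_mul, Submonoid.coe_mul, Matrix.conjTranspose_mul]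
  rw [← Matrix.mul_assoc, mul_phaseAt_conjTranspose_apply, Matrix.mul_assoc, Matrix.mul_assoc,
    phaseAt_mul_apply, ← Matrix.mul_assoc]
  by_cases h : l = i
  · simp only [h, if_true]
    linear_combination (-((p.1 : Matrix n n ℂ) * B * (p.2 : Matrix n n ℂ).conjTranspose) i i) *
      Complex.I_mul_I
  · simp [h]

/-- By Haar invariance the integral equals `c` times itself. -/
theorem integral_eq_zero_of_mul_left
    {F : Matrix.unitaryGroup n ℂ × Matrix.unitaryGroup n ℂ → ℂ}
    (g : Matrix.unitaryGroup n ℂ × Matrix.unitaryGroup n ℂ) (c : ℂ) (hc : c ≠ 1)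
    (h : ∀ p, F (g * p) = c * F p) : ∫ p, F p ∂((unitaryHaar n).prod (unitaryHaar n)) = 0 := by
  have hT := integral_mul_left_eq_self (μ := (unitaryHaar n).prod (unitaryHaar n)) F g
  simp only [h, integral_const_mul] at hT
  have : (c - 1) * ∫ p, F p ∂((unitaryHaar n).prod (unitaryHaar n)) = 0 := by
    rw [sub_mul, hT, one_mul, sub_self]
  exact (mul_eq_zero.1 this).resolve_left (sub_ne_zero.2 hc)

theorem integral_eq_zero_of_mul_right
    {F : Matrix.unitaryGroup n ℂ × Matrix.unitaryGroup n ℂ → ℂ}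
    (g : Matrix.unitaryGroup n ℂ × Matrix.unitaryGroup n ℂ) (c : ℂ) (hc : c ≠ 1)
    (h : ∀ p, F (p * g) = c * F p) : ∫ p, F p ∂((unitaryHaar n).prod (unitaryHaar n)) = 0 := by
  have hT := integral_mul_right_eq_self (μ := (unitaryHaar n).prod (unitaryHaar n)) F g
  simp only [h, integral_const_mul] at hT
  have : (c - 1) * ∫ p, F p ∂((unitaryHaar n).prod (unitaryHaar n)) = 0 := by
    rw [sub_mul, hT, one_mul, sub_self]
  exact (mul_eq_zero.1 this).resolve_left (sub_ne_zero.2 hc)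

/-- The product contains no complex conjugate: rotating row `i` by the phase `I`, on both unitaries,
multiplies each factor by `I` and hence the integrand by `-1`, while the weight stays put. For `i =
j` the two phases would cancel. -/
theorem integral_phaseWeight_mul_offDiag (x : n → ℝ) (B Y Y' : Matrix n n ℂ) {i j : n}
    (hij : i ≠ j) :
    ∫ p, (phaseWeight x B p : ℂ) *
      (((p.1 : Matrix n n ℂ) * Y * (p.2 : Matrix n n ℂ).conjTranspose) i j *
        ((p.1 : Matrix n n ℂ) * Y' * (p.2 : Matrix n n ℂ).conjTranspose) i j)
      ∂((unitaryHaar n).prod (unitaryHaar n)) = 0 := by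
  refine integral_eq_zero_of_mul_left (phaseAt i, phaseAt i) (-1) (by norm_num) fun p => ?_
  have h : ∀ Y : Matrix n n ℂ, (((((phaseAt i, phaseAt i) * p).1 : Matrix n n ℂ)) * Y *
      ((((phaseAt i, phaseAt i) * p).2 : Matrix n n ℂ)).conjTranspose) i j =
      Complex.I * ((p.1 : Matrix n n ℂ) * Y * (p.2 : Matrix n n ℂ).conjTranspose) i j := fun Y => by
    simp only [Prod.fst_mul, Prod.snd_mul, Submonoid.coe_mul, Matrix.conjTranspose_mul]
    rw [← Matrix.mul_assoc, mul_phaseAt_conjTranspose_apply, Matrix.mul_assoc, Matrix.mul_assoc,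
      phaseAt_mul_apply, ← Matrix.mul_assoc]
    simp [hij.symm]
  rw [phaseWeight_phaseAt_mul, h, h]
  linear_combination ((phaseWeight x B p : ℂ) *
      (((p.1 : Matrix n n ℂ) * Y * (p.2 : Matrix n n ℂ).conjTranspose) i j *
        ((p.1 : Matrix n n ℂ) * Y' * (p.2 : Matrix n n ℂ).conjTranspose) i j)) * Complex.I_mul_I

/-- Here only the second unitary acts, so the phase at `j` multiplies each factor by `-I` with
nothing to compensate it. -/
theorem integral_phaseWeight_mul_right (x : n → ℝ) (B : Matrix n n ℂ) (Y Y' : Matrix r n ℂ) (i : r)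
    (j : n) :
    ∫ p, (phaseWeight x B p : ℂ) *
      ((Y * (p.2 : Matrix n n ℂ).conjTranspose) i j *
        (Y' * (p.2 : Matrix n n ℂ).conjTranspose) i j)
      ∂((unitaryHaar n).prod (unitaryHaar n)) = 0 := by
  refine integral_eq_zero_of_mul_left (phaseAt j, phaseAt j) (-1) (by norm_num) fun p => ?_
  have h : ∀ Y : Matrix r n ℂ, (Y *
      ((((phaseAt j, phaseAt j) * p).2 : Matrix n n ℂ)).conjTranspose) i j =
      (Y * (p.2 : Matrix n n ℂ).conjTranspose) i j * (-Complex.I) := fun Y => by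
    simp only [Prod.snd_mul, Submonoid.coe_mul, Matrix.conjTranspose_mul]
    rw [← Matrix.mul_assoc, mul_phaseAt_conjTranspose_apply]
    simp
  rw [phaseWeight_phaseAt_mul, h, h]
  linear_combination ((phaseWeight x B p : ℂ) *
      ((Y * (p.2 : Matrix n n ℂ).conjTranspose) i j *
        (Y' * (p.2 : Matrix n n ℂ).conjTranspose) i j)) * Complex.I_mul_I

theorem phaseWeight_mul_right (x : n → ℝ) (B : Matrix n n ℂ)
    (p g : Matrix.unitaryGroup n ℂ × Matrix.unitaryGroup n ℂ) :
    phaseWeight x B (p * g) =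
      phaseWeight x ((g.1 : Matrix n n ℂ) * B * (g.2 : Matrix n n ℂ).conjTranspose) p := by
  unfold phaseWeight
  simp only [Prod.fst_mul, Prod.snd_mul, Submonoid.coe_mul, Matrix.conjTranspose_mul,
    Matrix.mul_assoc]

theorem phaseWeight_diagonal (x σ : n → ℝ)
    (p : Matrix.unitaryGroup n ℂ × Matrix.unitaryGroup n ℂ) :
    phaseWeight x (Matrix.diagonal fun k => (σ k : ℂ)) p =
      Real.exp (∑ l, x l * ∑ k, σ k * ((p.1 : Matrix n n ℂ) l k *
        star ((p.2 : Matrix n n ℂ) l k)).re) := by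
  unfold phaseWeight
  congr 1
  refine Finset.sum_congr rfl fun l _ => ?_
  congr 1
  rw [Matrix.mul_apply, Complex.re_sum]
  refine Finset.sum_congr rfl fun k _ => ?_
  rw [Matrix.mul_diagonal, Matrix.conjTranspose_apply, ← Complex.re_ofReal_mul]
  congr 1
  ring

/-- The fourth moments of a pair of unitary matrices under the exponential weight. -/
noncomputable def phaseMoment (x σ : n → ℝ) (j k l k' l' : n) : ℂ :=
  ∫ p, (phaseWeight x (Matrix.diagonal fun k => (σ k : ℂ)) p : ℂ) *
    ((p.1 : Matrix n n ℂ) j k * (p.1 : Matrix n n ℂ) j l *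
      star ((p.2 : Matrix n n ℂ) j k' * (p.2 : Matrix n n ℂ) j l'))
    ∂((unitaryHaar n).prod (unitaryHaar n))

open scoped ComplexOrder in
-- The exponent is `∑ x_i σ_q Re (U_iq conj V_iq)`, a positive kernel with features `√(x_i σ_q) Re
-- U_iq` and `√(x_i σ_q) Im U_iq`. The moment is the quadratic form of its exponential at the
-- function `U_jk U_jl`.
theorem phaseMoment_nonneg {x σ : n → ℝ} (hx : ∀ l, 0 ≤ x l) (hσ : ∀ k, 0 ≤ σ k) (j k l : n) :
    0 ≤ phaseMoment x σ j k l k l := by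
  have h1 : Continuous fun U : Matrix.unitaryGroup n ℂ =>
      (U : Matrix n n ℂ) j k * (U : Matrix n n ℂ) j l :=
    (continuous_unitaryGroup_apply j k).mul (continuous_unitaryGroup_apply j l)
  have h2 : ∀ w : (n × n) × Bool, Continuous fun U : Matrix.unitaryGroup n ℂ =>
      Real.sqrt (x w.1.1 * σ w.1.2) * bif w.2 then ((U : Matrix n n ℂ) w.1.1 w.1.2).re
        else ((U : Matrix n n ℂ) w.1.1 w.1.2).im := fun ⟨⟨i, q⟩, b⟩ => by
    have := continuous_unitaryGroup_apply i q
    cases b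
    · exact (Complex.continuous_im.comp this).const_mul _
    · exact (Complex.continuous_re.comp this).const_mul _
  have := integral_exp_kernel_nonneg (μ := unitaryHaar n) h2 h1
  unfold phaseMoment
  convert this using 5 with p
  rw [phaseWeight_diagonal]
  congr 1
  rw [Fintype.sum_prod_type, Fintype.sum_prod_type]
  refine Finset.sum_congr rfl fun i _ => ?_
  rw [Finset.mul_sum]
  refine Finset.sum_congr rfl fun q _ => ?_
  have hs := Real.mul_self_sqrt (mul_nonneg (hx i) (hσ q))
  simp only [Fintype.sum_bool, cond_true, cond_false, Complex.mul_re, Complex.star_def,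
    Complex.conj_re, Complex.conj_im]
  linear_combination (-(((p.1 : Matrix n n ℂ) i q).re * ((p.2 : Matrix n n ℂ) i q).re +
    ((p.1 : Matrix n n ℂ) i q).im * ((p.2 : Matrix n n ℂ) i q).im)) * hs

/-- Multiply both unitaries on the right by a phase at one column `q`. The weight is unchanged, as
diagonal matrices commute, while the monomial acquires a factor. Unless `{k, l}` and `{k', l'}`
agree with multiplicity, some `q` makes this factor different from `1`: `l` if `k' = k`, `k` if `k'
= l`, and `k'` otherwise. -/
theorem phaseMoment_eq_zero (x σ : n → ℝ) {j k l k' l' : n}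
    (h : ¬ ((k' = k ∧ l' = l) ∨ (k' = l ∧ l' = k))) : phaseMoment x σ j k l k' l' = 0 := by
  obtain ⟨q, hq⟩ : ∃ q, ((if k = q then Complex.I else 1) * (if l = q then Complex.I else 1)) *
      ((if k' = q then -Complex.I else 1) * (if l' = q then -Complex.I else 1)) ≠ 1 := by
    have hI : Complex.I ≠ 1 := fun h => by simpa using congrArg Complex.re h
    have hI' : -Complex.I ≠ 1 := fun h => by simpa using congrArg Complex.re h
    have hI2 : (-1 : ℂ) ≠ 1 := by norm_num
    by_cases e1 : k' = k
    · have e2 : l' ≠ l := fun e => h (Or.inl ⟨e1, e⟩)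
      refine ⟨l, ?_⟩
      by_cases e : k = l <;> simp [e1, e2, e, hI]
    · by_cases e2 : k' = l
      · have e3 : l' ≠ k := fun e => h (Or.inr ⟨e2, e⟩)
        refine ⟨k, ?_⟩
        by_cases e : l = k <;> simp [e2, e3, e, hI]
      · refine ⟨k', ?_⟩
        by_cases e : l' = k' <;> simp [Ne.symm e1, Ne.symm e2, e, hI', hI2]
  refine integral_eq_zero_of_mul_right (phaseAt q, phaseAt q) _ hq fun p => ?_
  have hw : phaseWeight x (Matrix.diagonal fun k => (σ k : ℂ)) (p * (phaseAt q, phaseAt q)) =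
      phaseWeight x (Matrix.diagonal fun k => (σ k : ℂ)) p := by
    rw [phaseWeight_mul_right]
    congr 1
    ext u v
    rw [mul_phaseAt_conjTranspose_apply, phaseAt_mul_apply]
    by_cases huv : u = v
    · subst huv
      by_cases hu : u = q <;> simp [hu]
      linear_combination (-(σ q : ℂ)) * Complex.I_mul_I
    · simp [huv]
  rw [hw]
  simp only [Prod.fst_mul, Prod.snd_mul, Submonoid.coe_mul, mul_phaseAt_apply, star_mul']
  have hs : ∀ P : Prop, [Decidable P] → star (if P then Complex.I else 1) =
      if P then -Complex.I else (1 : ℂ) := fun P _ => by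
    by_cases hP : P <;> simp [hP]
  rw [hs, hs]
  ring

end Phases

/-! ### Diagonal entries of the Haar average. -/

/-- The exchange term alone has no sign. Adding the summand with `K` and `L` swapped, which the
symmetry of `C` permits, turns both terms together into `C K L |v_kK v_lL + v_kL v_lK|²`. -/
theorem re_sum_mul_diagonal_swap_nonneg {n : Type*} [Fintype n] (v : Matrix n n ℂ) {C : n → n → ℝ}
    (hC : ∀ K L, 0 ≤ C K L) (hs : ∀ K L, C K L = C L K) (k l : n) :
    0 ≤ (∑ K, ∑ L, (C K L : ℂ) * (v k K * star (v k K) * (v l L * star (v l L)) +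
      v k K * star (v l K) * (v l L * star (v k L)))).re := by
  have h1 : ∀ K L, ((C K L : ℂ) * (v k K * star (v k K) * (v l L * star (v l L)) +
      v k K * star (v l K) * (v l L * star (v k L)))).re +
      ((C L K : ℂ) * (v k L * star (v k L) * (v l K * star (v l K)) +
      v k L * star (v l L) * (v l K * star (v k K)))).re =
      C K L * Complex.normSq (v k K * v l L + v k L * v l K) := fun K L => by
    rw [hs L K, Complex.re_ofReal_mul, Complex.re_ofReal_mul, ← mul_add]
    congr 1
    simp [Complex.normSq_apply]
    ring
  have h2 := calc
    2 * (∑ K, ∑ L, (C K L : ℂ) * (v k K * star (v k K) * (v l L * star (v l L)) +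
      v k K * star (v l K) * (v l L * star (v k L)))).re
    _ = ∑ K, ∑ L, C K L * Complex.normSq (v k K * v l L + v k L * v l K) := by
      simp only [← h1, Finset.sum_add_distrib, Complex.re_sum]
      rw [two_mul]
      congr 1
      exact Finset.sum_comm
  have h3 : 0 ≤ ∑ K, ∑ L, C K L * Complex.normSq (v k K * v l L + v k L * v l K) :=
    Finset.sum_nonneg fun K _ => Finset.sum_nonneg fun L _ =>
      mul_nonneg (hC K L) (Complex.normSq_nonneg _)
  linarith

section InnerAverage

variable {n : Type*} [Fintype n] [DecidableEq n]

theorem mul_diagonal_mul_conjTranspose_apply (v : Matrix n n ℂ) (d : n → ℂ) (k l : n) :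
    (v * Matrix.diagonal d * v.conjTranspose) k l = ∑ K, v k K * d K * star (v l K) := by
  rw [Matrix.mul_apply]
  exact Finset.sum_congr rfl fun K _ => by
    rw [Matrix.mul_diagonal, Matrix.conjTranspose_apply]

theorem integral_phaseWeight_mul_diag (x σ : n → ℝ) (h h' : Matrix n n ℂ) (j : n) :
    ∫ p, (phaseWeight x (Matrix.diagonal fun k => (σ k : ℂ)) p : ℂ) *
      (((p.1 : Matrix n n ℂ) * (Matrix.diagonal (fun k => (σ k : ℂ)) * h) *
          (p.2 : Matrix n n ℂ).conjTranspose) j j *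
        ((p.1 : Matrix n n ℂ) * (Matrix.diagonal (fun k => (σ k : ℂ)) * h') *
          (p.2 : Matrix n n ℂ).conjTranspose) j j)
      ∂((unitaryHaar n).prod (unitaryHaar n)) =
    ∑ k, ∑ l, ∑ q : n × n, (σ k * σ l : ℂ) * (h k q.1 * h' l q.2) *
      phaseMoment x σ j k l q.1 q.2 := by
  have hexp : ∀ (h : Matrix n n ℂ) (p : Matrix.unitaryGroup n ℂ × Matrix.unitaryGroup n ℂ),
      ((p.1 : Matrix n n ℂ) * (Matrix.diagonal (fun k => (σ k : ℂ)) * h) *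
          (p.2 : Matrix n n ℂ).conjTranspose) j j =
      ∑ k, ∑ k', (p.1 : Matrix n n ℂ) j k * (σ k * h k k') * star ((p.2 : Matrix n n ℂ) j k') := by
    intro h p
    rw [Matrix.mul_assoc, Matrix.mul_apply]
    refine Finset.sum_congr rfl fun k _ => ?_
    rw [Matrix.mul_apply, Finset.mul_sum]
    refine Finset.sum_congr rfl fun k' _ => ?_
    rw [Matrix.diagonal_mul, Matrix.conjTranspose_apply]
    ring
  have hpt : ∀ p : Matrix.unitaryGroup n ℂ × Matrix.unitaryGroup n ℂ,
      (phaseWeight x (Matrix.diagonal fun k => (σ k : ℂ)) p : ℂ) *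
      (((p.1 : Matrix n n ℂ) * (Matrix.diagonal (fun k => (σ k : ℂ)) * h) *
          (p.2 : Matrix n n ℂ).conjTranspose) j j *
        ((p.1 : Matrix n n ℂ) * (Matrix.diagonal (fun k => (σ k : ℂ)) * h') *
          (p.2 : Matrix n n ℂ).conjTranspose) j j) =
      ∑ k, ∑ l, ∑ q : n × n, (σ k * σ l : ℂ) * (h k q.1 * h' l q.2) *
        ((phaseWeight x (Matrix.diagonal fun k => (σ k : ℂ)) p : ℂ) *
          ((p.1 : Matrix n n ℂ) j k * (p.1 : Matrix n n ℂ) j l *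
          star ((p.2 : Matrix n n ℂ) j q.1 * (p.2 : Matrix n n ℂ) j q.2))) := fun p => by
    rw [hexp, hexp, Finset.sum_mul_sum, Finset.mul_sum]
    refine Finset.sum_congr rfl fun k _ => ?_
    rw [Finset.mul_sum]
    refine Finset.sum_congr rfl fun l _ => ?_
    rw [Finset.sum_mul_sum, Finset.mul_sum, Fintype.sum_prod_type]
    refine Finset.sum_congr rfl fun k' _ => ?_
    rw [Finset.mul_sum]
    refine Finset.sum_congr rfl fun l' _ => ?_
    rw [star_mul']
    ring
  have hint : ∀ k l (q : n × n), Integrable (fun p : Matrix.unitaryGroup n ℂ × Matrix.unitaryGroup n ℂ =>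
      (σ k * σ l : ℂ) * (h k q.1 * h' l q.2) *
        ((phaseWeight x (Matrix.diagonal fun k => (σ k : ℂ)) p : ℂ) *
          ((p.1 : Matrix n n ℂ) j k * (p.1 : Matrix n n ℂ) j l *
          star ((p.2 : Matrix n n ℂ) j q.1 * (p.2 : Matrix n n ℂ) j q.2))))
      ((unitaryHaar n).prod (unitaryHaar n)) := fun k l q => by
    refine Continuous.integrable_of_compactSpace ?_
    have h1 := continuous_phaseWeight x (Matrix.diagonal fun k => (σ k : ℂ))
    have h2 := fun k => continuous_unitaryGroup_apply j k
    have h3 := fun k => (h2 k).comp (continuous_fst (X := Matrix.unitaryGroup n ℂ)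
      (Y := Matrix.unitaryGroup n ℂ))
    have h4 := fun k => (h2 k).comp (continuous_snd (X := Matrix.unitaryGroup n ℂ)
      (Y := Matrix.unitaryGroup n ℂ))
    exact continuous_const.mul ((Complex.continuous_ofReal.comp h1).mul
      (((h3 k).mul (h3 l)).mul ((h4 q.1).mul (h4 q.2)).star))
  simp only [hpt]
  rw [integral_finsetSum _ fun k _ => integrable_finsetSum _ fun l _ =>
    integrable_finsetSum _ fun q _ => hint k l q]
  refine Finset.sum_congr rfl fun k _ => ?_
  rw [integral_finsetSum _ fun l _ => integrable_finsetSum _ fun q _ => hint k l q]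
  refine Finset.sum_congr rfl fun l _ => ?_
  rw [integral_finsetSum _ fun q _ => hint k l q]
  refine Finset.sum_congr rfl fun q _ => ?_
  rw [integral_const_mul, phaseMoment]

open scoped ComplexOrder in
-- Once the entries are expanded, only the moments with `(k', l')` a permutation of `(k, l)`
-- survive. The two permutations share one nonnegative moment, so their coefficients may be added
-- before their sign is examined, and the sum is the form in `re_sum_mul_diagonal_swap_nonneg`.
theorem sum_integral_phaseWeight_diag_nonneg {x σ : n → ℝ} (hx : ∀ l, 0 ≤ x l)
    (hσ : ∀ k, 0 ≤ σ k) (v : Matrix n n ℂ) (y : n → ℝ) {T : Type*} [Fintype T] (a : T → ℝ)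
    (e e' : T → ℕ) (hC : ∀ K L, 0 ≤ ∑ t, a t * (y K ^ e t * y L ^ e' t))
    (hs : ∀ K L, ∑ t, a t * (y K ^ e t * y L ^ e' t) = ∑ t, a t * (y L ^ e t * y K ^ e' t))
    (j : n) :
    0 ≤ (∑ t, (a t : ℂ) * ∫ p, (phaseWeight x (Matrix.diagonal fun k => (σ k : ℂ)) p : ℂ) *
      (((p.1 : Matrix n n ℂ) * (Matrix.diagonal (fun k => (σ k : ℂ)) *
          (v * Matrix.diagonal (fun K => (y K : ℂ) ^ e t) * v.conjTranspose)) *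
          (p.2 : Matrix n n ℂ).conjTranspose) j j *
        ((p.1 : Matrix n n ℂ) * (Matrix.diagonal (fun k => (σ k : ℂ)) *
          (v * Matrix.diagonal (fun K => (y K : ℂ) ^ e' t) * v.conjTranspose)) *
          (p.2 : Matrix n n ℂ).conjTranspose) j j)
      ∂((unitaryHaar n).prod (unitaryHaar n))).re := by
  set C : n → n → ℝ := fun K L => ∑ t, a t * (y K ^ e t * y L ^ e' t) with hCdef
  let E : n → n → n → n → ℂ := fun k k' l l' =>
    ∑ K, ∑ L, (C K L : ℂ) * (v k K * star (v k' K) * (v l L * star (v l' L)))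
  have hE : ∀ k l k' l', ∑ t, (a t : ℂ) *
      ((v * Matrix.diagonal (fun K => (y K : ℂ) ^ e t) * v.conjTranspose) k k' *
        (v * Matrix.diagonal (fun K => (y K : ℂ) ^ e' t) * v.conjTranspose) l l') =
      E k k' l l' := fun k l k' l' => by
    have h0 : ∀ t, (a t : ℂ) *
      ((v * Matrix.diagonal (fun K => (y K : ℂ) ^ e t) * v.conjTranspose) k k' *
        (v * Matrix.diagonal (fun K => (y K : ℂ) ^ e' t) * v.conjTranspose) l l') =
        ∑ K, ∑ L, (a t : ℂ) * ((v k K * (y K : ℂ) ^ e t * star (v k' K)) *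
          (v l L * (y L : ℂ) ^ e' t * star (v l' L))) := fun t => by
      rw [mul_diagonal_mul_conjTranspose_apply, mul_diagonal_mul_conjTranspose_apply,
        Finset.sum_mul_sum, Finset.mul_sum]
      exact Finset.sum_congr rfl fun K _ => Finset.mul_sum _ _ _
    simp only [h0, E, hCdef]
    rw [Finset.sum_comm]
    refine Finset.sum_congr rfl fun K _ => ?_
    rw [Finset.sum_comm]
    refine Finset.sum_congr rfl fun L _ => ?_
    push_cast
    rw [Finset.sum_mul]
    refine Finset.sum_congr rfl fun t _ => ?_
    ring
  have hsum : (∑ t, (a t : ℂ) * ∫ p, (phaseWeight x (Matrix.diagonal fun k => (σ k : ℂ)) p : ℂ) *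
      (((p.1 : Matrix n n ℂ) * (Matrix.diagonal (fun k => (σ k : ℂ)) *
          (v * Matrix.diagonal (fun K => (y K : ℂ) ^ e t) * v.conjTranspose)) *
          (p.2 : Matrix n n ℂ).conjTranspose) j j *
        ((p.1 : Matrix n n ℂ) * (Matrix.diagonal (fun k => (σ k : ℂ)) *
          (v * Matrix.diagonal (fun K => (y K : ℂ) ^ e' t) * v.conjTranspose)) *
          (p.2 : Matrix n n ℂ).conjTranspose) j j)
      ∂((unitaryHaar n).prod (unitaryHaar n))) =
      ∑ k, ∑ l, ∑ q : n × n, (σ k * σ l : ℂ) * E k q.1 l q.2 * phaseMoment x σ j k l q.1 q.2 := by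
    simp only [integral_phaseWeight_mul_diag, ← hE, Finset.mul_sum]
    rw [Finset.sum_comm]
    refine Finset.sum_congr rfl fun k _ => ?_
    rw [Finset.sum_comm]
    refine Finset.sum_congr rfl fun l _ => ?_
    rw [Finset.sum_comm]
    refine Finset.sum_congr rfl fun q _ => ?_
    rw [Finset.sum_mul]
    refine Finset.sum_congr rfl fun t _ => ?_
    ring
  rw [hsum, Complex.re_sum]
  refine Finset.sum_nonneg fun k _ => ?_
  rw [Complex.re_sum]
  refine Finset.sum_nonneg fun l _ => ?_
  obtain ⟨N, hN0, hN⟩ : ∃ N : ℝ, 0 ≤ N ∧ phaseMoment x σ j k l k l = N := by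
    have h := phaseMoment_nonneg hx hσ j k l
    exact ⟨_, (Complex.nonneg_iff.1 h).1, (Complex.ext rfl (by simpa using (Complex.nonneg_iff.1 h).2.symm))⟩
  have hN' : phaseMoment x σ j k l l k = N := by
    rw [← hN]
    unfold phaseMoment
    simp only [mul_comm (((_ : Matrix.unitaryGroup n ℂ × Matrix.unitaryGroup n ℂ).2 :
      Matrix n n ℂ) j l)]
  have hpos : ∀ z : ℂ, 0 ≤ z.re → 0 ≤ ((σ k * σ l : ℂ) * z * N).re := fun z hz => by
    have : ((σ k * σ l : ℂ) * z * N) = ((σ k * σ l * N : ℝ) : ℂ) * z := by push_cast; ring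
    rw [this, Complex.re_ofReal_mul]
    exact mul_nonneg (mul_nonneg (mul_nonneg (hσ k) (hσ l)) hN0) hz
  -- For `k = l` the two permutations coincide and only the direct term occurs; it is then
  -- nonnegative term by term.
  rw [← Finset.sum_subset (Finset.subset_univ {(k, l), (l, k)})]
  · by_cases hkl : k = l
    · subst hkl
      simp only [Finset.pair_eq_singleton, Finset.sum_singleton, hN]
      refine hpos _ ?_
      simp only [E, Complex.re_sum]
      refine Finset.sum_nonneg fun K _ => Finset.sum_nonneg fun L _ => ?_
      rw [Complex.re_ofReal_mul, Complex.star_def, Complex.mul_conj, Complex.mul_conj, ← Complex.ofReal_mul, Complex.ofReal_re]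
      exact mul_nonneg (hC K L) (mul_nonneg (Complex.normSq_nonneg _) (Complex.normSq_nonneg _))
    · rw [Finset.sum_pair (by simp [hkl])]
      simp only [hN, hN']
      rw [← add_mul, ← mul_add]
      refine hpos _ ?_
      simp only [E, ← Finset.sum_add_distrib, ← mul_add]
      exact re_sum_mul_diagonal_swap_nonneg v hC hs k l
  · rintro ⟨k', l'⟩ _ hq
    rw [phaseMoment_eq_zero, mul_zero]
    simpa [Prod.ext_iff] using hq

end InnerAverage

/-! ### Singular value decomposition. -/

section SVD

variable {𝕜 : Type*} [RCLike 𝕜] {m n : Type*} [Fintype m] [DecidableEq m] [Fintype n]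
  [DecidableEq n]

open scoped ComplexOrder in
theorem Matrix.PosSemidef.exists_unitary_diagonal {H : Matrix n n 𝕜} (hH : H.PosSemidef) :
    ∃ V ∈ Matrix.unitaryGroup n 𝕜, ∃ y : n → ℝ, (∀ k, 0 ≤ y k) ∧
      H = V * Matrix.diagonal (fun k => (y k : 𝕜)) * V.conjTranspose := by
  refine ⟨hH.1.eigenvectorUnitary, hH.1.eigenvectorUnitary.2, hH.1.eigenvalues,
    hH.eigenvalues_nonneg, ?_⟩
  have := hH.1.spectral_theorem
  rw [Unitary.conjStarAlgAut_apply] at this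
  exact this

open scoped ComplexOrder in
/-- Singular value decomposition, with the singular values placed along an embedding of the
columns in the rows. -/
theorem Matrix.exists_svd (f : n ↪ m) (B : Matrix m n 𝕜) :
    ∃ U ∈ Matrix.unitaryGroup m 𝕜, ∃ V ∈ Matrix.unitaryGroup n 𝕜, ∃ σ : n → ℝ,
      (∀ k, 0 ≤ σ k) ∧
      B = U * (Matrix.of fun i j => if i = f j then (σ j : 𝕜) else 0) * V.conjTranspose := by
  obtain ⟨V, hV, y, hy, hH⟩ :=
    (Matrix.posSemidef_conjTranspose_mul_self B).exists_unitary_diagonal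
  have hVV : V.conjTranspose * V = 1 := Matrix.mem_unitaryGroup_iff'.1 hV
  have hVV' : V * V.conjTranspose = 1 := Matrix.mem_unitaryGroup_iff.1 hV
  have hW : (B * V).conjTranspose * (B * V) = Matrix.diagonal (fun k => (y k : 𝕜)) := by
    calc (B * V).conjTranspose * (B * V) = V.conjTranspose * (B.conjTranspose * B) * V := by
          rw [Matrix.conjTranspose_mul]; simp only [Matrix.mul_assoc]
      _ = (V.conjTranspose * V) * Matrix.diagonal (fun k => (y k : 𝕜)) *
            (V.conjTranspose * V) := by rw [hH]; simp only [Matrix.mul_assoc]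
      _ = _ := by rw [hVV, Matrix.one_mul, Matrix.mul_one]
  let w : n → EuclideanSpace 𝕜 m := fun j => WithLp.toLp 2 fun i => (B * V) i j
  have hinner : ∀ i j, inner 𝕜 (w i) (w j) = if i = j then (y i : 𝕜) else 0 := fun i j => by
    have := congrFun (congrFun hW i) j
    rw [Matrix.mul_apply, Matrix.diagonal_apply] at this
    rw [← this, PiLp.inner_apply]
    refine Finset.sum_congr rfl fun a _ => ?_
    simp [w, Matrix.conjTranspose_apply, mul_comm]
  have hw0 : ∀ j, y j = 0 → w j = 0 := fun j hj => by
    rw [← inner_self_eq_zero (𝕜 := 𝕜), hinner]; simp [hj]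
  let σ : n → ℝ := fun k => Real.sqrt (y k)
  have hσσ : ∀ k, σ k * σ k = y k := fun k => Real.mul_self_sqrt (hy k)
  let v : m → EuclideanSpace 𝕜 m := fun i =>
    if h : ∃ j, f j = i then ((σ h.choose)⁻¹ : 𝕜) • w h.choose else 0
  have hv : ∀ j, v (f j) = ((σ j)⁻¹ : 𝕜) • w j := fun j => by
    have hex : ∃ j', f j' = f j := ⟨j, rfl⟩
    have : hex.choose = j := f.injective hex.choose_spec
    simp only [v, dif_pos hex]
    rw [this]
  -- The columns of `B * V` are orthogonal with lengths `σ j`. The nonzero ones normalise to an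
  -- orthonormal family; where `σ j = 0` the column vanishes, so any completion to a basis will do.
  let s : Set m := {i | ∃ j, f j = i ∧ σ j ≠ 0}
  have horth : Orthonormal 𝕜 (s.domRestrict v) := by
    rw [orthonormal_iff_ite]
    rintro ⟨_, j, rfl, hj⟩ ⟨_, j', rfl, hj'⟩
    rw [Set.domRestrict_apply, Set.domRestrict_apply, hv, hv, inner_smul_left, inner_smul_right,
      hinner]
    have hj0 : (σ j : 𝕜) ≠ 0 := by exact_mod_cast hj
    by_cases h : j = j'
    · subst h
      simp only [if_true, map_inv₀, RCLike.conj_ofReal, ← hσσ]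
      push_cast
      field_simp
    · simp [h]
  obtain ⟨b, hb⟩ := horth.exists_orthonormalBasis_extension_of_card_eq (by simp)
  let U : Matrix m m 𝕜 := Matrix.of fun i k => b k i
  have hU : U ∈ Matrix.unitaryGroup m 𝕜 := by
    rw [Matrix.mem_unitaryGroup_iff', Matrix.star_eq_conjTranspose]
    ext i j
    have := orthonormal_iff_ite.1 b.orthonormal i j
    rw [Matrix.one_apply, ← this, PiLp.inner_apply, Matrix.mul_apply]
    refine Finset.sum_congr rfl fun a _ => ?_
    simp [U, Matrix.conjTranspose_apply, mul_comm]
  refine ⟨U, hU, V, hV, σ, fun k => Real.sqrt_nonneg _, ?_⟩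
  have key : B * V = U * (Matrix.of fun i j => if i = f j then (σ j : 𝕜) else 0) := by
    ext i j
    rw [Matrix.mul_apply (M := U), Finset.sum_eq_single (f j)]
    · simp only [Matrix.of_apply, if_true, U]
      by_cases hj : σ j = 0
      · have := congrArg (fun z : EuclideanSpace 𝕜 m => z i)
          (hw0 j (by rw [← hσσ, hj, mul_zero]))
        simpa [w, hj] using this
      · have hj0 : (σ j : 𝕜) ≠ 0 := by exact_mod_cast hj
        rw [hb (f j) ⟨j, rfl, hj⟩, hv]
        simp only [PiLp.smul_apply, smul_eq_mul, w]
        field_simp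
    · intro k _ hk; simp [hk]
    · simp
  rw [← key, Matrix.mul_assoc, hVV', Matrix.mul_one]

end SVD

/-! ### The Haar average over a two-sided unitary orbit. -/

section InnerAverage

variable {n r : Type*} [Fintype n] [DecidableEq n]

theorem conj_diagonal_pow {v : Matrix n n ℂ} (hv : v.conjTranspose * v = 1)
    (hv' : v * v.conjTranspose = 1) (d : n → ℂ) (q : ℕ) :
    (v * Matrix.diagonal d * v.conjTranspose) ^ q =
      v * Matrix.diagonal (fun k => d k ^ q) * v.conjTranspose := by
  induction q with
  | zero => simp [hv']
  | succ q ih =>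
    rw [pow_succ, ih]
    calc v * Matrix.diagonal (fun k => d k ^ q) * v.conjTranspose *
          (v * Matrix.diagonal d * v.conjTranspose)
        = v * (Matrix.diagonal (fun k => d k ^ q) * (v.conjTranspose * v) * Matrix.diagonal d) *
          v.conjTranspose := by simp only [Matrix.mul_assoc]
      _ = _ := by
        rw [hv, Matrix.mul_one, Matrix.diagonal_mul_diagonal]
        simp only [pow_succ]

/-- The two-sided unitary action on `A`, on the top square block on the left. -/
noncomputable def unitaryAct (p : Matrix.unitaryGroup n ℂ × Matrix.unitaryGroup n ℂ)
    (A : Matrix (n ⊕ r) n ℂ) : Matrix (n ⊕ r) n ℂ :=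
  Matrix.fromRows ((p.1 : Matrix n n ℂ) * A.toRows₁ * (p.2 : Matrix n n ℂ).conjTranspose)
    (A.toRows₂ * (p.2 : Matrix n n ℂ).conjTranspose)

theorem continuous_unitaryAct_apply (A : Matrix (n ⊕ r) n ℂ) (i : n ⊕ r) (j : n) :
    Continuous fun p => unitaryAct p A i j := by
  unfold unitaryAct
  rcases i with i | i
  · exact (continuous_mul_mul_conjTranspose A.toRows₁).matrix_elem i j
  · exact (continuous_const.matrix_mul
      (continuous_subtype_val.comp continuous_snd).matrix_conjTranspose).matrix_elem i j

open scoped ComplexOrder in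
-- The phases remove the lower rows and the off-diagonal entries. For a diagonal entry, the singular
-- vectors of the top block are absorbed by Haar invariance, which makes the weight diagonal and
-- reduces to `sum_integral_phaseWeight_diag_nonneg`. The eigenvalues of `AᴴA` enter `hC` through
-- their power sums, since they are chosen only inside the proof.
theorem integral_phaseWeight_unitaryAct_nonneg [Fintype r] {x : n → ℝ} (hx : ∀ l, 0 ≤ x l)
    (A : Matrix (n ⊕ r) n ℂ) {T : Type*} [Fintype T] (a : T → ℝ) (e e' : T → ℕ)
    (hC : ∀ y : n → ℝ, (∀ K, 0 ≤ y K) →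
      (∀ q, (((A.conjTranspose * A) ^ q).trace).re = ∑ K, y K ^ q) →
      ∀ K L, 0 ≤ ∑ t, a t * (y K ^ e t * y L ^ e' t))
    (hs : ∀ y z : ℝ, ∑ t, a t * (y ^ e t * z ^ e' t) = ∑ t, a t * (z ^ e t * y ^ e' t)) :
    0 ≤ ∫ p, phaseWeight x A.toRows₁ p * ∑ i, ∑ j, ∑ t, a t *
      (unitaryAct p (A * (A.conjTranspose * A) ^ e t) i j *
        unitaryAct p (A * (A.conjTranspose * A) ^ e' t) i j).re
      ∂((unitaryHaar n).prod (unitaryHaar n)) := by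
  set H := A.conjTranspose * A with hHdef
  have hint : ∀ i j t, Integrable (fun p => (phaseWeight x A.toRows₁ p : ℂ) *
      (unitaryAct p (A * H ^ e t) i j * unitaryAct p (A * H ^ e' t) i j))
      ((unitaryHaar n).prod (unitaryHaar n)) := fun i j t =>
    Continuous.integrable_of_compactSpace
      ((Complex.continuous_ofReal.comp (continuous_phaseWeight x _)).mul
        ((continuous_unitaryAct_apply _ i j).mul (continuous_unitaryAct_apply _ i j)))
  have h1 : ∫ p, phaseWeight x A.toRows₁ p * ∑ i, ∑ j, ∑ t, a t *
      (unitaryAct p (A * H ^ e t) i j * unitaryAct p (A * H ^ e' t) i j).re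
      ∂((unitaryHaar n).prod (unitaryHaar n)) =
      ∑ i, ∑ j, (∑ t, (a t : ℂ) * ∫ p, (phaseWeight x A.toRows₁ p : ℂ) *
      (unitaryAct p (A * H ^ e t) i j * unitaryAct p (A * H ^ e' t) i j)
      ∂((unitaryHaar n).prod (unitaryHaar n))).re := by
    have hpt : ∀ p, phaseWeight x A.toRows₁ p * ∑ i, ∑ j, ∑ t, a t *
      (unitaryAct p (A * H ^ e t) i j * unitaryAct p (A * H ^ e' t) i j).re =
      ∑ i, ∑ j, ∑ t, a t * ((phaseWeight x A.toRows₁ p : ℂ) *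
        (unitaryAct p (A * H ^ e t) i j * unitaryAct p (A * H ^ e' t) i j)).re := fun p => by
      simp only [Finset.mul_sum, Complex.re_ofReal_mul]
      refine Finset.sum_congr rfl fun i _ => Finset.sum_congr rfl fun j _ =>
        Finset.sum_congr rfl fun t _ => ?_
      ring
    have hint' : ∀ i j t, Integrable (fun p => a t * ((phaseWeight x A.toRows₁ p : ℂ) *
        (unitaryAct p (A * H ^ e t) i j * unitaryAct p (A * H ^ e' t) i j)).re)
        ((unitaryHaar n).prod (unitaryHaar n)) := fun i j t => (hint i j t).re.const_mul _
    simp only [hpt]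
    rw [integral_finsetSum _ fun i _ => integrable_finsetSum _ fun j _ =>
      integrable_finsetSum _ fun t _ => hint' i j t]
    refine Finset.sum_congr rfl fun i _ => ?_
    rw [integral_finsetSum _ fun j _ => integrable_finsetSum _ fun t _ => hint' i j t]
    refine Finset.sum_congr rfl fun j _ => ?_
    rw [integral_finsetSum _ fun t _ => hint' i j t, Complex.re_sum]
    refine Finset.sum_congr rfl fun t _ => ?_
    rw [integral_const_mul, Complex.re_ofReal_mul]
    congr 1
    exact integral_re (hint i j t)
  rw [h1, Fintype.sum_sum_type]
  have hbot : ∀ i : r, ∀ j t, ∫ p, (phaseWeight x A.toRows₁ p : ℂ) *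
      (unitaryAct p (A * H ^ e t) (Sum.inr i) j * unitaryAct p (A * H ^ e' t) (Sum.inr i) j)
      ∂((unitaryHaar n).prod (unitaryHaar n)) = 0 := fun i j t =>
    integral_phaseWeight_mul_right x _ _ _ i j
  have hoff : ∀ i j : n, i ≠ j → ∀ t, ∫ p, (phaseWeight x A.toRows₁ p : ℂ) *
      (unitaryAct p (A * H ^ e t) (Sum.inl i) j * unitaryAct p (A * H ^ e' t) (Sum.inl i) j)
      ∂((unitaryHaar n).prod (unitaryHaar n)) = 0 := fun i j hij t =>
    integral_phaseWeight_mul_offDiag x _ _ _ hij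
  simp only [hbot, mul_zero, Finset.sum_const_zero, Complex.zero_re, add_zero]
  refine Finset.sum_nonneg fun i _ => ?_
  rw [Finset.sum_eq_single i (fun j _ hj => by simp [hoff i j hj.symm]) (by simp)]
  obtain ⟨U, hU, V, hV, σ, hσ, hB⟩ := Matrix.exists_svd (Function.Embedding.refl n) A.toRows₁
  have hdiag : (Matrix.of fun i j => if i = (Function.Embedding.refl n) j then (σ j : ℂ) else 0) =
      Matrix.diagonal fun k => (σ k : ℂ) := by
    ext i j
    by_cases h : i = j
    · subst h; simp
    · simp [h]
  rw [RCLike.ofReal_eq_complex_ofReal, hdiag] at hB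
  obtain ⟨W, hW, y, hy, hH⟩ :=
    (Matrix.posSemidef_conjTranspose_mul_self A).exists_unitary_diagonal
  have hVV : V.conjTranspose * V = 1 := Matrix.mem_unitaryGroup_iff'.1 hV
  have hUU : U.conjTranspose * U = 1 := Matrix.mem_unitaryGroup_iff'.1 hU
  have hWW : W.conjTranspose * W = 1 := Matrix.mem_unitaryGroup_iff'.1 hW
  have hWW' : W * W.conjTranspose = 1 := Matrix.mem_unitaryGroup_iff.1 hW
  have hHq : ∀ q, H ^ q = W * Matrix.diagonal (fun k => (y k : ℂ) ^ q) * W.conjTranspose :=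
    fun q => by
      rw [hHdef, hH]
      exact conj_diagonal_pow hWW hWW' _ q
  have htr : ∀ q, ((H ^ q).trace).re = ∑ K, y K ^ q := fun q => by
    rw [hHq, Matrix.mul_assoc, Matrix.trace_mul_comm, Matrix.mul_assoc, hWW, Matrix.mul_one,
      Matrix.trace_diagonal, Complex.re_sum]
    exact Finset.sum_congr rfl fun K _ => by rw [← Complex.ofReal_pow, Complex.ofReal_re]
  -- `Vᴴ W` diagonalises the Gram matrix in the basis of right singular vectors of the top block.
  have hmain := sum_integral_phaseWeight_diag_nonneg hx hσ (V.conjTranspose * W) y a e e'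
    (hC y hy htr) (fun K L => hs _ _) i
  refine hmain.trans_eq ?_
  congr 1
  refine Finset.sum_congr rfl fun t _ => ?_
  congr 1
  rw [← integral_mul_right_eq_self (μ := (unitaryHaar n).prod (unitaryHaar n)) (fun p =>
    (phaseWeight x A.toRows₁ p : ℂ) * (unitaryAct p (A * H ^ e t) (Sum.inl i) i *
      unitaryAct p (A * H ^ e' t) (Sum.inl i) i))
      ((⟨U, hU⟩⁻¹, ⟨V, hV⟩⁻¹) : Matrix.unitaryGroup n ℂ × Matrix.unitaryGroup n ℂ)]
  have hinv : ∀ (U : Matrix n n ℂ) (hU : U ∈ Matrix.unitaryGroup n ℂ),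
      (((⟨U, hU⟩ : Matrix.unitaryGroup n ℂ)⁻¹ : Matrix.unitaryGroup n ℂ) : Matrix n n ℂ) =
        U.conjTranspose := fun U hU => rfl
  refine integral_congr_ae (Filter.Eventually.of_forall fun p => ?_)
  have hw : phaseWeight x A.toRows₁ (p * (⟨U, hU⟩⁻¹, ⟨V, hV⟩⁻¹)) =
      phaseWeight x (Matrix.diagonal fun k => (σ k : ℂ)) p := by
    rw [phaseWeight_mul_right, hB]
    congr 1
    simp only [hinv, Matrix.conjTranspose_conjTranspose]
    calc _ = (U.conjTranspose * U) * (Matrix.diagonal fun k => (σ k : ℂ)) *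
          (V.conjTranspose * V) := by simp only [Matrix.mul_assoc]
      _ = _ := by rw [hUU, hVV, Matrix.one_mul, Matrix.mul_one]
  have hact : ∀ q, unitaryAct (p * (⟨U, hU⟩⁻¹, ⟨V, hV⟩⁻¹)) (A * H ^ q) (Sum.inl i) i =
      ((p.1 : Matrix n n ℂ) * (Matrix.diagonal (fun k => (σ k : ℂ)) *
          (V.conjTranspose * W * Matrix.diagonal (fun K => (y K : ℂ) ^ q) *
            (V.conjTranspose * W).conjTranspose)) *
          (p.2 : Matrix n n ℂ).conjTranspose) i i := fun q => by
    have h0 : (A * H ^ q).toRows₁ = A.toRows₁ * H ^ q := rfl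
    have hmat : (p.1 : Matrix n n ℂ) * U.conjTranspose * (A * H ^ q).toRows₁ *
        ((p.2 : Matrix n n ℂ) * V.conjTranspose).conjTranspose =
        (p.1 : Matrix n n ℂ) * (Matrix.diagonal (fun k => (σ k : ℂ)) *
          (V.conjTranspose * W * Matrix.diagonal (fun K => (y K : ℂ) ^ q) *
            (V.conjTranspose * W).conjTranspose)) * (p.2 : Matrix n n ℂ).conjTranspose := by
      rw [h0, hB, hHq, Matrix.conjTranspose_mul, Matrix.conjTranspose_mul,
        Matrix.conjTranspose_conjTranspose]
      calc _ = (p.1 : Matrix n n ℂ) * ((U.conjTranspose * U) *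
            (Matrix.diagonal fun k => (σ k : ℂ)) * (V.conjTranspose *
            (W * (Matrix.diagonal (fun k => (y k : ℂ) ^ q) * W.conjTranspose)) * V)) *
            (p.2 : Matrix n n ℂ).conjTranspose := by simp only [Matrix.mul_assoc]
        _ = _ := by rw [hUU, Matrix.one_mul]; simp only [Matrix.mul_assoc]
    exact congrFun (congrFun hmat i) i
  simp only [hw, hact]

end InnerAverage

/-! ### Powers of the Gram matrix and the defect. -/

theorem gram_mul_mul {m n : Type*} [Fintype m] [Fintype n] [DecidableEq m]
    {P : Matrix m m ℂ} {Q : Matrix n n ℂ}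
    (hP : P.conjTranspose * P = 1) (A : Matrix m n ℂ) :
    (P * A * Q).conjTranspose * (P * A * Q) = Q.conjTranspose * (A.conjTranspose * A) * Q := by
  calc _ = Q.conjTranspose * (A.conjTranspose * ((P.conjTranspose * P) * A)) * Q := by
        rw [Matrix.conjTranspose_mul, Matrix.conjTranspose_mul]; simp only [Matrix.mul_assoc]
    _ = _ := by rw [hP, Matrix.one_mul]

section GramPowers

variable {m n : Type*} [Fintype m] [Fintype n] [DecidableEq n]

/-- `Re tr (AᴴA)^q`. -/
noncomputable def gramTrace (q : ℕ) (A : Matrix m n ℂ) : ℝ :=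
  (((A.conjTranspose * A) ^ q).trace).re

/-- `A (AᴴA)^q`. -/
noncomputable def gramPow (q : ℕ) (A : Matrix m n ℂ) : Matrix m n ℂ :=
  A * (A.conjTranspose * A) ^ q

open scoped ComplexOrder in
-- The eigenvalues of `AᴴA` give all the traces and the norm at once, so comparing them amounts to
-- comparing `ℓ^q` and sup norms of one vector.
theorem exists_gramTrace_eq_sum_pow (A : Matrix m n ℂ) :
    ∃ y : n → ℝ, (∀ k, 0 ≤ y k) ∧ (∀ q, gramTrace q A = ∑ k, y k ^ q) ∧ ‖A‖ ^ 2 = ‖y‖ := by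
  obtain ⟨W, hW, y, hy, hH⟩ :=
    (Matrix.posSemidef_conjTranspose_mul_self A).exists_unitary_diagonal
  have hWW : W.conjTranspose * W = 1 := Matrix.mem_unitaryGroup_iff'.1 hW
  have hWW' : W * W.conjTranspose = 1 := Matrix.mem_unitaryGroup_iff.1 hW
  refine ⟨y, hy, fun q => ?_, ?_⟩
  · rw [gramTrace, hH]
    erw [conj_diagonal_pow hWW hWW']
    rw [Matrix.mul_assoc, Matrix.trace_mul_comm, Matrix.mul_assoc, hWW, Matrix.mul_one,
      Matrix.trace_diagonal, Complex.re_sum]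
    exact Finset.sum_congr rfl fun K _ => by
      rw [RCLike.ofReal_eq_complex_ofReal, ← Complex.ofReal_pow, Complex.ofReal_re]
  · have hW' : W.conjTranspose ∈ unitary (Matrix n n ℂ) := Unitary.star_mem hW
    rw [sq, ← Matrix.l2_opNorm_conjTranspose_mul_self, hH, CStarRing.norm_mul_mem_unitary _ hW',
      CStarRing.norm_mem_unitary_mul _ hW, Matrix.l2_opNorm_diagonal]
    simp [Pi.norm_def]

theorem gramTrace_nonneg (q : ℕ) (A : Matrix m n ℂ) : 0 ≤ gramTrace q A := by
  obtain ⟨y, hy, h, -⟩ := exists_gramTrace_eq_sum_pow A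
  rw [h]
  exact Finset.sum_nonneg fun k _ => pow_nonneg (hy k) q

theorem continuous_gram_pow (q : ℕ) :
    Continuous fun A : Matrix m n ℂ => (A.conjTranspose * A) ^ q :=
  (continuous_id.matrix_conjTranspose.matrix_mul continuous_id).pow q

theorem continuous_gramTrace (q : ℕ) : Continuous (gramTrace q : Matrix m n ℂ → ℝ) :=
  Complex.continuous_re.comp (continuous_gram_pow q).matrix_trace

theorem continuous_gramPow_apply (q : ℕ) (i : m) (j : n) :
    Continuous fun A : Matrix m n ℂ => gramPow q A i j :=
  (continuous_id.matrix_mul (continuous_gram_pow q)).matrix_elem i j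

theorem conj_pow_of_unitary {Q : Matrix n n ℂ} (hQ : Q * Q.conjTranspose = 1)
    (hQ' : Q.conjTranspose * Q = 1) (H : Matrix n n ℂ) (q : ℕ) :
    (Q.conjTranspose * H * Q) ^ q = Q.conjTranspose * H ^ q * Q := by
  induction q with
  | zero => simp [hQ']
  | succ q ih =>
    rw [pow_succ, ih]
    calc _ = Q.conjTranspose * (H ^ q * ((Q * Q.conjTranspose) * H)) * Q := by
          simp only [Matrix.mul_assoc]
      _ = _ := by rw [hQ, Matrix.one_mul, pow_succ]

theorem gramTrace_mul_mul [DecidableEq m] {P : Matrix m m ℂ} {Q : Matrix n n ℂ}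
    (hP : P.conjTranspose * P = 1) (hQ : Q * Q.conjTranspose = 1) (hQ' : Q.conjTranspose * Q = 1)
    (q : ℕ) (A : Matrix m n ℂ) : gramTrace q (P * A * Q) = gramTrace q A := by
  rw [gramTrace, gram_mul_mul hP, conj_pow_of_unitary hQ hQ', Matrix.trace_mul_comm,
    ← Matrix.mul_assoc, hQ, Matrix.one_mul, gramTrace]

theorem gramPow_mul_mul [DecidableEq m] {P : Matrix m m ℂ} {Q : Matrix n n ℂ}
    (hP : P.conjTranspose * P = 1) (hQ : Q * Q.conjTranspose = 1) (hQ' : Q.conjTranspose * Q = 1)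
    (q : ℕ) (A : Matrix m n ℂ) : gramPow q (P * A * Q) = P * gramPow q A * Q := by
  rw [gramPow, gram_mul_mul hP, conj_pow_of_unitary hQ hQ', gramPow]
  calc _ = P * (A * ((Q * Q.conjTranspose) * (A.conjTranspose * A) ^ q)) * Q := by
        simp only [Matrix.mul_assoc]
    _ = _ := by rw [hQ, Matrix.one_mul]

/-- Up to a positive factor, the value at `A` of `∑ (∂²/∂(Re A_ij)² - ∂²/∂(Im A_ij)²)` applied to
the function `(Re tr (AᴴA)^(k+2) + ε) ^ s`. -/
noncomputable def laplaceDefect (k : ℕ) (s ε : ℝ) (A : Matrix m n ℂ) : ℝ :=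
  (gramTrace (k + 2) A + ε) ^ (s - 1) * ∑ i, ∑ j,
    ((∑ t : Fin (k + 1), (gramPow t A i j * gramPow (k - t) A i j).re) -
      (1 - s) * (k + 2) / (gramTrace (k + 2) A + ε) *
        (gramPow (k + 1) A i j * gramPow (k + 1) A i j).re)

theorem continuous_laplaceDefect (k : ℕ) (s : ℝ) {ε : ℝ} (hε : 0 < ε) :
    Continuous (laplaceDefect k s ε : Matrix m n ℂ → ℝ) := by
  have h0 : ∀ A : Matrix m n ℂ, gramTrace (k + 2) A + ε ≠ 0 := fun A => by
    have := gramTrace_nonneg (k + 2) A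
    positivity
  have h1 := continuous_gramTrace (m := m) (n := n) (k + 2)
  have h2 := fun (q : ℕ) i j => continuous_gramPow_apply (m := m) (n := n) q i j
  unfold laplaceDefect
  refine ((h1.add continuous_const).rpow_const fun A => Or.inl (h0 A)).mul ?_
  refine continuous_finsetSum _ fun i _ => continuous_finsetSum _ fun j _ => ?_
  refine (continuous_finsetSum _ fun t _ => Complex.continuous_re.comp
    ((h2 _ i j).mul (h2 _ i j))).sub ?_
  exact (continuous_const.div (h1.add continuous_const) h0).mul
    (Complex.continuous_re.comp ((h2 _ i j).mul (h2 _ i j)))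

/-- The form is `tr (A Bᵀ)`, bilinear without conjugation, so it is preserved by complex orthogonal
matrices and not by unitary ones. -/
theorem sum_mul_mul_of_transpose [DecidableEq m] {P : Matrix m m ℂ} {Q : Matrix n n ℂ}
    (hP : P.transpose * P = 1) (hQ : Q * Q.transpose = 1) (A B : Matrix m n ℂ) :
    ∑ i, ∑ j, (P * A * Q) i j * (P * B * Q) i j = ∑ i, ∑ j, A i j * B i j := by
  have h : ∀ A B : Matrix m n ℂ, ∑ i, ∑ j, A i j * B i j = (A * B.transpose).trace := fun A B => by
    simp [Matrix.trace, Matrix.mul_apply]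
  rw [h, h]
  calc _ = (P * (A * (Q * Q.transpose) * (B.transpose * P.transpose))).trace := by
        rw [Matrix.transpose_mul, Matrix.transpose_mul]; simp only [Matrix.mul_assoc]
    _ = (A * B.transpose * (P.transpose * P)).trace := by
        rw [hQ, Matrix.mul_one, Matrix.trace_mul_comm]; simp only [Matrix.mul_assoc]
    _ = _ := by rw [hP, Matrix.mul_one]

/-- A real orthogonal matrix is unitary, which governs the Gram powers and traces, and also complex
orthogonal, which preserves the bilinear sums. -/
theorem laplaceDefect_mul_mul [DecidableEq m] {P : Matrix m m ℝ} {Q : Matrix n n ℝ}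
    (hP : P ∈ Matrix.unitaryGroup m ℝ) (hQ : Q ∈ Matrix.unitaryGroup n ℝ) (k : ℕ) (s ε : ℝ)
    (A : Matrix m n ℂ) : laplaceDefect k s ε (P.map Complex.ofReal * A * Q.map Complex.ofReal) =
      laplaceDefect k s ε A := by
  have hPt : (P.map Complex.ofReal).conjTranspose = (P.map Complex.ofReal).transpose := by
    ext i j; simp
  have hQt : (Q.map Complex.ofReal).conjTranspose = (Q.map Complex.ofReal).transpose := by
    ext i j; simp
  have hP1 : (P.map Complex.ofReal).transpose * P.map Complex.ofReal = 1 := by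
    have h : P.transpose * P = 1 := by
      simpa [Matrix.star_eq_conjTranspose] using Matrix.mem_unitaryGroup_iff'.1 hP
    have := congrArg (fun M : Matrix m m ℝ => M.map Complex.ofRealHom) h
    simp only [Matrix.map_mul] at this
    rw [Matrix.map_one _ (map_zero _) (map_one _)] at this
    exact this
  have hQ1 : Q.map Complex.ofReal * (Q.map Complex.ofReal).transpose = 1 := by
    have h : Q * Q.transpose = 1 := by
      simpa [Matrix.star_eq_conjTranspose] using Matrix.mem_unitaryGroup_iff.1 hQ
    have := congrArg (fun M : Matrix n n ℝ => M.map Complex.ofRealHom) h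
    simp only [Matrix.map_mul] at this
    rw [Matrix.map_one _ (map_zero _) (map_one _)] at this
    exact this
  have hQ2 : (Q.map Complex.ofReal).transpose * Q.map Complex.ofReal = 1 :=
    mul_eq_one_comm.1 hQ1
  have hsum : ∀ t t' : ℕ, ∑ i, ∑ j, (gramPow t (P.map Complex.ofReal * A * Q.map Complex.ofReal) i j *
      gramPow t' (P.map Complex.ofReal * A * Q.map Complex.ofReal) i j).re =
      ∑ i, ∑ j, (gramPow t A i j * gramPow t' A i j).re := fun t t' => by
    rw [gramPow_mul_mul (by rw [hPt, hP1]) (by rw [hQt, hQ1]) (by rw [hQt, hQ2]),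
      gramPow_mul_mul (by rw [hPt, hP1]) (by rw [hQt, hQ1]) (by rw [hQt, hQ2])]
    simp only [← Complex.re_sum]
    rw [sum_mul_mul_of_transpose hP1 hQ1]
  have hrw : ∀ A : Matrix m n ℂ, laplaceDefect k s ε A = (gramTrace (k + 2) A + ε) ^ (s - 1) *
      ((∑ t : Fin (k + 1), ∑ i, ∑ j, (gramPow t A i j * gramPow (k - t) A i j).re) -
      (1 - s) * (k + 2) / (gramTrace (k + 2) A + ε) *
        ∑ i, ∑ j, (gramPow (k + 1) A i j * gramPow (k + 1) A i j).re) := fun A => by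
    rw [laplaceDefect]
    congr 1
    simp only [Finset.sum_sub_distrib, Finset.mul_sum]
    congr 1
    rw [Finset.sum_comm' (t' := Finset.univ) (s' := fun _ => Finset.univ) (by simp)]
    conv_rhs => rw [Finset.sum_comm]
    conv_lhs => rw [Finset.sum_comm]
    refine Finset.sum_congr rfl fun i _ => ?_
    rw [Finset.sum_comm]
  rw [hrw, hrw]
  simp only [hsum]
  rw [gramTrace_mul_mul (by rw [hPt, hP1]) (by rw [hQt, hQ1]) (by rw [hQt, hQ2])]

/-- If `z ≤ y`, the left side is at most `κ y^(k+2) z^k ≤ (k + 1) z^k`, and each of the `k + 1`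
terms on the right is at least `z^k`. This is the positivity of the coefficients `C K L` for the
defect. -/
theorem mul_pow_le_sum_pow_mul_pow {k : ℕ} {y z κ τ : ℝ} (hy : 0 ≤ y) (hz : 0 ≤ z) (hκ : 0 ≤ κ)
    (hyτ : y ^ (k + 2) ≤ τ) (hzτ : z ^ (k + 2) ≤ τ) (hκτ : κ * τ ≤ k + 1) :
    κ * (y ^ (k + 1) * z ^ (k + 1)) ≤ ∑ t : Fin (k + 1), y ^ (t : ℕ) * z ^ (k - t) := by
  have key : ∀ y z : ℝ, 0 ≤ y → 0 ≤ z → y ^ (k + 2) ≤ τ → z ≤ y →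
      κ * (y ^ (k + 1) * z ^ (k + 1)) ≤ (k + 1) * z ^ k := fun y z hy hz hyτ hzy => by
    calc κ * (y ^ (k + 1) * z ^ (k + 1)) = κ * (y ^ (k + 1) * z) * z ^ k := by ring
      _ ≤ κ * (y ^ (k + 1) * y) * z ^ k := by gcongr
      _ = κ * y ^ (k + 2) * z ^ k := by ring
      _ ≤ κ * τ * z ^ k := by gcongr
      _ ≤ _ := by gcongr
  rcases le_total z y with h | h
  · refine (key y z hy hz hyτ h).trans ?_
    calc ((k : ℝ) + 1) * z ^ k = ∑ _t : Fin (k + 1), z ^ k := by simp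
      _ ≤ _ := Finset.sum_le_sum fun t _ => by
        calc z ^ k = z ^ (t : ℕ) * z ^ (k - t) := by rw [← pow_add]; congr 1; omega
          _ ≤ _ := by gcongr
  · rw [mul_comm (y ^ (k + 1))]
    refine (key z y hz hy hzτ h).trans ?_
    calc ((k : ℝ) + 1) * y ^ k = ∑ _t : Fin (k + 1), y ^ k := by simp
      _ ≤ _ := Finset.sum_le_sum fun t _ => by
        calc y ^ k = y ^ (t : ℕ) * y ^ (k - t) := by rw [← pow_add]; congr 1; omega
          _ ≤ _ := by gcongr

end GramPowers

/-! ### The defect averaged over a unitary orbit. -/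

section Orbit

variable {n r : Type*} [Fintype n] [DecidableEq n] [Fintype r] [DecidableEq r]

/-- The block-diagonal extension of a unitary matrix by the identity. -/
noncomputable def unitaryExtend (r : Type*) [Fintype r] [DecidableEq r] (U : Matrix n n ℂ) :
    Matrix (n ⊕ r) (n ⊕ r) ℂ :=
  Matrix.fromBlocks U 0 0 1

theorem unitaryExtend_conjTranspose_mul (U : Matrix.unitaryGroup n ℂ) :
    (unitaryExtend r (U : Matrix n n ℂ)).conjTranspose * unitaryExtend r (U : Matrix n n ℂ) = 1 := by
  have hU : (U : Matrix n n ℂ).conjTranspose * (U : Matrix n n ℂ) = 1 :=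
    Matrix.mem_unitaryGroup_iff'.1 U.2
  rw [unitaryExtend, Matrix.fromBlocks_conjTranspose, Matrix.fromBlocks_multiply]
  simp [hU]

theorem unitaryAct_eq (p : Matrix.unitaryGroup n ℂ × Matrix.unitaryGroup n ℂ)
    (A : Matrix (n ⊕ r) n ℂ) : unitaryAct p A =
      unitaryExtend r (p.1 : Matrix n n ℂ) * A * (p.2 : Matrix n n ℂ).conjTranspose := by
  conv_rhs => rw [← Matrix.fromRows_toRows A]
  rw [unitaryExtend, Matrix.fromBlocks_mul_fromRows, Matrix.fromRows_mul, unitaryAct]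
  simp

theorem gramTrace_unitaryAct (p : Matrix.unitaryGroup n ℂ × Matrix.unitaryGroup n ℂ)
    (A : Matrix (n ⊕ r) n ℂ) (q : ℕ) : gramTrace q (unitaryAct p A) = gramTrace q A := by
  rw [unitaryAct_eq]
  refine gramTrace_mul_mul (unitaryExtend_conjTranspose_mul _) ?_ ?_ q A
  · rw [Matrix.conjTranspose_conjTranspose]; exact Matrix.mem_unitaryGroup_iff'.1 p.2.2
  · rw [Matrix.conjTranspose_conjTranspose]; exact Matrix.mem_unitaryGroup_iff.1 p.2.2

theorem gramPow_unitaryAct (p : Matrix.unitaryGroup n ℂ × Matrix.unitaryGroup n ℂ)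
    (A : Matrix (n ⊕ r) n ℂ) (q : ℕ) :
    gramPow q (unitaryAct p A) = unitaryAct p (gramPow q A) := by
  rw [unitaryAct_eq, unitaryAct_eq]
  refine gramPow_mul_mul (unitaryExtend_conjTranspose_mul _) ?_ ?_ q A
  · rw [Matrix.conjTranspose_conjTranspose]; exact Matrix.mem_unitaryGroup_iff'.1 p.2.2
  · rw [Matrix.conjTranspose_conjTranspose]; exact Matrix.mem_unitaryGroup_iff.1 p.2.2

/-- Traces are constant on the orbit and `A (AᴴA)^q` transforms as `A` does, so the integrand has
the form treated in `integral_phaseWeight_unitaryAct_nonneg`. The condition `1 ≤ s (k + 2)` says `(1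
- s) (k + 2) ≤ k + 1`, which is what makes the coefficients nonnegative. -/
theorem integral_phaseWeight_laplaceDefect_nonneg {x : n → ℝ} (hx : ∀ l, 0 ≤ x l) (k : ℕ)
    {s ε : ℝ} (hε : 0 < ε) (hs : s ≤ 1) (hsk : 1 ≤ s * (k + 2)) (A : Matrix (n ⊕ r) n ℂ) :
    0 ≤ ∫ p, phaseWeight x A.toRows₁ p * laplaceDefect k s ε (unitaryAct p A)
      ∂((unitaryHaar n).prod (unitaryHaar n)) := by
  set τ := gramTrace (k + 2) A with hτ
  have hτ0 : 0 ≤ τ := gramTrace_nonneg _ _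
  set κ := (1 - s) * (k + 2) / (τ + ε) with hκ
  have hκ0 : 0 ≤ κ := div_nonneg (mul_nonneg (by linarith) (by positivity)) (by positivity)
  have hκτ : κ * τ ≤ k + 1 := by
    rw [hκ, div_mul_eq_mul_div, div_le_iff₀ (by positivity)]
    have : (1 - s) * (k + 2) ≤ k + 1 := by linarith
    nlinarith [mul_le_mul_of_nonneg_right this hτ0]
  -- The index `none` carries the negative term with exponents `(k + 1, k + 1)`; the index `some t`
  -- carries the exponents `(t, k - t)`.
  let a : Option (Fin (k + 1)) → ℝ := fun t => t.elim (-κ) fun _ => 1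
  let e : Option (Fin (k + 1)) → ℕ := fun t => t.elim (k + 1) fun i => i
  let e' : Option (Fin (k + 1)) → ℕ := fun t => t.elim (k + 1) fun i => k - i
  have hmain := integral_phaseWeight_unitaryAct_nonneg hx A a e e' (fun y hy htr K L => by
    simp only [Fintype.sum_option, a, e, e', Option.elim]
    have hle : ∀ K, y K ^ (k + 2) ≤ τ := fun K => by
      rw [hτ, gramTrace, htr]
      exact Finset.single_le_sum (f := fun K => y K ^ (k + 2)) (fun i _ => pow_nonneg (hy i) _)
        (Finset.mem_univ K)
    have := mul_pow_le_sum_pow_mul_pow (hy K) (hy L) hκ0 (hle K) (hle L) hκτ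
    simp only [one_mul]
    linarith) (fun y z => by
    simp only [Fintype.sum_option, a, e, e', Option.elim, one_mul]
    rw [mul_comm (y ^ (k + 1))]
    congr 1
    refine Fintype.sum_equiv Fin.revPerm _ _ fun t => ?_
    rw [mul_comm]
    simp only [Fin.revPerm_apply, Fin.val_rev]
    congr 2 <;> omega)
  have hpt : ∀ p, phaseWeight x A.toRows₁ p * laplaceDefect k s ε (unitaryAct p A) =
      (τ + ε) ^ (s - 1) * (phaseWeight x A.toRows₁ p * ∑ i, ∑ j, ∑ t, a t *
      (unitaryAct p (A * (A.conjTranspose * A) ^ e t) i j *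
        unitaryAct p (A * (A.conjTranspose * A) ^ e' t) i j).re) := fun p => by
    rw [laplaceDefect, gramTrace_unitaryAct, mul_left_comm]
    congr 2
    refine Finset.sum_congr rfl fun i _ => Finset.sum_congr rfl fun j _ => ?_
    simp only [Fintype.sum_option, a, e, e', Option.elim, one_mul, gramPow_unitaryAct]
    rw [sub_eq_neg_add, neg_mul]
    rfl
  simp only [hpt, integral_const_mul]
  exact mul_nonneg (Real.rpow_nonneg (by positivity) _) hmain

end Orbit

/-! ### Invariance of Gaussian laws under isometries. -/

section Invariance

/-- Polarisation shows that the matrix is orthogonal, so the image has the same covariance. -/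
theorem gaussPi_map_isometry {ι : Type*} [Fintype ι] (T : (ι → ℝ) →ₗ[ℝ] (ι → ℝ))
    (hT : ∀ x, ∑ i, T x i ^ 2 = ∑ i, x i ^ 2) : (gaussPi ι).map T = gaussPi ι := by
  classical
  set M := LinearMap.toMatrix' T with hM
  have hTM : ∀ x, T x = M.mulVec x := fun x => by rw [hM, ← Matrix.toLin'_apply,
    Matrix.toLin'_toMatrix']
  have hdot : ∀ x, (M.mulVec x) ⬝ᵥ (M.mulVec x) = x ⬝ᵥ x := fun x => by
    have := hT x
    simpa only [hTM, dotProduct, sq] using this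
  have hMM : M.transpose * M = 1 := by
    have hpol : ∀ x y, x ⬝ᵥ (M.transpose * M).mulVec y = x ⬝ᵥ y := fun x y => by
      rw [← Matrix.mulVec_mulVec, Matrix.dotProduct_mulVec, ← Matrix.mulVec_transpose,
        Matrix.transpose_transpose]
      have h := hdot (x + y)
      have hx := hdot x
      have hy := hdot y
      rw [Matrix.mulVec_add, add_dotProduct, dotProduct_add, dotProduct_add, add_dotProduct,
        dotProduct_add, dotProduct_add, dotProduct_comm (M.mulVec y) (M.mulVec x),
        dotProduct_comm y x] at h
      linarith
    ext i j
    have := hpol (Pi.single i 1) (Pi.single j 1)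
    simpa [Matrix.one_apply, Pi.single_apply, eq_comm] using this
  have hMM' : M * M.transpose = 1 := mul_eq_one_comm.1 hMM
  have := gaussPi_map_mulVec_eq M (1 : Matrix ι ι ℝ) (by simp [hMM'])
  have e1 : (T : (ι → ℝ) → ι → ℝ) = fun x => M.mulVec x := funext hTM
  rw [e1, this]
  simp

end Invariance

/-! ### Complex matrices in real coordinates. -/

section ComplexMatrix

variable {m n : Type*}

/-- The complex matrix with the given real and imaginary parts. -/
noncomputable def complexMatrix (x : m × n ⊕ m × n → ℝ) : Matrix m n ℂ :=
  Matrix.of fun i j => x (Sum.inl (i, j)) + x (Sum.inr (i, j)) * Complex.I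

/-- The real and imaginary parts of the entries of a complex matrix. -/
def realCoords (A : Matrix m n ℂ) : m × n ⊕ m × n → ℝ :=
  Sum.elim (fun q => (A q.1 q.2).re) fun q => (A q.1 q.2).im

theorem complexMatrix_realCoords (A : Matrix m n ℂ) : complexMatrix (realCoords A) = A := by
  ext i j
  exact Complex.re_add_im _

theorem realCoords_complexMatrix (x : m × n ⊕ m × n → ℝ) :
    realCoords (complexMatrix x) = x := by
  ext (⟨i, j⟩ | ⟨i, j⟩) <;> simp [realCoords, complexMatrix]

theorem complexMatrix_add (x y : m × n ⊕ m × n → ℝ) :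
    complexMatrix (x + y) = complexMatrix x + complexMatrix y := by
  ext i j; simp [complexMatrix]; ring

theorem complexMatrix_smul (c : ℝ) (x : m × n ⊕ m × n → ℝ) :
    complexMatrix (c • x) = (c : ℂ) • complexMatrix x := by
  ext i j; simp [complexMatrix]; ring

theorem continuous_complexMatrix :
    Continuous (complexMatrix : (m × n ⊕ m × n → ℝ) → Matrix m n ℂ) := by
  refine continuous_matrix fun i j => ?_
  simp only [complexMatrix, Matrix.of_apply]
  fun_prop

variable [Fintype m] [Fintype n]

theorem sum_realCoords_sq (A : Matrix m n ℂ) :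
    ∑ c, realCoords A c ^ 2 = ((A.conjTranspose * A).trace).re := by
  rw [Fintype.sum_sum_type, ← Finset.sum_add_distrib, Fintype.sum_prod_type, Finset.sum_comm,
    Matrix.trace, Complex.re_sum]
  refine Finset.sum_congr rfl fun j _ => ?_
  rw [Matrix.diag_apply, Matrix.mul_apply, Complex.re_sum]
  refine Finset.sum_congr rfl fun i _ => ?_
  simp [realCoords, Matrix.conjTranspose_apply]
  ring

/-- The Euclidean length in real coordinates is `tr AᴴA`, which two-sided unitary multiplication
preserves, so it acts as a real isometry. -/
theorem integral_complexMatrix_mul_mul [DecidableEq m] [DecidableEq n] {P : Matrix m m ℂ}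
    {Q : Matrix n n ℂ} (hP : P.conjTranspose * P = 1) (hQ : Q * Q.conjTranspose = 1)
    {F : Matrix m n ℂ → ℝ} (hF : Continuous F) :
    ∫ x, F (P * complexMatrix x * Q) ∂gaussPi (m × n ⊕ m × n) =
      ∫ x, F (complexMatrix x) ∂gaussPi (m × n ⊕ m × n) := by
  let T : (m × n ⊕ m × n → ℝ) →ₗ[ℝ] (m × n ⊕ m × n → ℝ) :=
    { toFun := fun x => realCoords (P * complexMatrix x * Q)
      map_add' := fun x y => by
        rw [complexMatrix_add, Matrix.mul_add, Matrix.add_mul]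
        ext (⟨i, j⟩ | ⟨i, j⟩) <;> simp [realCoords]
      map_smul' := fun c x => by
        rw [complexMatrix_smul, Matrix.mul_smul, Matrix.smul_mul]
        ext (⟨i, j⟩ | ⟨i, j⟩) <;> simp [realCoords] }
  have hT : (gaussPi (m × n ⊕ m × n)).map T = gaussPi (m × n ⊕ m × n) :=
    gaussPi_map_isometry T fun x => by
      change ∑ i, realCoords (P * complexMatrix x * Q) i ^ 2 = _
      conv_rhs => rw [← realCoords_complexMatrix x]
      rw [sum_realCoords_sq, sum_realCoords_sq, gram_mul_mul hP, Matrix.trace_mul_comm,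
        ← Matrix.mul_assoc, hQ, Matrix.one_mul]
  have h := integral_map (μ := gaussPi (m × n ⊕ m × n)) (φ := T)
    (f := fun x => F (complexMatrix x))
    (LinearMap.continuous_of_finiteDimensional T).measurable.aemeasurable
    (hF.comp continuous_complexMatrix).stronglyMeasurable.aestronglyMeasurable
  rw [hT] at h
  rw [h]
  refine integral_congr_ae (Filter.Eventually.of_forall fun x => ?_)
  change F _ = F (complexMatrix (realCoords _))
  rw [complexMatrix_realCoords]

end ComplexMatrix

/-! ### Growth of the matrix functions. -/

section Growth

variable {ι : Type*} [Fintype ι]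

theorem ExpGrowth.matrix_mul {l m n : Type*} [Fintype m] {A : (ι → ℝ) → Matrix l m ℂ}
    {B : (ι → ℝ) → Matrix m n ℂ} (hA : ∀ i j, ExpGrowth fun x => A x i j)
    (hB : ∀ i j, ExpGrowth fun x => B x i j) (i : l) (j : n) :
    ExpGrowth fun x => (A x * B x) i j := by
  simp only [Matrix.mul_apply]
  exact ExpGrowth.sum _ fun k _ => (hA i k).mul (hB k j)

theorem ExpGrowth.conjTranspose {m n : Type*} {A : (ι → ℝ) → Matrix m n ℂ}
    (hA : ∀ i j, ExpGrowth fun x => A x i j) (i : n) (j : m) :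
    ExpGrowth fun x => (A x).conjTranspose i j :=
  (hA j i).of_norm_le fun x => by simp [Matrix.conjTranspose_apply]

theorem ExpGrowth.matrix_pow {n : Type*} [Fintype n] [DecidableEq n]
    {A : (ι → ℝ) → Matrix n n ℂ} (hA : ∀ i j, ExpGrowth fun x => A x i j) (q : ℕ) (i j : n) :
    ExpGrowth fun x => (A x ^ q) i j := by
  induction q generalizing i j with
  | zero => simpa using ExpGrowth.const ((1 : Matrix n n ℂ) i j)
  | succ q ih => simpa only [pow_succ] using ExpGrowth.matrix_mul ih hA i j

theorem ExpGrowth.re {f : (ι → ℝ) → ℂ} (hf : ExpGrowth f) : ExpGrowth fun x => (f x).re :=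
  hf.of_norm_le fun _ => Complex.abs_re_le_norm _

theorem ExpGrowth.ofReal {f : (ι → ℝ) → ℝ} (hf : ExpGrowth f) : ExpGrowth fun x => (f x : ℂ) :=
  hf.of_norm_le fun x => by simp

theorem ExpGrowth.complexMatrix {m n : Type*} [Fintype m] [Fintype n] (i : m) (j : n) :
    ExpGrowth fun x : m × n ⊕ m × n → ℝ => complexMatrix x i j := by
  simp only [_root_.complexMatrix, Matrix.of_apply]
  exact (ExpGrowth.eval _).ofReal.add ((ExpGrowth.eval _).ofReal.mul (ExpGrowth.const _))

variable {m n : Type*} [Fintype m] [Fintype n] [DecidableEq n]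

theorem ExpGrowth.gramPow {A : (ι → ℝ) → Matrix m n ℂ}
    (hA : ∀ i j, ExpGrowth fun x => A x i j) (q : ℕ) (i : m) (j : n) :
    ExpGrowth fun x => gramPow q (A x) i j :=
  ExpGrowth.matrix_mul hA
    (ExpGrowth.matrix_pow (ExpGrowth.matrix_mul (ExpGrowth.conjTranspose hA) hA) q) i j

theorem ExpGrowth.gramTrace {A : (ι → ℝ) → Matrix m n ℂ}
    (hA : ∀ i j, ExpGrowth fun x => A x i j) (q : ℕ) :
    ExpGrowth fun x => gramTrace q (A x) := by
  simp only [_root_.gramTrace, Matrix.trace, Matrix.diag_apply, Complex.re_sum]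
  exact ExpGrowth.sum _ fun i _ => (ExpGrowth.matrix_pow
    (ExpGrowth.matrix_mul (ExpGrowth.conjTranspose hA) hA) q i i).re

/-- This is what the smoothing `ε` is for: negative powers of the trace stay bounded by `ε ^ s`. -/
theorem ExpGrowth.gramTrace_rpow {A : (ι → ℝ) → Matrix m n ℂ} {ε s : ℝ} (hε : 0 < ε)
    (hs : s ≤ 0) (q : ℕ) : ExpGrowth fun x => (_root_.gramTrace q (A x) + ε) ^ s :=
  (ExpGrowth.const (ε ^ s)).of_norm_le fun x => by
    have h := gramTrace_nonneg q (A x)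
    rw [Real.norm_of_nonneg (by positivity), Real.norm_of_nonneg (by positivity)]
    exact Real.rpow_le_rpow_of_nonpos hε (by linarith) hs

theorem ExpGrowth.laplaceDefect {A : (ι → ℝ) → Matrix m n ℂ}
    (hA : ∀ i j, ExpGrowth fun x => A x i j) (k : ℕ) {s ε : ℝ} (hε : 0 < ε) (hs : s ≤ 1) :
    ExpGrowth fun x => laplaceDefect k s ε (A x) := by
  unfold _root_.laplaceDefect
  refine (ExpGrowth.gramTrace_rpow hε (by linarith) _).mul (ExpGrowth.sum _ fun i _ =>
    ExpGrowth.sum _ fun j _ => ?_)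
  refine (ExpGrowth.sum _ fun t _ => ((ExpGrowth.gramPow hA _ i j).mul
    (ExpGrowth.gramPow hA _ i j)).re).sub (ExpGrowth.mul ?_ ((ExpGrowth.gramPow hA _ i j).mul
    (ExpGrowth.gramPow hA _ i j)).re)
  have h := (ExpGrowth.const ((1 - s) * (k + 2))).mul
    (ExpGrowth.gramTrace_rpow (A := A) hε (s := -1) (by norm_num) (k + 2))
  simpa only [Real.rpow_neg_one, div_eq_mul_inv] using h

end Growth

/-! ### Average of the defect around a real matrix. -/

section Shift

variable {n r : Type*} [Fintype n] [DecidableEq n] [Fintype r] [DecidableEq r]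

/-- Unitary entries have modulus at most one, so the bound is uniform over the group; it supplies
the domination for Fubini. -/
theorem sum_abs_realCoords_mul_mul_le {m : Type*} [Fintype m] [DecidableEq m] {P : Matrix m m ℂ}
    {Q : Matrix n n ℂ} (hP : P ∈ Matrix.unitaryGroup m ℂ) (hQ : Q ∈ Matrix.unitaryGroup n ℂ)
    (ω : m × n ⊕ m × n → ℝ) :
    ∑ c, |realCoords (P * complexMatrix ω * Q) c| ≤
      (2 * Fintype.card m * Fintype.card n : ℝ) * ∑ c, |ω c| := by
  have h1 : ∀ i j, ‖(P * complexMatrix ω * Q) i j‖ ≤ ∑ c, |ω c| := fun i j => by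
    calc ‖(P * complexMatrix ω * Q) i j‖
        ≤ ∑ l, ∑ k, ‖P i k * complexMatrix ω k l * Q l j‖ := by
          rw [Matrix.mul_apply]
          refine (norm_sum_le _ _).trans (Finset.sum_le_sum fun l _ => ?_)
          rw [Matrix.mul_apply, Finset.sum_mul]
          exact norm_sum_le _ _
      _ ≤ ∑ l, ∑ k, (|ω (Sum.inl (k, l))| + |ω (Sum.inr (k, l))|) := by
          refine Finset.sum_le_sum fun l _ => Finset.sum_le_sum fun k _ => ?_
          rw [norm_mul, norm_mul]
          have h : ‖complexMatrix ω k l‖ ≤ |ω (Sum.inl (k, l))| + |ω (Sum.inr (k, l))| := by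
            refine (Complex.norm_le_abs_re_add_abs_im _).trans_eq ?_
            simp [complexMatrix]
          calc ‖P i k‖ * ‖complexMatrix ω k l‖ * ‖Q l j‖ ≤ 1 * ‖complexMatrix ω k l‖ * 1 := by
                gcongr
                · exact entry_norm_bound_of_unitary hP i k
                · exact entry_norm_bound_of_unitary hQ l j
            _ ≤ _ := by simpa using h
      _ = _ := by
          rw [Fintype.sum_sum_type, ← Finset.sum_add_distrib, Fintype.sum_prod_type,
            Finset.sum_comm]
  calc ∑ c, |realCoords (P * complexMatrix ω * Q) c| ≤ ∑ _c : m × n ⊕ m × n, ∑ c, |ω c| := by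
        refine Finset.sum_le_sum fun c _ => ?_
        rcases c with c | c
        · exact (Complex.abs_re_le_norm _).trans (h1 c.1 c.2)
        · exact (Complex.abs_im_le_norm _).trans (h1 c.1 c.2)
    _ = _ := by
        rw [Finset.sum_const, Finset.card_univ, Fintype.card_sum, Fintype.card_prod, nsmul_eq_mul]
        push_cast
        ring

theorem unitaryAct_smul (p : Matrix.unitaryGroup n ℂ × Matrix.unitaryGroup n ℂ) (c : ℂ)
    (A : Matrix (n ⊕ r) n ℂ) : unitaryAct p (c • A) = c • unitaryAct p A := by
  rw [unitaryAct_eq, unitaryAct_eq, Matrix.mul_smul, Matrix.smul_mul]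

/-- The circular complex Gaussian law is invariant under the unitary action, so one may average over
Haar pairs before integrating in `ω`. For each fixed `ω` that inner average is nonnegative. -/
theorem integral_exp_mul_laplaceDefect_nonneg {x : n → ℝ} (hx : ∀ l, 0 ≤ x l) (k : ℕ)
    {s ε ρ : ℝ} (hε : 0 < ε) (hs : s ≤ 1) (hsk : 1 ≤ s * (k + 2)) (hρ : 0 < ρ) :
    0 ≤ ∫ ω, Real.exp (∑ l, x l * (complexMatrix ω (Sum.inl l) l).re) *
      laplaceDefect k s ε ((ρ : ℂ) • complexMatrix ω) ∂gaussPi ((n ⊕ r) × n ⊕ (n ⊕ r) × n) := by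
  set ν := (unitaryHaar n).prod (unitaryHaar n) with hν
  set G : Matrix (n ⊕ r) n ℂ → ℝ := fun A =>
    Real.exp (∑ l, x l * (A (Sum.inl l) l).re) * laplaceDefect k s ε ((ρ : ℂ) • A) with hG
  have hGc : Continuous G := by
    refine Continuous.mul ?_ ((continuous_laplaceDefect k s hε).comp (continuous_const_smul _))
    refine Real.continuous_exp.comp (continuous_finsetSum _ fun l _ => ?_)
    exact continuous_const.mul (Complex.continuous_re.comp (continuous_id.matrix_elem _ _))
  have hGg : ExpGrowth fun ω : (n ⊕ r) × n ⊕ (n ⊕ r) × n → ℝ => G (complexMatrix ω) := by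
    refine ExpGrowth.mul ?_ (ExpGrowth.laplaceDefect (fun i j => ?_) k hε hs)
    · have h := ExpGrowth.exp_sum (ι := (n ⊕ r) × n ⊕ (n ⊕ r) × n)
        (Sum.elim (fun q => if q.1 = Sum.inl q.2 then x q.2 else 0) 0)
      have e : ∀ ω : (n ⊕ r) × n ⊕ (n ⊕ r) × n → ℝ,
          ∑ l, x l * (complexMatrix ω (Sum.inl l) l).re = ∑ i,
          (Sum.elim (fun q : (n ⊕ r) × n => if q.1 = Sum.inl q.2 then x q.2 else 0)
            (0 : (n ⊕ r) × n → ℝ)) i * ω i := fun ω => by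
        rw [Fintype.sum_sum_type, Fintype.sum_prod_type, Fintype.sum_sum_type]
        simp [complexMatrix]
      simpa only [e] using h
    · simp only [Matrix.smul_apply]
      exact (ExpGrowth.const _).smul (ExpGrowth.complexMatrix i j)
  have hPu : ∀ p : Matrix.unitaryGroup n ℂ × Matrix.unitaryGroup n ℂ,
      unitaryExtend r (p.1 : Matrix n n ℂ) ∈ Matrix.unitaryGroup (n ⊕ r) ℂ := fun p =>
    Matrix.mem_unitaryGroup_iff'.2 (unitaryExtend_conjTranspose_mul p.1)
  have hQu : ∀ p : Matrix.unitaryGroup n ℂ × Matrix.unitaryGroup n ℂ,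
      (p.2 : Matrix n n ℂ).conjTranspose ∈ Matrix.unitaryGroup n ℂ := fun p =>
    (p.2⁻¹ : Matrix.unitaryGroup n ℂ).2
  have hinv : ∀ p, ∫ ω, G (unitaryAct p (complexMatrix ω)) ∂gaussPi ((n ⊕ r) × n ⊕ (n ⊕ r) × n) =
      ∫ ω, G (complexMatrix ω) ∂gaussPi ((n ⊕ r) × n ⊕ (n ⊕ r) × n) := fun p => by
    simp only [unitaryAct_eq]
    refine integral_complexMatrix_mul_mul (unitaryExtend_conjTranspose_mul _) ?_ hGc
    rw [Matrix.conjTranspose_conjTranspose]; exact Matrix.mem_unitaryGroup_iff'.1 p.2.2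
  have hcont : Continuous fun z : (Matrix.unitaryGroup n ℂ × Matrix.unitaryGroup n ℂ) ×
      ((n ⊕ r) × n ⊕ (n ⊕ r) × n → ℝ) => G (unitaryAct z.1 (complexMatrix z.2)) := by
    refine hGc.comp ?_
    simp only [unitaryAct_eq, unitaryExtend]
    refine Continuous.matrix_mul (Continuous.matrix_mul ?_ ?_) ?_
    · exact (continuous_subtype_val.comp (continuous_fst.comp continuous_fst)).matrix_fromBlocks
        continuous_const continuous_const continuous_const
    · exact continuous_complexMatrix.comp continuous_snd
    · exact (continuous_subtype_val.comp
        (continuous_snd.comp continuous_fst)).matrix_conjTranspose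
  have hint : Integrable (Function.uncurry fun
      (p : Matrix.unitaryGroup n ℂ × Matrix.unitaryGroup n ℂ)
      (ω : (n ⊕ r) × n ⊕ (n ⊕ r) × n → ℝ) => G (unitaryAct p (complexMatrix ω)))
      (ν.prod (gaussPi ((n ⊕ r) × n ⊕ (n ⊕ r) × n))) := by
    obtain ⟨C, hC0, hC⟩ := hGg.exists_nonneg
    set D : ℝ := 2 * Fintype.card (n ⊕ r) * Fintype.card n
    have hb : Integrable (fun z : (Matrix.unitaryGroup n ℂ × Matrix.unitaryGroup n ℂ) ×
      ((n ⊕ r) × n ⊕ (n ⊕ r) × n → ℝ) => C * Real.exp ((C * D) * ∑ c, |z.2 c|))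
      (ν.prod (gaussPi ((n ⊕ r) × n ⊕ (n ⊕ r) × n))) :=
      ((ExpGrowth.integrable_exp_abs (C * D)).const_mul C).comp_snd ν
    have : BorelSpace ((Matrix.unitaryGroup n ℂ × Matrix.unitaryGroup n ℂ) ×
      ((n ⊕ r) × n ⊕ (n ⊕ r) × n → ℝ)) := Prod.borelSpace
    refine hb.mono' hcont.aestronglyMeasurable (Filter.Eventually.of_forall fun z => ?_)
    have h := hC (realCoords (unitaryAct z.1 (complexMatrix z.2)))
    rw [complexMatrix_realCoords] at h
    refine h.trans ?_
    rw [mul_assoc]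
    gcongr
    rw [unitaryAct_eq]
    exact sum_abs_realCoords_mul_mul_le (hPu z.1) (hQu z.1) z.2
  have hI : ∫ ω, G (complexMatrix ω) ∂gaussPi ((n ⊕ r) × n ⊕ (n ⊕ r) × n) =
      ∫ ω, ∫ p, G (unitaryAct p (complexMatrix ω)) ∂ν
        ∂gaussPi ((n ⊕ r) × n ⊕ (n ⊕ r) × n) := by
    rw [← integral_integral_swap hint]
    simp only [hinv]
    simp
  change 0 ≤ ∫ ω, G (complexMatrix ω) ∂gaussPi ((n ⊕ r) × n ⊕ (n ⊕ r) × n)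
  rw [hI]
  refine integral_nonneg fun ω => ?_
  -- The orbit is that of `ρ • complexMatrix ω`, hence the weight `x l / ρ`.
  have h := integral_phaseWeight_laplaceDefect_nonneg (x := fun l => x l / ρ)
    (fun l => div_nonneg (hx l) hρ.le) k hε hs hsk ((ρ : ℂ) • complexMatrix ω : Matrix (n ⊕ r) n ℂ)
  refine h.trans_eq (integral_congr_ae (Filter.Eventually.of_forall fun p => ?_))
  simp only [hG, unitaryAct_smul]
  congr 1
  unfold phaseWeight
  congr 1
  refine Finset.sum_congr rfl fun l _ => ?_
  have e : ((p.1 : Matrix n n ℂ) * ((ρ : ℂ) • complexMatrix ω : Matrix (n ⊕ r) n ℂ).toRows₁ *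
      (p.2 : Matrix n n ℂ).conjTranspose) l l = ρ * unitaryAct p (complexMatrix ω) (Sum.inl l) l := by
    change _ = ρ * ((p.1 : Matrix n n ℂ) * (complexMatrix ω : Matrix (n ⊕ r) n ℂ).toRows₁ *
      (p.2 : Matrix n n ℂ).conjTranspose) l l
    have : ((ρ : ℂ) • complexMatrix ω : Matrix (n ⊕ r) n ℂ).toRows₁ =
      (ρ : ℂ) • (complexMatrix ω : Matrix (n ⊕ r) n ℂ).toRows₁ := rfl
    rw [this, Matrix.mul_smul, Matrix.smul_mul, Matrix.smul_apply, smul_eq_mul]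
  rw [e, Complex.re_ofReal_mul]
  field_simp

theorem map_ofReal_mem_unitaryGroup {m : Type*} [Fintype m] [DecidableEq m] {P : Matrix m m ℝ}
    (hP : P ∈ Matrix.unitaryGroup m ℝ) : P.map Complex.ofReal ∈ Matrix.unitaryGroup m ℂ := by
  have hst : (P.map Complex.ofReal).conjTranspose = P.conjTranspose.map Complex.ofReal := by
    ext i j; simp
  have h := congrArg (fun M : Matrix m m ℝ => M.map Complex.ofRealHom)
    (Matrix.mem_unitaryGroup_iff'.1 hP)
  simp only [Matrix.map_mul] at h
  rw [Matrix.map_one _ (map_zero _) (map_one _)] at h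
  rw [Matrix.mem_unitaryGroup_iff', Matrix.star_eq_conjTranspose, hst]
  exact h

/-- The Laplace defect has nonnegative average around every real matrix. -/
theorem integral_laplaceDefect_shift_nonneg (X : Matrix (n ⊕ r) n ℝ) (k : ℕ)
    {s ε ρ : ℝ} (hε : 0 < ε) (hs : s ≤ 1) (hsk : 1 ≤ s * (k + 2)) (hρ : 0 < ρ) :
    0 ≤ ∫ ω, laplaceDefect k s ε (X.map Complex.ofReal + (ρ : ℂ) • complexMatrix ω)
      ∂gaussPi ((n ⊕ r) × n ⊕ (n ⊕ r) × n) := by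
  -- The orthogonal factors disappear because both the noise and `laplaceDefect` are invariant under
  -- them; a nonnegative diagonal shift remains.
  obtain ⟨O, hO, O', hO', x, hx, hX⟩ := Matrix.exists_svd (𝕜 := ℝ) Function.Embedding.inl X
  set D : Matrix (n ⊕ r) n ℝ := Matrix.of fun i j => if i = Sum.inl j then x j else 0 with hD
  have hO't : O'.conjTranspose ∈ Matrix.unitaryGroup n ℝ :=
    ((⟨O', hO'⟩ : Matrix.unitaryGroup n ℝ)⁻¹).2
  have hXm : X.map Complex.ofReal =
      O.map Complex.ofReal * D.map Complex.ofReal * O'.conjTranspose.map Complex.ofReal := by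
    have h := congrArg (fun M : Matrix (n ⊕ r) n ℝ => M.map Complex.ofRealHom) hX
    simp only [Matrix.map_mul] at h
    exact h
  have hOu := Matrix.mem_unitaryGroup_iff'.1 (map_ofReal_mem_unitaryGroup hO)
  have hO'u := Matrix.mem_unitaryGroup_iff.1 (map_ofReal_mem_unitaryGroup hO't)
  have hrot := integral_complexMatrix_mul_mul hOu hO'u
    (F := fun A => laplaceDefect k s ε (X.map Complex.ofReal + (ρ : ℂ) • A))
    ((continuous_laplaceDefect k s hε).comp (continuous_const.add (continuous_const_smul _)))
  rw [← hrot]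
  have hred : ∀ A : Matrix (n ⊕ r) n ℂ, laplaceDefect k s ε (X.map Complex.ofReal +
      (ρ : ℂ) • (O.map Complex.ofReal * A * O'.conjTranspose.map Complex.ofReal)) =
      laplaceDefect k s ε (D.map Complex.ofReal + (ρ : ℂ) • A) := fun A => by
    rw [← laplaceDefect_mul_mul hO hO't k s ε (D.map Complex.ofReal + (ρ : ℂ) • A), hXm,
      Matrix.mul_add, Matrix.add_mul, Matrix.mul_smul, Matrix.smul_mul]
  simp only [hred]
  -- The shift in units of the noise, so that it can be moved into the Gaussian vector and traded
  -- for a weight.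
  set v : (n ⊕ r) × n ⊕ (n ⊕ r) × n → ℝ :=
    Sum.elim (fun q => if q.1 = Sum.inl q.2 then x q.2 / ρ else 0) 0 with hv
  have hDv : ∀ ω, D.map Complex.ofReal + (ρ : ℂ) • complexMatrix ω =
      (ρ : ℂ) • complexMatrix (ω + v) := fun ω => by
    have hρ' : (ρ : ℂ) ≠ 0 := by exact_mod_cast hρ.ne'
    rw [complexMatrix_add, smul_add, add_comm]
    congr 1
    ext i j
    simp only [hD, hv, Matrix.map_apply, Matrix.of_apply, Matrix.smul_apply, complexMatrix,
      Sum.elim_inl, Sum.elim_inr, Pi.zero_apply]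
    by_cases h : i = Sum.inl j
    · simp [h]
      field_simp
    · simp [h]
  simp only [hDv]
  have hK : Continuous fun ω : (n ⊕ r) × n ⊕ (n ⊕ r) × n → ℝ =>
      laplaceDefect k s ε ((ρ : ℂ) • complexMatrix ω) :=
    (continuous_laplaceDefect k s hε).comp
      ((continuous_const_smul _).comp continuous_complexMatrix)
  rw [integral_gaussPi_add hK.stronglyMeasurable v]
  have hexp : ∀ ω : (n ⊕ r) × n ⊕ (n ⊕ r) × n → ℝ, ∑ i, (v i * ω i - v i ^ 2 / 2) =
      ∑ l, x l / ρ * (complexMatrix ω (Sum.inl l) l).re - ∑ i, v i ^ 2 / 2 := fun ω => by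
    rw [Finset.sum_sub_distrib]
    congr 1
    rw [Fintype.sum_sum_type, Fintype.sum_prod_type, Fintype.sum_sum_type]
    simp [complexMatrix, hv]
  -- The constant part of the Cameron–Martin density is a positive factor and does not affect the
  -- sign.
  simp only [hexp, Real.exp_sub, smul_eq_mul, div_mul_eq_mul_div, integral_div]
  refine div_nonneg ?_ (Real.exp_pos _).le
  simpa only [div_mul_eq_mul_div] using integral_exp_mul_laplaceDefect_nonneg (r := r)
    (x := fun l => x l / ρ) (fun l => div_nonneg (hx l) hρ.le) k hε hs hsk hρ

end Shift

/-! ### Derivatives of matrix functions along a line. -/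

section EntrywiseDerivative

variable {l m n : Type*}

theorem hasDerivAt_matrix_mul_apply [Fintype m] {A : ℝ → Matrix l m ℂ} {B : ℝ → Matrix m n ℂ}
    {A' : Matrix l m ℂ} {B' : Matrix m n ℂ} {t : ℝ}
    (hA : ∀ i j, HasDerivAt (fun t => A t i j) (A' i j) t)
    (hB : ∀ i j, HasDerivAt (fun t => B t i j) (B' i j) t) (i : l) (j : n) :
    HasDerivAt (fun t => (A t * B t) i j) ((A' * B t + A t * B') i j) t := by
  simp only [Matrix.mul_apply, Matrix.add_apply, ← Finset.sum_add_distrib]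
  exact HasDerivAt.fun_sum fun k _ => (hA i k).mul (hB k j)

theorem hasDerivAt_conjTranspose_apply {A : ℝ → Matrix l m ℂ} {A' : Matrix l m ℂ} {t : ℝ}
    (hA : ∀ i j, HasDerivAt (fun t => A t i j) (A' i j) t) (i : m) (j : l) :
    HasDerivAt (fun t => (A t).conjTranspose i j) (A'.conjTranspose i j) t :=
  (hA j i).star

theorem hasDerivAt_matrix_pow_apply [Fintype n] [DecidableEq n] {H : ℝ → Matrix n n ℂ} {H' : Matrix n n ℂ} {t : ℝ}
    (hH : ∀ i j, HasDerivAt (fun t => H t i j) (H' i j) t) (q : ℕ) (i j : n) :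
    HasDerivAt (fun t => (H t ^ q) i j)
      ((∑ p ∈ Finset.range q, H t ^ p * H' * H t ^ (q - 1 - p)) i j) t := by
  induction q generalizing i j with
  | zero => simpa using hasDerivAt_const t ((1 : Matrix n n ℂ) i j)
  | succ q ih =>
    simp only [pow_succ]
    refine (hasDerivAt_matrix_mul_apply ih hH i j).congr_deriv ?_
    rw [Finset.sum_range_succ, Finset.sum_mul]
    refine congrArg (fun M : Matrix n n ℂ => M i j) (congrArg₂ (· + ·) ?_ ?_)
    · refine Finset.sum_congr rfl fun p hp => ?_
      rw [Matrix.mul_assoc, ← pow_succ]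
      have := Finset.mem_range.1 hp
      rw [show q - 1 - p + 1 = q + 1 - 1 - p by omega]
    · simp

theorem hasDerivAt_matrix_trace [Fintype n] {H : ℝ → Matrix n n ℂ} {H' : Matrix n n ℂ} {t : ℝ}
    (hH : ∀ i j, HasDerivAt (fun t => H t i j) (H' i j) t) :
    HasDerivAt (fun t => (H t).trace) H'.trace t := by
  simp only [Matrix.trace, Matrix.diag_apply]
  exact HasDerivAt.fun_sum fun k _ => hH k k

theorem hasDerivAt_complex_re {f : ℝ → ℂ} {f' : ℂ} {t : ℝ} (hf : HasDerivAt f f' t) :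
    HasDerivAt (fun t => (f t).re) f'.re t :=
  (Complex.reCLM.hasFDerivAt.comp_hasDerivAt t hf)

end EntrywiseDerivative

theorem hasDerivAt_add_smul_apply {m n : Type*} (A E : Matrix m n ℂ) (t : ℝ) (i : m) (j : n) :
    HasDerivAt (fun t : ℝ => (A + (t : ℂ) • E) i j) (E i j) t := by
  simp only [Matrix.add_apply, Matrix.smul_apply, smul_eq_mul]
  have := (Complex.ofRealCLM.hasDerivAt (x := t)).mul_const (E i j)
  simpa using this.const_add (A i j)

theorem re_trace_mul_add_conjTranspose {n : Type*} [Fintype n] (H L : Matrix n n ℂ) (hH : H.conjTranspose = H) :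
    ((H * (L.conjTranspose + L)).trace).re = 2 * ((H * L).trace).re := by
  have : (H * L.conjTranspose).trace = star (H * L).trace := by
    rw [← Matrix.trace_conjTranspose, Matrix.conjTranspose_mul, hH, Matrix.trace_mul_comm]
  rw [Matrix.mul_add, Matrix.trace_add, Complex.add_re, this, Complex.star_def, Complex.conj_re]
  ring

theorem hasDerivAt_gram_apply {m n : Type*} [Fintype m] (A E : Matrix m n ℂ) (i j : n) :
    HasDerivAt (fun t : ℝ => ((A + (t : ℂ) • E).conjTranspose * (A + (t : ℂ) • E)) i j)
      ((E.conjTranspose * A + A.conjTranspose * E) i j) 0 := by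
  have h := hasDerivAt_add_smul_apply A E 0
  simpa using hasDerivAt_matrix_mul_apply (hasDerivAt_conjTranspose_apply h) h i j

/-- Passing from `L` to `I • L` keeps the part in `Lᴴ` and `L` and reverses the part quadratic in
`L`. Subtracting will leave only the latter. -/
theorem re_trace_mul_I {n : Type*} [Fintype n] (L R S : Matrix n n ℂ) :
    ((R * (-(Complex.I • L.conjTranspose) + Complex.I • L) * S * (Complex.I • L)).trace).re =
      ((R * (L.conjTranspose + L) * S * L).trace).re - 2 * ((R * L * S * L).trace).re := by
  have : R * (-(Complex.I • L.conjTranspose) + Complex.I • L) * S * (Complex.I • L) =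
      R * (L.conjTranspose + L) * S * L - (2 : ℂ) • (R * L * S * L) := by
    have e : -(Complex.I • L.conjTranspose) + Complex.I • L =
        Complex.I • ((2 : ℂ) • L - (L.conjTranspose + L)) := by
      rw [two_smul, smul_sub, smul_add, smul_add]; abel
    rw [e, Matrix.mul_smul, Matrix.mul_smul, Matrix.smul_mul, Matrix.smul_mul, smul_smul,
      Complex.I_mul_I, neg_one_smul, Matrix.mul_sub, Matrix.sub_mul, Matrix.sub_mul,
      neg_sub, Matrix.mul_smul, Matrix.smul_mul, Matrix.smul_mul]
  rw [this, Matrix.trace_sub, Matrix.trace_smul, Complex.sub_re, smul_eq_mul]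
  congr 1
  simp

/-! ### First and second derivatives of the Gram trace and its smoothed power. -/

section GramDerivative

variable {m n : Type*} [Fintype m] [Fintype n] [DecidableEq n]

/-- The first derivative of `gramTrace (q + 1)` at `A` in the direction `E`. -/
noncomputable def gramTraceDeriv (q : ℕ) (A E : Matrix m n ℂ) : ℝ :=
  2 * (q + 1) * (((A.conjTranspose * A) ^ q * (A.conjTranspose * E)).trace).re

/-- The second derivative of `gramTrace (k + 2)` at `A` in the direction `E`. -/
noncomputable def gramTraceDeriv2 (k : ℕ) (A E : Matrix m n ℂ) : ℝ :=
  2 * (k + 2) * (((∑ p ∈ Finset.range (k + 1), (A.conjTranspose * A) ^ p *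
    (E.conjTranspose * A + A.conjTranspose * E) * (A.conjTranspose * A) ^ (k - p)) *
      (A.conjTranspose * E) + (A.conjTranspose * A) ^ (k + 1) * (E.conjTranspose * E)).trace).re

theorem gram_pow_conjTranspose (A : Matrix m n ℂ) (q : ℕ) :
    ((A.conjTranspose * A) ^ q).conjTranspose = (A.conjTranspose * A) ^ q := by
  rw [Matrix.conjTranspose_pow, Matrix.conjTranspose_mul, Matrix.conjTranspose_conjTranspose]

theorem hasDerivAt_gramTrace (q : ℕ) (A E : Matrix m n ℂ) :
    HasDerivAt (fun t : ℝ => gramTrace (q + 1) (A + (t : ℂ) • E)) (gramTraceDeriv q A E) 0 := by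
  have h := hasDerivAt_complex_re (hasDerivAt_matrix_trace
    (hasDerivAt_matrix_pow_apply (hasDerivAt_gram_apply A E) (q + 1)))
  refine h.congr_deriv ?_
  simp only [Complex.ofReal_zero, zero_smul, add_zero]
  rw [Matrix.trace_sum]
  have : ∀ p ∈ Finset.range (q + 1), ((A.conjTranspose * A) ^ p *
      (E.conjTranspose * A + A.conjTranspose * E) * (A.conjTranspose * A) ^ (q + 1 - 1 - p)).trace =
      ((A.conjTranspose * A) ^ q * (E.conjTranspose * A + A.conjTranspose * E)).trace :=
    fun p hp => by
      rw [Matrix.trace_mul_comm, ← Matrix.mul_assoc, ← pow_add]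
      congr 3
      have := Finset.mem_range.1 hp
      omega
  rw [Finset.sum_congr rfl this, Finset.sum_const, Finset.card_range, nsmul_eq_mul, gramTraceDeriv]
  have h2 := re_trace_mul_add_conjTranspose ((A.conjTranspose * A) ^ q) (A.conjTranspose * E)
    (gram_pow_conjTranspose A q)
  rw [Matrix.conjTranspose_mul, Matrix.conjTranspose_conjTranspose] at h2
  rw [← Complex.ofReal_natCast, Complex.re_ofReal_mul, h2]
  push_cast
  ring

theorem hasDerivAt_gramTraceDeriv (k : ℕ) (A E : Matrix m n ℂ) :
    HasDerivAt (fun t : ℝ => gramTraceDeriv (k + 1) (A + (t : ℂ) • E) E)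
      (gramTraceDeriv2 k A E) 0 := by
  have h1 := hasDerivAt_matrix_pow_apply (hasDerivAt_gram_apply A E) (k + 1)
  have h2 : ∀ i j, HasDerivAt (fun t : ℝ => ((A + (t : ℂ) • E).conjTranspose * E) i j)
      ((E.conjTranspose * E) i j) 0 := fun i j => by
    simpa using hasDerivAt_matrix_mul_apply (hasDerivAt_conjTranspose_apply
      (hasDerivAt_add_smul_apply A E 0)) (B := fun _ => E) (B' := 0)
      (fun i j => hasDerivAt_const _ _) i j
  have h := (hasDerivAt_complex_re (hasDerivAt_matrix_trace
    (hasDerivAt_matrix_mul_apply h1 h2))).const_mul (2 * ((k + 1 : ℕ) + 1 : ℝ))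
  refine h.congr_deriv ?_
  rw [gramTraceDeriv2]
  simp only [Complex.ofReal_zero, zero_smul, add_zero, add_tsub_cancel_right]
  push_cast
  ring

/-- The smoothed power of the Gram trace. -/
noncomputable def gramPotential (k : ℕ) (s ε : ℝ) (A : Matrix m n ℂ) : ℝ :=
  (gramTrace (k + 2) A + ε) ^ s

/-- The first derivative of `gramPotential` in the direction `E`. -/
noncomputable def gramPotentialDeriv (k : ℕ) (s ε : ℝ) (A E : Matrix m n ℂ) : ℝ :=
  s * (gramTrace (k + 2) A + ε) ^ (s - 1) * gramTraceDeriv (k + 1) A E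

/-- The second derivative of `gramPotential` in the direction `E`. -/
noncomputable def gramPotentialDeriv2 (k : ℕ) (s ε : ℝ) (A E : Matrix m n ℂ) : ℝ :=
  s * ((s - 1) * (gramTrace (k + 2) A + ε) ^ (s - 2) * gramTraceDeriv (k + 1) A E ^ 2 +
    (gramTrace (k + 2) A + ε) ^ (s - 1) * gramTraceDeriv2 k A E)

variable (k : ℕ) (s : ℝ) {ε : ℝ} (A E : Matrix m n ℂ)

theorem hasDerivAt_gramPotential (hε : 0 < ε) :
    HasDerivAt (fun t : ℝ => gramPotential k s ε (A + (t : ℂ) • E))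
      (gramPotentialDeriv k s ε A E) 0 := by
  have h0 := gramTrace_nonneg (k + 2) A
  have h := ((hasDerivAt_gramTrace (k + 1) A E).add_const ε).rpow_const (p := s)
    (Or.inl (by simpa using (by positivity : gramTrace (k + 2) A + ε ≠ 0)))
  refine h.congr_deriv ?_
  rw [gramPotentialDeriv]
  simp only [Complex.ofReal_zero, zero_smul, add_zero]
  ring_nf

theorem hasDerivAt_gramPotentialDeriv (hε : 0 < ε) :
    HasDerivAt (fun t : ℝ => gramPotentialDeriv k s ε (A + (t : ℂ) • E) E)
      (gramPotentialDeriv2 k s ε A E) 0 := by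
  have h0 := gramTrace_nonneg (k + 2) A
  have h := ((hasDerivAt_gramTrace (k + 1) A E).add_const ε).rpow_const (p := s - 1)
    (Or.inl (by simpa using (by positivity : gramTrace (k + 2) A + ε ≠ 0)))
  have h' := (h.const_mul s).mul (hasDerivAt_gramTraceDeriv k A E)
  refine h'.congr_deriv ?_
  rw [gramPotentialDeriv2]
  simp only [Complex.ofReal_zero, zero_smul, add_zero]
  have e : s - 1 - 1 = s - 2 := by ring
  rw [e]
  ring_nf

/-- All terms involving `Eᴴ` agree for `E` and `I • E` and cancel, by `re_trace_mul_I`. -/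
theorem gramTraceDeriv2_sub_I :
    gramTraceDeriv2 k A E - gramTraceDeriv2 k A (Complex.I • E) =
      4 * (k + 2) * ∑ p ∈ Finset.range (k + 1),
        (((A.conjTranspose * A) ^ p * (A.conjTranspose * E) * (A.conjTranspose * A) ^ (k - p) *
          (A.conjTranspose * E)).trace).re := by
  have hI : (Complex.I • E).conjTranspose = -(Complex.I • E.conjTranspose) := by
    rw [Matrix.conjTranspose_smul]; simp
  have hEE : (Complex.I • E).conjTranspose * (Complex.I • E) = E.conjTranspose * E := by
    rw [hI, Matrix.neg_mul, Matrix.smul_mul, Matrix.mul_smul, smul_smul, Complex.I_mul_I]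
    simp
  have hL : (A.conjTranspose * E).conjTranspose = E.conjTranspose * A := by
    rw [Matrix.conjTranspose_mul, Matrix.conjTranspose_conjTranspose]
  have hIL : (Complex.I • E).conjTranspose * A + A.conjTranspose * (Complex.I • E) =
      -(Complex.I • (A.conjTranspose * E).conjTranspose) + Complex.I • (A.conjTranspose * E) := by
    rw [hI, hL, Matrix.neg_mul, Matrix.smul_mul, Matrix.mul_smul]
  rw [gramTraceDeriv2, gramTraceDeriv2, hEE, hIL, ← hL]
  simp only [Matrix.trace_add, Matrix.trace_sum, Finset.sum_mul, Complex.add_re, Complex.re_sum,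
    Matrix.mul_smul A.conjTranspose]
  simp only [re_trace_mul_I, Finset.sum_sub_distrib, ← Finset.mul_sum]
  ring

theorem gramTraceDeriv_sq_sub_I (q : ℕ) :
    gramTraceDeriv q A E ^ 2 - gramTraceDeriv q A (Complex.I • E) ^ 2 =
      4 * (q + 1) ^ 2 * (((A.conjTranspose * A) ^ q * (A.conjTranspose * E)).trace *
        ((A.conjTranspose * A) ^ q * (A.conjTranspose * E)).trace).re := by
  rw [gramTraceDeriv, gramTraceDeriv, Matrix.mul_smul, Matrix.mul_smul, Matrix.trace_smul]
  simp only [smul_eq_mul, Complex.mul_re, Complex.I_re, Complex.I_im]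
  ring

theorem gram_pow_mul_conjTranspose_apply (q : ℕ) (i : m) (j : n) :
    ((A.conjTranspose * A) ^ q * A.conjTranspose) j i = star (gramPow q A i j) := by
  rw [← Matrix.conjTranspose_apply, gramPow, Matrix.conjTranspose_mul, gram_pow_conjTranspose]

/-- For a matrix unit the traces collapse to conjugates of entries of `gramPow`, and conjugation is
invisible to the real part. Writing `τ^(s-2)` as `τ^(s-1) / τ` produces the correction with `1 - s`.
Summed over the entries this is the defect, with factor `4 s (k + 2)`. -/
theorem gramPotentialDeriv2_sub_I [DecidableEq m] (i : m) (j : n) (hε : 0 < ε) :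
    gramPotentialDeriv2 k s ε A (Matrix.single i j (1 : ℂ)) -
      gramPotentialDeriv2 k s ε A (Complex.I • Matrix.single i j (1 : ℂ)) =
    4 * s * (k + 2) * ((gramTrace (k + 2) A + ε) ^ (s - 1) *
      ((∑ t : Fin (k + 1), (gramPow t A i j * gramPow (k - t) A i j).re) -
      (1 - s) * (k + 2) / (gramTrace (k + 2) A + ε) *
        (gramPow (k + 1) A i j * gramPow (k + 1) A i j).re)) := by
  have h0 := gramTrace_nonneg (k + 2) A
  have hτ : 0 < gramTrace (k + 2) A + ε := by positivity
  have hc : ((A.conjTranspose * A) ^ (k + 1) * (A.conjTranspose * Matrix.single i j (1 : ℂ))).trace =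
      star (gramPow (k + 1) A i j) := by
    rw [← Matrix.mul_assoc, Matrix.trace_mul_single, MulOpposite.op_one, one_smul, gram_pow_mul_conjTranspose_apply]
  have hp : ∀ p q : ℕ, ((A.conjTranspose * A) ^ p * (A.conjTranspose * Matrix.single i j (1 : ℂ)) *
      (A.conjTranspose * A) ^ q * (A.conjTranspose * Matrix.single i j (1 : ℂ))).trace =
      star (gramPow p A i j * gramPow q A i j) := fun p q => by
    rw [← Matrix.mul_assoc, ← Matrix.mul_assoc, Matrix.trace_mul_single, MulOpposite.op_one, one_smul, Matrix.mul_assoc _ _ A.conjTranspose,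
      Matrix.mul_apply, Finset.sum_eq_single j]
    · rw [Matrix.mul_single_apply_same, gram_pow_mul_conjTranspose_apply,
        gram_pow_mul_conjTranspose_apply, star_mul', mul_one]
    · intro b _ hb
      rw [Matrix.mul_single_apply_of_ne _ _ _ _ _ hb, zero_mul]
    · simp
  have e1 := gramTraceDeriv2_sub_I k A (Matrix.single i j (1 : ℂ))
  have e2 := gramTraceDeriv_sq_sub_I A (Matrix.single i j (1 : ℂ)) (k + 1)
  rw [hc, ← star_mul', Complex.star_def, Complex.conj_re] at e2
  simp only [hp, Complex.star_def, Complex.conj_re] at e1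
  rw [Finset.sum_range (fun p => (gramPow p A i j * gramPow (k - p) A i j).re)] at e1
  have e3 : (gramTrace (k + 2) A + ε) ^ (s - 2) =
      (gramTrace (k + 2) A + ε) ^ (s - 1) / (gramTrace (k + 2) A + ε) := by
    rw [← Real.rpow_sub_one hτ.ne']; congr 1; ring
  rw [gramPotentialDeriv2, gramPotentialDeriv2, e3]
  push_cast at e2
  set τ := gramTrace (k + 2) A + ε
  have : ∀ a b c d e f g : ℝ, s * ((s - 1) * a * b + c * d) - s * ((s - 1) * a * e + c * f) =
    s * ((s - 1) * a * (b - e) + c * (d - f)) := by intros; ring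
  rw [this _ _ _ _ _ _ 0, e1, e2]
  field_simp
  ring

end GramDerivative

/-! ### Continuity and growth of these derivatives. -/

theorem ExpGrowth.matrix_trace {ι n : Type*} [Fintype ι] [Fintype n] {H : (ι → ℝ) → Matrix n n ℂ}
    (hH : ∀ i j, ExpGrowth fun x => H x i j) : ExpGrowth fun x => (H x).trace := by
  simp only [Matrix.trace, Matrix.diag_apply]
  exact ExpGrowth.sum _ fun i _ => hH i i

section Regularity

variable {m n : Type*} [Fintype m] [Fintype n] [DecidableEq n]

theorem continuous_gramTraceDeriv (q : ℕ) (E : Matrix m n ℂ) :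
    Continuous fun A : Matrix m n ℂ => gramTraceDeriv q A E :=
  continuous_const.mul (Complex.continuous_re.comp (((continuous_gram_pow q).matrix_mul
    (continuous_id.matrix_conjTranspose.matrix_mul continuous_const)).matrix_trace))

theorem continuous_gramTraceDeriv2 (k : ℕ) (E : Matrix m n ℂ) :
    Continuous fun A : Matrix m n ℂ => gramTraceDeriv2 k A E := by
  refine continuous_const.mul (Complex.continuous_re.comp (Continuous.matrix_trace
    (Continuous.add (Continuous.matrix_mul (continuous_finsetSum _ fun p _ => ?_)
    (continuous_id.matrix_conjTranspose.matrix_mul continuous_const))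
    ((continuous_gram_pow _).matrix_mul continuous_const))))
  exact ((continuous_gram_pow p).matrix_mul ((continuous_const.matrix_mul continuous_id).add
    (continuous_id.matrix_conjTranspose.matrix_mul continuous_const))).matrix_mul
    (continuous_gram_pow _)

theorem continuous_gramTrace_rpow (q : ℕ) (s : ℝ) {ε : ℝ} (hε : 0 < ε) :
    Continuous fun A : Matrix m n ℂ => (gramTrace q A + ε) ^ s :=
  ((continuous_gramTrace q).add continuous_const).rpow_const fun A => Or.inl (by
    exact (add_pos_of_nonneg_of_pos (gramTrace_nonneg q A) hε).ne')

theorem continuous_gramPotentialDeriv (k : ℕ) (s : ℝ) {ε : ℝ} (hε : 0 < ε) (E : Matrix m n ℂ) :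
    Continuous fun A : Matrix m n ℂ => gramPotentialDeriv k s ε A E :=
  (continuous_const.mul (continuous_gramTrace_rpow _ _ hε)).mul (continuous_gramTraceDeriv _ E)

theorem continuous_gramPotentialDeriv2 (k : ℕ) (s : ℝ) {ε : ℝ} (hε : 0 < ε) (E : Matrix m n ℂ) :
    Continuous fun A : Matrix m n ℂ => gramPotentialDeriv2 k s ε A E :=
  continuous_const.mul (((continuous_const.mul (continuous_gramTrace_rpow _ _ hε)).mul
    ((continuous_gramTraceDeriv _ E).pow 2)).add
    ((continuous_gramTrace_rpow _ _ hε).mul (continuous_gramTraceDeriv2 _ E)))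

variable {ι : Type*} [Fintype ι] {A : (ι → ℝ) → Matrix m n ℂ}

theorem ExpGrowth.gramTraceDeriv (hA : ∀ i j, ExpGrowth fun x => A x i j) (q : ℕ)
    (E : Matrix m n ℂ) : ExpGrowth fun x => gramTraceDeriv q (A x) E := by
  have hc : ∀ (B : Matrix m n ℂ) i j, ExpGrowth fun _ : ι → ℝ => B i j :=
    fun B i j => ExpGrowth.const _
  have hH := ExpGrowth.matrix_pow (ExpGrowth.matrix_mul (ExpGrowth.conjTranspose hA) hA) q
  have hAE := ExpGrowth.matrix_mul (ExpGrowth.conjTranspose hA) (hc E)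
  simp only [_root_.gramTraceDeriv]
  exact (ExpGrowth.const _).mul (ExpGrowth.matrix_trace (ExpGrowth.matrix_mul hH hAE)).re

theorem ExpGrowth.gramTraceDeriv2 (hA : ∀ i j, ExpGrowth fun x => A x i j) (k : ℕ)
    (E : Matrix m n ℂ) : ExpGrowth fun x => gramTraceDeriv2 k (A x) E := by
  have hc : ∀ (B : Matrix m n ℂ) i j, ExpGrowth fun _ : ι → ℝ => B i j :=
    fun B i j => ExpGrowth.const _
  have hH := ExpGrowth.matrix_pow (ExpGrowth.matrix_mul (ExpGrowth.conjTranspose hA) hA)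
  have hAE := ExpGrowth.matrix_mul (ExpGrowth.conjTranspose hA) (hc E)
  have hEA := ExpGrowth.matrix_mul (ExpGrowth.conjTranspose (hc E)) hA
  have hEE := ExpGrowth.matrix_mul (ExpGrowth.conjTranspose (hc E)) (hc E)
  simp only [_root_.gramTraceDeriv2]
  refine (ExpGrowth.const _).mul (ExpGrowth.matrix_trace fun i j => ?_).re
  simp only [Matrix.add_apply]
  refine (ExpGrowth.matrix_mul (fun i j => ?_) hAE i j).add (ExpGrowth.matrix_mul (hH _) hEE i j)
  simp only [Matrix.sum_apply]
  refine ExpGrowth.sum _ fun p _ => ExpGrowth.matrix_mul (ExpGrowth.matrix_mul (hH p)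
    fun i j => ?_) (hH _) i j
  simp only [Matrix.add_apply]
  exact (hEA i j).add (hAE i j)

theorem ExpGrowth.gramPotential (hA : ∀ i j, ExpGrowth fun x => A x i j) (k : ℕ) {s ε : ℝ}
    (hε : 0 < ε) (hs0 : 0 ≤ s) (hs : s ≤ 1) : ExpGrowth fun x => gramPotential k s ε (A x) := by
  refine ((ExpGrowth.gramTrace hA (k + 2)).add (ExpGrowth.const (ε + 1))).of_norm_le fun x => ?_
  have h := gramTrace_nonneg (k + 2) (A x)
  rw [_root_.gramPotential, Real.norm_of_nonneg (by positivity), Real.norm_of_nonneg (by positivity)]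
  rcases le_total 1 (_root_.gramTrace (k + 2) (A x) + ε) with h1 | h1
  · refine (Real.rpow_le_rpow_of_exponent_le h1 hs).trans ?_
    rw [Real.rpow_one]; linarith
  · refine (Real.rpow_le_one (by positivity) h1 hs0).trans ?_
    linarith

theorem ExpGrowth.gramPotentialDeriv (hA : ∀ i j, ExpGrowth fun x => A x i j) (k : ℕ) {s ε : ℝ}
    (hε : 0 < ε) (hs : s ≤ 1) (E : Matrix m n ℂ) :
    ExpGrowth fun x => gramPotentialDeriv k s ε (A x) E := by
  simp only [_root_.gramPotentialDeriv]
  exact ((ExpGrowth.const s).mul (ExpGrowth.gramTrace_rpow hε (by linarith) _)).mul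
    (ExpGrowth.gramTraceDeriv hA _ E)

theorem ExpGrowth.gramPotentialDeriv2 (hA : ∀ i j, ExpGrowth fun x => A x i j) (k : ℕ) {s ε : ℝ}
    (hε : 0 < ε) (hs : s ≤ 1) (E : Matrix m n ℂ) :
    ExpGrowth fun x => gramPotentialDeriv2 k s ε (A x) E := by
  unfold _root_.gramPotentialDeriv2
  simp only [sq]
  exact (ExpGrowth.const s).mul ((((ExpGrowth.const _).mul
    (ExpGrowth.gramTrace_rpow hε (by linarith) _)).mul ((ExpGrowth.gramTraceDeriv hA _ E).mul
    (ExpGrowth.gramTraceDeriv hA _ E))).add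
    ((ExpGrowth.gramTrace_rpow hε (by linarith) _).mul (ExpGrowth.gramTraceDeriv2 hA _ E)))

end Regularity

/-! ### Differentiability of the Gram trace. -/

section Differentiability

variable {V : Type*} [NormedAddCommGroup V] [NormedSpace ℝ V]

theorem differentiable_matrix_mul_apply {l m n : Type*} [Fintype m] {A : V → Matrix l m ℂ}
    {B : V → Matrix m n ℂ} (hA : ∀ i j, Differentiable ℝ fun x => A x i j)
    (hB : ∀ i j, Differentiable ℝ fun x => B x i j) (i : l) (j : n) :
    Differentiable ℝ fun x => (A x * B x) i j := by
  simp only [Matrix.mul_apply]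
  exact Differentiable.fun_sum fun k _ => (hA i k).mul (hB k j)

theorem differentiable_matrix_pow_apply {n : Type*} [Fintype n] [DecidableEq n]
    {A : V → Matrix n n ℂ} (hA : ∀ i j, Differentiable ℝ fun x => A x i j) (q : ℕ) (i j : n) :
    Differentiable ℝ fun x => (A x ^ q) i j := by
  induction q generalizing i j with
  | zero => simp
  | succ q ih => simpa only [pow_succ] using differentiable_matrix_mul_apply ih hA i j

theorem differentiable_gramTrace {m n : Type*} [Fintype m] [Fintype n] [DecidableEq n]
    {A : V → Matrix m n ℂ} (hA : ∀ i j, Differentiable ℝ fun x => A x i j) (q : ℕ) :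
    Differentiable ℝ fun x => gramTrace q (A x) := by
  have h1 : ∀ i j, Differentiable ℝ fun x => (A x).conjTranspose i j := fun i j => (hA j i).star
  have h2 := differentiable_matrix_pow_apply (differentiable_matrix_mul_apply h1 hA) q
  simp only [gramTrace, Matrix.trace, Matrix.diag_apply]
  exact Complex.reCLM.differentiable.comp (Differentiable.fun_sum fun i _ => h2 i i)

end Differentiability

/-! ### Derivative in the angle between real and imaginary parts. -/

section Rotation

variable {m n : Type*} [DecidableEq m] [DecidableEq n]

/-- The scaling of the real coordinates by `cos θ` and of the imaginary ones by `sin θ`. -/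
noncomputable def rotScale (κ : Type*) (θ : ℝ) : κ ⊕ κ → ℝ :=
  Sum.elim (fun _ => Real.cos θ) fun _ => Real.sin θ

theorem complexMatrix_single_inl (i : m) (j : n) :
    complexMatrix (Pi.single (Sum.inl (i, j)) 1) = Matrix.single i j (1 : ℂ) := by
  ext a b
  by_cases h : i = a ∧ j = b
  · obtain ⟨rfl, rfl⟩ := h; simp [complexMatrix]
  · have h' : ¬ (a = i ∧ b = j) := fun e => h ⟨e.1.symm, e.2.symm⟩
    simp [complexMatrix, Pi.single_apply, h, h']

theorem complexMatrix_single_inr (i : m) (j : n) :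
    complexMatrix (Pi.single (Sum.inr (i, j)) 1) = Complex.I • Matrix.single i j (1 : ℂ) := by
  ext a b
  by_cases h : i = a ∧ j = b
  · obtain ⟨rfl, rfl⟩ := h; simp [complexMatrix]
  · have h' : ¬ (a = i ∧ b = j) := fun e => h ⟨e.1.symm, e.2.symm⟩
    simp [complexMatrix, Pi.single_apply, h, h']

theorem complexMatrix_add_single (x : m × n ⊕ m × n → ℝ) (c : m × n ⊕ m × n) (t : ℝ) :
    complexMatrix (x + Pi.single c t) =
      complexMatrix x + (t : ℂ) • complexMatrix (Pi.single c 1) := by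
  rw [complexMatrix_add, ← complexMatrix_smul, ← Pi.single_smul, smul_eq_mul, mul_one]

variable [Fintype m] [Fintype n]

/-- In the scaling formula the product `w w'` is `-cos θ sin θ` on real coordinates and `+cos θ sin
θ` on imaginary ones, so the second derivatives appear exactly as the differences computed in
`gramPotentialDeriv2_sub_I`. -/
theorem hasDerivAt_integral_gramPotential (k : ℕ) {s ε : ℝ} (hε : 0 < ε) (hs0 : 0 ≤ s)
    (hs : s ≤ 1) (θ : ℝ) :
    HasDerivAt (fun θ => ∫ x, gramPotential k s ε (complexMatrix (rotScale (m × n) θ * x))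
      ∂gaussPi (m × n ⊕ m × n))
      (-(Real.cos θ * Real.sin θ * (4 * s * (k + 2)) *
        ∫ x, laplaceDefect k s ε (complexMatrix (rotScale (m × n) θ * x))
          ∂gaussPi (m × n ⊕ m × n))) θ := by
  have hA : ∀ i j, ExpGrowth fun x : m × n ⊕ m × n → ℝ => complexMatrix x i j :=
    ExpGrowth.complexMatrix
  have hD : Differentiable ℝ fun x : m × n ⊕ m × n → ℝ => gramPotential k s ε (complexMatrix x) := by
    unfold gramPotential
    refine Differentiable.rpow_const ((differentiable_gramTrace (fun i j => ?_) _).add_const ε)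
      fun x => Or.inl ?_
    · simp only [complexMatrix, Matrix.of_apply]
      have h := fun c : m × n ⊕ m × n => (Complex.ofRealCLM.comp
        (ContinuousLinearMap.proj c : (m × n ⊕ m × n → ℝ) →L[ℝ] ℝ)).differentiable
      exact (h _).add ((h _).mul_const _)
    · have := gramTrace_nonneg (k + 2) (complexMatrix x)
      positivity
  have hcm := continuous_complexMatrix (m := m) (n := n)
  have h := hasDerivAt_integral_gaussPi_scale (ι := m × n ⊕ m × n)
    (f1 := fun c x => gramPotentialDeriv k s ε (complexMatrix x) (complexMatrix (Pi.single c 1)))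
    (f2 := fun c x => gramPotentialDeriv2 k s ε (complexMatrix x) (complexMatrix (Pi.single c 1)))
    hD (ExpGrowth.gramPotential hA k hε hs0 hs)
    (fun c => (continuous_gramPotentialDeriv k s hε _).comp hcm)
    (fun c => (continuous_gramPotentialDeriv2 k s hε _).comp hcm)
    (fun c => ExpGrowth.gramPotentialDeriv hA k hε hs _)
    (fun c => ExpGrowth.gramPotentialDeriv2 hA k hε hs _)
    (fun c x => by
      simp only [complexMatrix_add_single]
      exact hasDerivAt_gramPotential k s _ _ hε)
    (fun c x => by
      simp only [complexMatrix_add_single]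
      exact hasDerivAt_gramPotentialDeriv k s _ _ hε)
    (w := rotScale (m × n)) (w' := fun θ => Sum.elim (fun _ => -Real.sin θ) fun _ => Real.cos θ)
    (fun θ c => by
      rcases c with c | c
      · exact Real.hasDerivAt_cos θ
      · exact Real.hasDerivAt_sin θ)
    (fun θ c => by
      rcases c with c | c
      · exact Real.abs_cos_le_one θ
      · exact Real.abs_sin_le_one θ)
    (fun θ c => by
      rcases c with c | c
      · simpa using Real.abs_sin_le_one θ
      · exact Real.abs_cos_le_one θ) θ
  refine h.congr_deriv ?_
  have hscale : ∀ x : m × n ⊕ m × n → ℝ, ∑ i, |(rotScale (m × n) θ * x) i| ≤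
      1 * ∑ i, |x i| + 0 := fun x => by
    rw [one_mul, add_zero]
    refine Finset.sum_le_sum fun i _ => ?_
    rw [Pi.mul_apply, abs_mul]
    refine mul_le_of_le_one_left (abs_nonneg _) ?_
    rcases i with c | c
    · exact Real.abs_cos_le_one θ
    · exact Real.abs_sin_le_one θ
  have hsc : Continuous fun x : m × n ⊕ m × n → ℝ => rotScale (m × n) θ * x := by fun_prop
  have hint : ∀ c, Integrable (fun x : m × n ⊕ m × n → ℝ => gramPotentialDeriv2 k s ε
      (complexMatrix (rotScale (m × n) θ * x)) (complexMatrix (Pi.single c 1)))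
      (gaussPi (m × n ⊕ m × n)) := fun c =>
    ((ExpGrowth.gramPotentialDeriv2 hA k hε hs _).comp 1 0 hscale).integrable_of_continuous
      ((continuous_gramPotentialDeriv2 k s hε _).comp (hcm.comp hsc))
  rw [Fintype.sum_sum_type]
  have hr1 : ∀ q, rotScale (m × n) θ (Sum.inl q) = Real.cos θ := fun _ => rfl
  have hr2 : ∀ q, rotScale (m × n) θ (Sum.inr q) = Real.sin θ := fun _ => rfl
  simp only [hr1, hr2, Sum.elim_inl, Sum.elim_inr]
  rw [← Finset.sum_add_distrib]
  have hpt : ∀ x : m × n ⊕ m × n → ℝ, 4 * s * (k + 2) *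
      laplaceDefect k s ε (complexMatrix (rotScale (m × n) θ * x)) =
      ∑ q : m × n, (gramPotentialDeriv2 k s ε (complexMatrix (rotScale (m × n) θ * x))
        (complexMatrix (Pi.single (Sum.inl q) 1)) -
        gramPotentialDeriv2 k s ε (complexMatrix (rotScale (m × n) θ * x))
        (complexMatrix (Pi.single (Sum.inr q) 1))) := fun x => by
    rw [Fintype.sum_prod_type, laplaceDefect]
    simp only [complexMatrix_single_inl, complexMatrix_single_inr, Finset.mul_sum]
    refine Finset.sum_congr rfl fun i _ => Finset.sum_congr rfl fun j _ => ?_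
    rw [gramPotentialDeriv2_sub_I k s _ i j hε]
  have hI : 4 * s * (k + 2) * ∫ x, laplaceDefect k s ε (complexMatrix (rotScale (m × n) θ * x))
      ∂gaussPi (m × n ⊕ m × n) =
      ∑ q : m × n, (∫ x, gramPotentialDeriv2 k s ε (complexMatrix (rotScale (m × n) θ * x))
        (complexMatrix (Pi.single (Sum.inl q) 1)) ∂gaussPi (m × n ⊕ m × n) -
        ∫ x, gramPotentialDeriv2 k s ε (complexMatrix (rotScale (m × n) θ * x))
        (complexMatrix (Pi.single (Sum.inr q) 1)) ∂gaussPi (m × n ⊕ m × n)) := by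
    have hsub : ∀ q : m × n, Integrable (fun x : m × n ⊕ m × n → ℝ =>
        gramPotentialDeriv2 k s ε (complexMatrix (rotScale (m × n) θ * x))
          (complexMatrix (Pi.single (Sum.inl q) 1)) -
        gramPotentialDeriv2 k s ε (complexMatrix (rotScale (m × n) θ * x))
          (complexMatrix (Pi.single (Sum.inr q) 1))) (gaussPi (m × n ⊕ m × n)) :=
      fun q => (hint _).sub (hint _)
    rw [← integral_const_mul]
    simp only [hpt]
    rw [integral_finsetSum _ fun q _ => hsub q]
    exact Finset.sum_congr rfl fun q _ => integral_sub (hint _) (hint _)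
  rw [mul_assoc (Real.cos θ * Real.sin θ), hI, Finset.mul_sum, ← Finset.sum_neg_distrib]
  refine Finset.sum_congr rfl fun q _ => ?_
  ring

end Rotation

/-! ### Gaussian measures on a disjoint union of coordinates. -/

section SumSpace

variable {α β : Type*} [Fintype α] [Fintype β]

theorem measurePreserving_sumElim_gaussPi :
    MeasurePreserving (fun z : (α → ℝ) × (β → ℝ) => (Sum.elim z.1 z.2 : α ⊕ β → ℝ))
      ((gaussPi α).prod (gaussPi β)) (gaussPi (α ⊕ β)) := by
  have h := measurePreserving_sumPiEquivProdPi_symm (X := fun _ : α ⊕ β => ℝ)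
    fun _ => gaussianReal 0 1
  convert h using 1
  · ext z i
    rcases i with i | i <;> rfl
  · rfl
  · rfl

theorem integral_gaussPi_sum {f : (α ⊕ β → ℝ) → ℝ} (hf : StronglyMeasurable f) :
    ∫ x, f x ∂gaussPi (α ⊕ β) =
      ∫ z, f (Sum.elim z.1 z.2) ∂((gaussPi α).prod (gaussPi β)) := by
  rw [← measurePreserving_sumElim_gaussPi.map_eq,
    integral_map measurePreserving_sumElim_gaussPi.aemeasurable hf.aestronglyMeasurable]

theorem integral_gaussPi_sum_nonneg {f : (α ⊕ β → ℝ) → ℝ} (hf : StronglyMeasurable f)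
    (h : ∀ x, 0 ≤ ∫ y, f (Sum.elim x y) ∂gaussPi β) : 0 ≤ ∫ x, f x ∂gaussPi (α ⊕ β) := by
  rw [integral_gaussPi_sum hf]
  by_cases hi : Integrable (fun z : (α → ℝ) × (β → ℝ) => f (Sum.elim z.1 z.2))
      ((gaussPi α).prod (gaussPi β))
  · rw [integral_prod _ hi]
    exact integral_nonneg h
  -- A non-integrable function has integral zero by convention, which is nonnegative.
  · rw [integral_undef hi]

end SumSpace

/-! ### Monotonicity in the angle on `[0, π/4]`. -/

section Monotonicity

variable {n r : Type*} [Fintype n] [Fintype r] [DecidableEq n] [DecidableEq r]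

/-- A real coordinate of variance `c²` splits into independent parts of variances `d²` and `ρ²`;
both sides have the same covariance. -/
theorem gaussPi_map_rotScale {κ : Type*} [Fintype κ] [DecidableEq κ] {c ρ d : ℝ}
    (h : d ^ 2 + ρ ^ 2 = c ^ 2) :
    (gaussPi (κ ⊕ κ)).map (fun x => (Sum.elim (fun _ => c) fun _ => ρ : κ ⊕ κ → ℝ) * x) =
      (gaussPi (κ ⊕ (κ ⊕ κ))).map fun y => (Sum.elim
        (fun q => d * y (Sum.inl q) + ρ * y (Sum.inr (Sum.inl q)))
        (fun q => ρ * y (Sum.inr (Sum.inr q))) : κ ⊕ κ → ℝ) := by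
  have key := gaussPi_map_mulVec_eq
    (Matrix.fromBlocks (c • (1 : Matrix κ κ ℝ)) 0 0 (ρ • (1 : Matrix κ κ ℝ)))
    (Matrix.fromBlocks (d • (1 : Matrix κ κ ℝ)) (Matrix.fromCols (ρ • (1 : Matrix κ κ ℝ)) 0) 0
      (Matrix.fromCols 0 (ρ • (1 : Matrix κ κ ℝ)))) (by
    simp only [Matrix.fromBlocks_transpose, Matrix.fromBlocks_multiply, Matrix.transpose_fromCols,
      Matrix.fromCols_mul_fromRows, Matrix.transpose_smul, Matrix.transpose_one,
      Matrix.transpose_zero, Matrix.mul_zero, add_zero, zero_add,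
      Matrix.mul_smul, Matrix.mul_one, smul_smul, smul_zero, ← add_smul]
    rw [← sq, ← sq, ← sq, h])
  convert key using 2
  · ext x i
    rcases i with i | i <;> simp [Matrix.fromBlocks_mulVec, Matrix.smul_mulVec]
  · ext x i
    rcases i with i | i <;>
      simp [Matrix.mulVec, dotProduct, Matrix.fromCols, Matrix.one_apply]

/-- With the part of size `d` frozen, what remains is a real shift plus noise of the same size `ρ`
in the real and imaginary coordinates, that is, circular noise. -/
theorem integral_rotScale_nonneg {κ : Type*} [Fintype κ] [DecidableEq κ] {F : (κ ⊕ κ → ℝ) → ℝ}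
    (hF : Continuous F) {d ρ c : ℝ} (hdsq : d ^ 2 + ρ ^ 2 = c ^ 2)
    (h : ∀ x : κ → ℝ, 0 ≤ ∫ y : κ ⊕ κ → ℝ, F (Sum.elim (fun q => d * x q + ρ * y (Sum.inl q))
      fun q => ρ * y (Sum.inr q)) ∂gaussPi (κ ⊕ κ)) :
    0 ≤ ∫ x, F ((Sum.elim (fun _ => c) fun _ => ρ : κ ⊕ κ → ℝ) * x) ∂gaussPi (κ ⊕ κ) := by
  have hc2 : Continuous fun y : κ ⊕ (κ ⊕ κ) → ℝ => (Sum.elim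
      (fun q => d * y (Sum.inl q) + ρ * y (Sum.inr (Sum.inl q)))
      (fun q => ρ * y (Sum.inr (Sum.inr q))) : κ ⊕ κ → ℝ) := by
    refine continuous_pi fun i => ?_
    rcases i with i | i <;> simp only [Sum.elim_inl, Sum.elim_inr] <;> fun_prop
  rw [← integral_map (φ := fun x => (Sum.elim (fun _ => c) fun _ => ρ : κ ⊕ κ → ℝ) * x) (f := F)
      (continuous_const.mul continuous_id).measurable.aemeasurable
      hF.stronglyMeasurable.aestronglyMeasurable, gaussPi_map_rotScale hdsq,
    integral_map hc2.measurable.aemeasurable hF.stronglyMeasurable.aestronglyMeasurable]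
  exact integral_gaussPi_sum_nonneg (hF.comp hc2).stronglyMeasurable h

theorem complexMatrix_sumElim {m n : Type*} (d ρ : ℝ) (x : m × n → ℝ) (y : m × n ⊕ m × n → ℝ) :
    complexMatrix (Sum.elim (fun q => d * x q + ρ * y (Sum.inl q)) fun q => ρ * y (Sum.inr q)) =
      (Matrix.of fun i j => d * x (i, j)).map Complex.ofReal + (ρ : ℂ) • complexMatrix y := by
  ext i j
  simp [complexMatrix]
  ring

/-- The frozen real part has variance `cos² θ - sin² θ`; its nonnegativity is what confines the
angle to `[0, π/4]`. -/
theorem integral_laplaceDefect_rotScale_nonneg (k : ℕ) {s ε : ℝ} (hε : 0 < ε) (hs : s ≤ 1)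
    (hsk : 1 ≤ s * (k + 2)) {θ : ℝ} (hθ : 0 < Real.sin θ)
    (hθ' : Real.sin θ ^ 2 ≤ Real.cos θ ^ 2) :
    0 ≤ ∫ x, laplaceDefect k s ε (complexMatrix (rotScale ((n ⊕ r) × n) θ * x))
      ∂gaussPi ((n ⊕ r) × n ⊕ (n ⊕ r) × n) := by
  refine integral_rotScale_nonneg (F := fun x => laplaceDefect k s ε (complexMatrix x))
    (d := Real.sqrt (Real.cos θ ^ 2 - Real.sin θ ^ 2))
    ((continuous_laplaceDefect k s hε).comp continuous_complexMatrix)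
    (by rw [Real.sq_sqrt (by linarith)]; ring) fun x => ?_
  simp only [complexMatrix_sumElim]
  exact integral_laplaceDefect_shift_nonneg _ k hε hs hsk hθ

theorem integral_gramPotential_le_of_mem_Icc (k : ℕ) {s ε : ℝ} (hε : 0 < ε) (hs : s ≤ 1)
    (hsk : 1 ≤ s * (k + 2)) {θ : ℝ} (hθ : θ ∈ Set.Icc 0 (Real.pi / 4)) :
    ∫ x, gramPotential k s ε (complexMatrix (rotScale ((n ⊕ r) × n) θ * x))
        ∂gaussPi ((n ⊕ r) × n ⊕ (n ⊕ r) × n) ≤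
      ∫ x, gramPotential k s ε (complexMatrix (rotScale ((n ⊕ r) × n) 0 * x))
        ∂gaussPi ((n ⊕ r) × n ⊕ (n ⊕ r) × n) := by
  have hs0 : 0 ≤ s := by
    by_contra hneg
    have : s * (k + 2) ≤ 0 := mul_nonpos_of_nonpos_of_nonneg (le_of_not_ge hneg) (by positivity)
    linarith
  have hd := hasDerivAt_integral_gramPotential (m := n ⊕ r) (n := n) k hε hs0 hs
  have hpi := Real.pi_pos
  refine antitoneOn_of_deriv_nonpos (convex_Icc 0 (Real.pi / 4))
    (fun θ _ => (hd θ).continuousAt.continuousWithinAt)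
    (fun θ _ => (hd θ).differentiableAt.differentiableWithinAt) (fun φ hφ => ?_)
    (Set.left_mem_Icc.2 (by positivity)) hθ hθ.1
  rw [interior_Icc] at hφ
  have hsin : 0 < Real.sin φ := Real.sin_pos_of_pos_of_lt_pi hφ.1 (by linarith [hφ.2])
  have hcos : 0 < Real.cos φ := Real.cos_pos_of_mem_Ioo ⟨by linarith [hφ.1], by linarith [hφ.2]⟩
  have h2 : 0 ≤ Real.cos (2 * φ) :=
    (Real.cos_pos_of_mem_Ioo ⟨by linarith [hφ.1], by linarith [hφ.2]⟩).le
  rw [Real.cos_two_mul'] at h2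
  rw [(hd φ).deriv]
  have := integral_laplaceDefect_rotScale_nonneg (n := n) (r := r) k hε hs hsk hsin (by linarith)
  have : 0 ≤ Real.cos φ * Real.sin φ * (4 * s * (k + 2)) := by positivity
  nlinarith [mul_nonneg this ‹0 ≤ ∫ x, laplaceDefect k s ε _ ∂_›]

end Monotonicity

/-! ### From traces of powers to moments of the norm. -/

section NormBounds

variable {m n : Type*} [Fintype m] [Fintype n] [DecidableEq n]

theorem norm_sq_pow_le_gramTrace (A : Matrix m n ℂ) {q : ℕ} (hq : q ≠ 0) :
    (‖A‖ ^ 2) ^ q ≤ gramTrace q A := by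
  obtain ⟨y, hy, h, hn⟩ := exists_gramTrace_eq_sum_pow A
  rw [h, hn]
  have h0 : 0 ≤ ∑ k, y k ^ q := Finset.sum_nonneg fun k _ => pow_nonneg (hy k) q
  have hroot := Real.rpow_nonneg h0 (q : ℝ)⁻¹
  calc ‖y‖ ^ q ≤ ((∑ k, y k ^ q) ^ (q : ℝ)⁻¹) ^ q := by
        gcongr
        refine (pi_norm_le_iff_of_nonneg hroot).2 fun k => ?_
        rw [Real.norm_of_nonneg (hy k)]
        calc y k = (y k ^ q) ^ (q : ℝ)⁻¹ := (Real.pow_rpow_inv_natCast (hy k) hq).symm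
          _ ≤ _ := Real.rpow_le_rpow (pow_nonneg (hy k) q)
            (Finset.single_le_sum (f := fun k => y k ^ q) (fun k _ => pow_nonneg (hy k) q)
              (Finset.mem_univ k)) (by positivity)
    _ = _ := Real.rpow_inv_natCast_pow h0 hq

theorem gramTrace_le_card_mul (A : Matrix m n ℂ) (q : ℕ) :
    gramTrace q A ≤ Fintype.card n * (‖A‖ ^ 2) ^ q := by
  obtain ⟨y, hy, h, hn⟩ := exists_gramTrace_eq_sum_pow A
  rw [h, hn]
  calc ∑ k, y k ^ q ≤ ∑ _k : n, ‖y‖ ^ q := by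
        gcongr with k
        · exact hy k
        · exact (le_abs_self _).trans (norm_le_pi_norm y k)
    _ = _ := by simp

end NormBounds

section Moments

theorem exists_norm_complexMatrix_le (m n : Type*) [Fintype m] [Fintype n] [DecidableEq n] :
    ∃ K : ℝ, 0 ≤ K ∧ ∀ x : m × n ⊕ m × n → ℝ, ‖complexMatrix x‖ ≤ K * ∑ i, |x i| := by
  let L : (m × n ⊕ m × n → ℝ) →ₗ[ℝ] Matrix m n ℂ :=
    { toFun := complexMatrix
      map_add' := complexMatrix_add
      map_smul' := fun c x => by rw [complexMatrix_smul]; rfl }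
  classical
  set e : m × n ⊕ m × n → m × n ⊕ m × n → ℝ := fun i j => if i = j then 1 else 0
  have h0 : 0 ≤ ∑ c, ‖complexMatrix (e c)‖ := Finset.sum_nonneg fun _ _ => norm_nonneg _
  refine ⟨∑ c, ‖complexMatrix (e c)‖, h0, fun x => ?_⟩
  have hx : complexMatrix x = ∑ c, (x c : ℂ) • complexMatrix (e c) := L.pi_apply_eq_sum_univ x
  rw [hx, Finset.mul_sum]
  refine (norm_sum_le _ _).trans (Finset.sum_le_sum fun c _ => ?_)
  rw [norm_smul, Complex.norm_real, Real.norm_eq_abs, mul_comm]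
  gcongr
  exact Finset.single_le_sum (f := fun c => ‖complexMatrix (e c)‖) (fun _ _ => norm_nonneg _)
    (Finset.mem_univ c)

theorem sum_abs_rotScale_mul_le {κ : Type*} [Fintype κ] (θ : ℝ) (x : κ ⊕ κ → ℝ) :
    ∑ i, |(rotScale κ θ * x) i| ≤ ∑ i, |x i| := by
  refine Finset.sum_le_sum fun i _ => ?_
  rw [Pi.mul_apply, abs_mul]
  refine mul_le_of_le_one_left (abs_nonneg _) ?_
  rcases i with c | c
  · exact Real.abs_cos_le_one θ
  · exact Real.abs_sin_le_one θ

theorem continuous_complexMatrix_rotScale {m n : Type*} [Fintype m] [Fintype n] [DecidableEq n]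
    (θ : ℝ) : Continuous fun x => complexMatrix (rotScale (m × n) θ * x) :=
  continuous_complexMatrix.comp (continuous_const.mul continuous_id)

theorem ExpGrowth.exp_norm_rotScale {m n : Type*} [Fintype m] [Fintype n] [DecidableEq n]
    (θ l : ℝ) : ExpGrowth fun x => Real.exp (l * ‖_root_.complexMatrix (rotScale (m × n) θ * x)‖) := by
  obtain ⟨K, hK0, hK⟩ := exists_norm_complexMatrix_le m n
  refine ExpGrowth.of_le_add_exp 1 (|l| * K) 0 zero_le_one fun x => ?_
  rw [Real.norm_of_nonneg (Real.exp_pos _).le, one_mul, add_zero]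
  refine Real.exp_le_exp.2 ?_
  calc l * ‖_root_.complexMatrix (rotScale (m × n) θ * x)‖ ≤ |l| * (K * ∑ i, |x i|) := by
        gcongr
        · exact le_abs_self l
        · exact (hK _).trans (mul_le_mul_of_nonneg_left (sum_abs_rotScale_mul_le θ x) hK0)
    _ = _ := by ring

theorem integrable_exp_norm_rotScale {m n : Type*} [Fintype m] [Fintype n] [DecidableEq n]
    (θ l : ℝ) : Integrable (fun x => Real.exp (l * ‖complexMatrix (rotScale (m × n) θ * x)‖))
      (gaussPi (m × n ⊕ m × n)) :=
  (ExpGrowth.exp_norm_rotScale θ l).integrable_of_continuous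
    (Real.continuous_exp.comp (continuous_const.mul (continuous_complexMatrix_rotScale θ).norm))

theorem integrable_cosh_norm_rotScale {m n : Type*} [Fintype m] [Fintype n] [DecidableEq n]
    (θ l : ℝ) : Integrable (fun x => Real.cosh (l * ‖complexMatrix (rotScale (m × n) θ * x)‖))
      (gaussPi (m × n ⊕ m × n)) := by
  simp only [Real.cosh_eq, ← neg_mul]
  exact ((integrable_exp_norm_rotScale θ l).add (integrable_exp_norm_rotScale θ (-l))).div_const 2

theorem pow_two_mul_le_cosh (z : ℝ) (p : ℕ) :
    z ^ (2 * p) / (2 * p).factorial ≤ Real.cosh z :=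
  le_hasSum (Real.hasSum_cosh z) p fun i _ => by
    rw [pow_mul]; positivity

theorem integrable_norm_pow_rotScale {m n : Type*} [Fintype m] [Fintype n] [DecidableEq n]
    (θ : ℝ) (p : ℕ) : Integrable (fun x => ‖complexMatrix (rotScale (m × n) θ * x)‖ ^ (2 * p))
      (gaussPi (m × n ⊕ m × n)) := by
  refine ((integrable_cosh_norm_rotScale (m := m) (n := n) θ 1).const_mul
    ((2 * p).factorial : ℝ)).mono'
    ((continuous_complexMatrix_rotScale θ).norm.pow _).stronglyMeasurable.aestronglyMeasurable
    (Filter.Eventually.of_forall fun x => ?_)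
  have h := pow_two_mul_le_cosh ‖complexMatrix (rotScale (m × n) θ * x)‖ p
  rw [div_le_iff₀ (by positivity)] at h
  rw [Real.norm_of_nonneg (by positivity), one_mul]
  linarith

theorem pow_rpow_div {z : ℝ} (hz : 0 ≤ z) (p : ℕ) {K : ℝ} {k : ℕ} (hk : k ≠ 0) (hK : K = k) :
    (z ^ k) ^ ((p : ℝ) / K) = z ^ p := by
  subst hK
  rw [← Real.rpow_natCast z k, ← Real.rpow_mul hz, mul_div_cancel₀, Real.rpow_natCast]
  exact_mod_cast hk

variable {n r : Type*} [Fintype n] [Fintype r] [DecidableEq n] [DecidableEq r]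

/-- With `s = p / (k + 2)` the power `(tr (AᴴA)^(k+2))^s` lies between `‖A‖^(2p)` and that times a
power of the dimension, so monotonicity of the smooth potential transfers to the norm up to this
factor. The condition `p ≠ 0` gives `1 ≤ s (k + 2)`, and `p ≤ k + 2` gives `s ≤ 1`. The `+ 1` keeps
the base positive when `n` is empty. -/
theorem integral_norm_pow_rotScale_le_add {p : ℕ} (hp : p ≠ 0) {k : ℕ} (hk : p ≤ k + 2) {δ : ℝ}
    (hδ : 0 < δ) {θ : ℝ} (hθ : θ ∈ Set.Icc 0 (Real.pi / 4)) :
    ∫ x, ‖complexMatrix (rotScale ((n ⊕ r) × n) θ * x)‖ ^ (2 * p)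
        ∂gaussPi ((n ⊕ r) × n ⊕ (n ⊕ r) × n) ≤
      ((Fintype.card n : ℝ) + 1) ^ ((p : ℝ) / (k + 2)) *
        ∫ x, ‖complexMatrix (rotScale ((n ⊕ r) × n) 0 * x)‖ ^ (2 * p)
          ∂gaussPi ((n ⊕ r) × n ⊕ (n ⊕ r) × n) + δ := by
  set s : ℝ := (p : ℝ) / (k + 2) with hs
  have hp' : (1 : ℝ) ≤ p := by exact_mod_cast Nat.one_le_iff_ne_zero.2 hp
  have hk2 : (0 : ℝ) < k + 2 := by positivity
  have hs0 : 0 < s := by positivity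
  have hs1 : s ≤ 1 := (div_le_one hk2).2 (by exact_mod_cast hk)
  have hsk : 1 ≤ s * (k + 2) := by rw [hs, div_mul_cancel₀ _ hk2.ne']; exact hp'
  -- Chosen so that `ε ^ s = δ`: by subadditivity of `z ↦ z ^ s` the smoothing then costs at most
  -- `δ`.
  set ε : ℝ := δ ^ s⁻¹ with hε
  have hε0 : 0 < ε := Real.rpow_pos_of_pos hδ _
  have hεs : ε ^ s = δ := Real.rpow_inv_rpow hδ.le hs0.ne'
  have hcast : ((k : ℝ) + 2) = ((k + 2 : ℕ) : ℝ) := by push_cast; ring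
  have hpow : ∀ A : Matrix (n ⊕ r) n ℂ, ((‖A‖ ^ 2) ^ (k + 2)) ^ s = ‖A‖ ^ (2 * p) := fun A => by
    rw [hs, pow_rpow_div (by positivity) p (Nat.succ_ne_zero _) hcast, ← pow_mul]
  have hlow : ∀ A : Matrix (n ⊕ r) n ℂ, ‖A‖ ^ (2 * p) ≤ gramPotential k s ε A := fun A => by
    rw [← hpow, gramPotential]
    exact Real.rpow_le_rpow (by positivity)
      ((norm_sq_pow_le_gramTrace A (Nat.succ_ne_zero _)).trans (by linarith)) hs0.le
  have hup : ∀ A : Matrix (n ⊕ r) n ℂ, gramPotential k s ε A ≤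
      ((Fintype.card n : ℝ) + 1) ^ s * ‖A‖ ^ (2 * p) + δ := fun A => by
    rw [← hpow, gramPotential, ← Real.mul_rpow (by positivity) (by positivity), ← hεs]
    refine (Real.rpow_add_le_add_rpow (gramTrace_nonneg _ A) hε0.le hs0.le hs1).trans ?_
    gcongr
    · exact gramTrace_nonneg _ A
    · refine (gramTrace_le_card_mul A _).trans ?_
      gcongr
      linarith
  have hgi : ∀ θ, Integrable (fun x => gramPotential k s ε
      (complexMatrix (rotScale ((n ⊕ r) × n) θ * x))) (gaussPi ((n ⊕ r) × n ⊕ (n ⊕ r) × n)) :=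
    fun θ => (((integrable_norm_pow_rotScale θ p).const_mul
      (((Fintype.card n : ℝ) + 1) ^ s)).add (integrable_const δ)).mono'
      ((continuous_gramTrace_rpow (k + 2) s hε0).comp
        (continuous_complexMatrix_rotScale θ)).stronglyMeasurable.aestronglyMeasurable
      (Filter.Eventually.of_forall fun x => by
        rw [Real.norm_of_nonneg ((by positivity : (0 : ℝ) ≤ _ ^ (2 * p)).trans (hlow _))]
        exact hup _)
  calc _ ≤ ∫ x, gramPotential k s ε (complexMatrix (rotScale ((n ⊕ r) × n) θ * x))
        ∂gaussPi ((n ⊕ r) × n ⊕ (n ⊕ r) × n) :=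
        integral_mono (integrable_norm_pow_rotScale θ p) (hgi θ) fun x => hlow _
    _ ≤ ∫ x, gramPotential k s ε (complexMatrix (rotScale ((n ⊕ r) × n) 0 * x))
        ∂gaussPi ((n ⊕ r) × n ⊕ (n ⊕ r) × n) :=
        integral_gramPotential_le_of_mem_Icc k hε0 hs1 hsk hθ
    _ ≤ ∫ x, (((Fintype.card n : ℝ) + 1) ^ s *
          ‖complexMatrix (rotScale ((n ⊕ r) × n) 0 * x)‖ ^ (2 * p) + δ)
        ∂gaussPi ((n ⊕ r) × n ⊕ (n ⊕ r) × n) :=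
        integral_mono (hgi 0) (((integrable_norm_pow_rotScale 0 p).const_mul _).add
          (integrable_const δ)) fun x => hup _
    _ = _ := by
        rw [integral_add ((integrable_norm_pow_rotScale 0 p).const_mul _) (integrable_const δ),
          integral_const_mul]
        simp

/-- As `k → ∞` the exponent `p / (k + 2)` tends to `0` and the dimensional factor to `1`; then `δ`
is arbitrary. -/
theorem integral_norm_pow_rotScale_le (p : ℕ) {θ : ℝ} (hθ : θ ∈ Set.Icc 0 (Real.pi / 4)) :
    ∫ x, ‖complexMatrix (rotScale ((n ⊕ r) × n) θ * x)‖ ^ (2 * p)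
        ∂gaussPi ((n ⊕ r) × n ⊕ (n ⊕ r) × n) ≤
      ∫ x, ‖complexMatrix (rotScale ((n ⊕ r) × n) 0 * x)‖ ^ (2 * p)
        ∂gaussPi ((n ⊕ r) × n ⊕ (n ⊕ r) × n) := by
  rcases eq_or_ne p 0 with rfl | hp
  · simp
  refine le_of_forall_pos_le_add fun δ hδ => ?_
  have hlim : Filter.Tendsto (fun k : ℕ => ((Fintype.card n : ℝ) + 1) ^ ((p : ℝ) / (k + 2)) *
        ∫ x, ‖complexMatrix (rotScale ((n ⊕ r) × n) 0 * x)‖ ^ (2 * p)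
          ∂gaussPi ((n ⊕ r) × n ⊕ (n ⊕ r) × n) + δ) Filter.atTop
      (nhds (((Fintype.card n : ℝ) + 1) ^ (0 : ℝ) *
        ∫ x, ‖complexMatrix (rotScale ((n ⊕ r) × n) 0 * x)‖ ^ (2 * p)
          ∂gaussPi ((n ⊕ r) × n ⊕ (n ⊕ r) × n) + δ)) := by
    refine Filter.Tendsto.add_const _ (Filter.Tendsto.mul_const _
      (((Real.continuousAt_const_rpow (by positivity)).tendsto).comp ?_))
    exact tendsto_const_nhds.div_atTop
      (Filter.tendsto_atTop_add_const_right _ _ tendsto_natCast_atTop_atTop)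
  rw [Real.rpow_zero, one_mul] at hlim
  refine ge_of_tendsto hlim (Filter.eventually_atTop.2 ⟨p, fun k hk => ?_⟩)
  exact integral_norm_pow_rotScale_le_add hp (by omega) hδ hθ

end Moments

theorem integrable_mul_pow_div_factorial {Ω : Type*} [MeasurableSpace Ω] {μ : Measure Ω}
    {f : Ω → ℝ} (l : ℝ) {p : ℕ} (hf : Integrable (fun x => f x ^ p) μ) :
    Integrable (fun x => (l * f x) ^ p / p.factorial) μ := by
  simp only [mul_pow]
  exact (hf.const_mul _).div_const _

/-- `cosh` rather than `exp` is used because its series has only even powers, with nonnegative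
coefficients, and even moments are what is known. -/
theorem integral_cosh_le_of_integral_pow_le {Ω Ω' : Type*} [MeasurableSpace Ω]
    [MeasurableSpace Ω'] {μ : Measure Ω} {ν : Measure Ω'} {f : Ω → ℝ} {g : Ω' → ℝ} (l : ℝ)
    (hfi : Integrable (fun x => Real.cosh (l * f x)) μ)
    (hgi : Integrable (fun x => Real.cosh (l * g x)) ν)
    (hfp : ∀ p : ℕ, Integrable (fun x => f x ^ (2 * p)) μ)
    (hgp : ∀ p : ℕ, Integrable (fun x => g x ^ (2 * p)) ν)
    (h : ∀ p : ℕ, ∫ x, f x ^ (2 * p) ∂μ ≤ ∫ x, g x ^ (2 * p) ∂ν) :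
    ∫ x, Real.cosh (l * f x) ∂μ ≤ ∫ x, Real.cosh (l * g x) ∂ν := by
  have hpos : ∀ (z : ℝ) (p : ℕ), 0 ≤ z ^ (2 * p) / (2 * p).factorial := fun z p => by
    rw [pow_mul]; positivity
  have hpart : ∀ (z : ℝ) (K : ℕ),
      ∑ p ∈ Finset.range K, z ^ (2 * p) / (2 * p).factorial ≤ Real.cosh z := fun z K =>
    sum_le_hasSum _ (fun p _ => hpos z p) (Real.hasSum_cosh z)
  refine le_of_tendsto' (tendsto_integral_of_dominated_convergence
    (F := fun (K : ℕ) x => ∑ p ∈ Finset.range K, (l * f x) ^ (2 * p) / (2 * p).factorial)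
    (fun x => Real.cosh (l * f x)) (fun K => ?_) hfi (fun K => ?_) ?_) fun K => ?_
  · exact (integrable_finsetSum _ fun p _ => integrable_mul_pow_div_factorial l (hfp p)).aestronglyMeasurable
  · refine Filter.Eventually.of_forall fun x => ?_
    rw [Real.norm_of_nonneg (Finset.sum_nonneg fun p _ => hpos _ p)]
    exact hpart _ K
  · exact Filter.Eventually.of_forall fun x => (Real.hasSum_cosh _).tendsto_sum_nat
  · calc ∫ x, ∑ p ∈ Finset.range K, (l * f x) ^ (2 * p) / (2 * p).factorial ∂μ
        ≤ ∫ x, ∑ p ∈ Finset.range K, (l * g x) ^ (2 * p) / (2 * p).factorial ∂ν := by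
          rw [integral_finsetSum _ fun p _ => integrable_mul_pow_div_factorial l (hfp p),
            integral_finsetSum _ fun p _ => integrable_mul_pow_div_factorial l (hgp p)]
          refine Finset.sum_le_sum fun p _ => ?_
          simp only [mul_pow]
          rw [integral_div, integral_div, integral_const_mul, integral_const_mul]
          gcongr
          · rw [pow_mul]; positivity
          · exact h p
      _ ≤ _ := integral_mono (integrable_finsetSum _ fun p _ => integrable_mul_pow_div_factorial l (hgp p)) hgi
          fun x => hpart _ K

theorem integral_cosh_norm_rotScale_le {n r : Type*} [Fintype n] [Fintype r] [DecidableEq n]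
    [DecidableEq r] (l : ℝ) {θ : ℝ} (hθ : θ ∈ Set.Icc 0 (Real.pi / 4)) :
    ∫ x, Real.cosh (l * ‖complexMatrix (rotScale ((n ⊕ r) × n) θ * x)‖)
        ∂gaussPi ((n ⊕ r) × n ⊕ (n ⊕ r) × n) ≤
      ∫ x, Real.cosh (l * ‖complexMatrix (rotScale ((n ⊕ r) × n) 0 * x)‖)
        ∂gaussPi ((n ⊕ r) × n ⊕ (n ⊕ r) × n) :=
  integral_cosh_le_of_integral_pow_le l
    (integrable_cosh_norm_rotScale θ l) (integrable_cosh_norm_rotScale 0 l)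
    (integrable_norm_pow_rotScale θ) (integrable_norm_pow_rotScale 0)
    fun p => integral_norm_pow_rotScale_le p hθ

/-! ### Powers of sums of exponentials. -/

section ExpSum

variable {ι K : Type*} [Fintype ι] [Fintype K] {U : K → ι → ℝ}

/-- `∑ₖ exp ⟨Uₖ, z⟩`. -/
noncomputable def expSum (U : K → ι → ℝ) (z : ι → ℝ) : ℝ :=
  ∑ k, Real.exp (∑ i, U k i * z i)

/-- The derivative of `(expSum U) ^ s` along the coordinate `c`. -/
noncomputable def expSumDeriv (U : K → ι → ℝ) (s : ℝ) (c : ι) (z : ι → ℝ) : ℝ :=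
  s * (expSum U z ^ (s - 1) * ∑ k, U k c * Real.exp (∑ i, U k i * z i))

/-- The second derivative of `(expSum U) ^ s` along the coordinate `c`. -/
noncomputable def expSumDeriv2 (U : K → ι → ℝ) (s : ℝ) (c : ι) (z : ι → ℝ) : ℝ :=
  s * ((s - 1) * expSum U z ^ (s - 2) *
      ((∑ k, U k c * Real.exp (∑ i, U k i * z i)) * ∑ k, U k c * Real.exp (∑ i, U k i * z i)) +
    expSum U z ^ (s - 1) * ∑ k, U k c * U k c * Real.exp (∑ i, U k i * z i))

theorem expSum_pos [Nonempty K] (z : ι → ℝ) : 0 < expSum U z :=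
  Finset.sum_pos (fun _ _ => Real.exp_pos _) Finset.univ_nonempty

theorem continuous_expSum : Continuous (expSum U) := by unfold expSum; fun_prop

theorem differentiable_expSum : Differentiable ℝ (expSum U) := by unfold expSum; fun_prop

theorem continuous_expSum_rpow [Nonempty K] (s : ℝ) : Continuous fun z => expSum U z ^ s :=
  continuous_expSum.rpow_const fun z => Or.inl (expSum_pos z).ne'

theorem ExpGrowth.expSum : ExpGrowth (expSum U) := by
  unfold _root_.expSum
  exact ExpGrowth.sum _ fun k _ => ExpGrowth.exp_sum (U k)

theorem ExpGrowth.expSum_rpow [Nonempty K] {s : ℝ} (hs : s ≤ 1) :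
    ExpGrowth fun z => _root_.expSum U z ^ s := by
  rcases le_total 0 s with h0 | h0
  · refine (ExpGrowth.expSum.add (ExpGrowth.const (1 : ℝ))).of_norm_le (g := fun z =>
      _root_.expSum U z + 1) fun z => ?_
    have h := expSum_pos (U := U) z
    rw [Real.norm_of_nonneg (by positivity), Real.norm_of_nonneg (by positivity)]
    rcases le_total 1 (_root_.expSum U z) with h1 | h1
    · refine (Real.rpow_le_rpow_of_exponent_le h1 hs).trans ?_
      rw [Real.rpow_one]; linarith
    · exact (Real.rpow_le_one h.le h1 h0).trans (by linarith)
  · obtain ⟨k⟩ := ‹Nonempty K›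
    refine (ExpGrowth.exp_sum fun i => s * U k i).of_norm_le fun z => ?_
    have h : Real.exp (∑ i, U k i * z i) ≤ _root_.expSum U z :=
      Finset.single_le_sum (f := fun k => Real.exp (∑ i, U k i * z i))
        (fun _ _ => (Real.exp_pos _).le) (Finset.mem_univ k)
    have hp : 0 < _root_.expSum U z := (Real.exp_pos _).trans_le h
    rw [Real.norm_of_nonneg (by positivity), Real.norm_of_nonneg (by positivity)]
    refine (Real.rpow_le_rpow_of_nonpos (Real.exp_pos _) h h0).trans_eq ?_
    rw [← Real.exp_mul, mul_comm, Finset.mul_sum]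
    simp only [mul_assoc]

theorem ExpGrowth.sum_mul_exp (a : K → ℝ) :
    ExpGrowth fun z : ι → ℝ => ∑ k, a k * Real.exp (∑ i, U k i * z i) :=
  ExpGrowth.sum _ fun k _ => (ExpGrowth.const (a k)).mul (ExpGrowth.exp_sum (U k))

theorem ExpGrowth.expSumDeriv [Nonempty K] {s : ℝ} (hs : s ≤ 1) (c : ι) :
    ExpGrowth (expSumDeriv U s c) := by
  unfold _root_.expSumDeriv
  exact (ExpGrowth.const s).mul ((ExpGrowth.expSum_rpow (by linarith)).mul
    (ExpGrowth.sum_mul_exp _))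

theorem ExpGrowth.expSumDeriv2 [Nonempty K] {s : ℝ} (hs : s ≤ 1) (c : ι) :
    ExpGrowth (expSumDeriv2 U s c) := by
  unfold _root_.expSumDeriv2
  exact (ExpGrowth.const s).mul ((((ExpGrowth.const (s - 1)).mul
    (ExpGrowth.expSum_rpow (by linarith))).mul ((ExpGrowth.sum_mul_exp _).mul
    (ExpGrowth.sum_mul_exp _))).add
    ((ExpGrowth.expSum_rpow (by linarith)).mul (ExpGrowth.sum_mul_exp _)))

theorem continuous_expSumDeriv [Nonempty K] (s : ℝ) (c : ι) : Continuous (expSumDeriv U s c) := by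
  unfold expSumDeriv
  exact continuous_const.mul ((continuous_expSum_rpow _).mul (by fun_prop))

theorem continuous_expSumDeriv2 [Nonempty K] (s : ℝ) (c : ι) :
    Continuous (expSumDeriv2 U s c) := by
  unfold expSumDeriv2
  exact continuous_const.mul (((continuous_const.mul (continuous_expSum_rpow _)).mul
    (by fun_prop)).add ((continuous_expSum_rpow _).mul (by fun_prop)))

theorem sum_mul_add_single [DecidableEq ι] (v z : ι → ℝ) (c : ι) (t : ℝ) :
    ∑ i, v i * (z + Pi.single c t : ι → ℝ) i = ∑ i, v i * z i + v c * t := by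
  simp only [Pi.add_apply, mul_add, Finset.sum_add_distrib]
  simp [Pi.single_apply]

theorem hasDerivAt_sum_mul_exp [DecidableEq ι] (a : K → ℝ) (c : ι) (z : ι → ℝ) :
    HasDerivAt (fun t => ∑ k, a k * Real.exp (∑ i, U k i * (z + Pi.single c t : ι → ℝ) i))
      (∑ k, a k * U k c * Real.exp (∑ i, U k i * z i)) 0 := by
  simp only [sum_mul_add_single]
  refine HasDerivAt.fun_sum fun k _ => ?_
  have h : HasDerivAt (fun t : ℝ => ∑ i, U k i * z i + U k c * t) (U k c) 0 := by
    simpa using ((hasDerivAt_id (0 : ℝ)).const_mul (U k c)).const_add (∑ i, U k i * z i)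
  refine (h.exp.const_mul (a k)).congr_deriv ?_
  rw [mul_zero, add_zero]
  ring

theorem hasDerivAt_expSum_rpow [Nonempty K] [DecidableEq ι] (s : ℝ) (c : ι) (z : ι → ℝ) :
    HasDerivAt (fun t => expSum U (z + Pi.single c t : ι → ℝ) ^ s)
      (s * (expSum U z ^ (s - 1) * ∑ k, U k c * Real.exp (∑ i, U k i * z i))) 0 := by
  have h := hasDerivAt_sum_mul_exp (U := U) (fun _ => 1) c z
  simp only [one_mul] at h
  have h0 : expSum U (z + Pi.single c 0 : ι → ℝ) = expSum U z := by simp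
  refine (HasDerivAt.rpow_const (p := s) h (Or.inl ?_)).congr_deriv ?_
  · exact (expSum_pos (U := U) (z + Pi.single c 0)).ne'
  · change _ * s * expSum U (z + Pi.single c 0 : ι → ℝ) ^ (s - 1) = _
    rw [h0]; ring

theorem hasDerivAt_expSumDeriv [Nonempty K] [DecidableEq ι] (s : ℝ) (c : ι) (z : ι → ℝ) :
    HasDerivAt (fun t => expSumDeriv U s c (z + Pi.single c t : ι → ℝ))
      (expSumDeriv2 U s c z) 0 := by
  have h1 := hasDerivAt_expSum_rpow (U := U) (s - 1) c z
  have h2 := hasDerivAt_sum_mul_exp (U := U) (fun k => U k c) c z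
  refine ((h1.mul h2).const_mul s).congr_deriv ?_
  simp only [Pi.single_zero, add_zero]
  rw [expSumDeriv2, show s - 1 - 1 = s - 2 by ring]
  ring

end ExpSum

/-! ### Gaussian comparison between two families of linear forms. -/

section Comparison

theorem sum_sum_mul_sq {γ K : Type*} [Fintype γ] [Fintype K] (V : K → γ → ℝ) (E : K → ℝ) :
    ∑ i, (∑ k, V k i * E k) * ∑ k, V k i * E k =
      ∑ k, ∑ l, (∑ i, V k i * V l i) * (E k * E l) := by
  have h : ∀ i, (∑ k, V k i * E k) * ∑ k, V k i * E k =
      ∑ k, ∑ l, V k i * V l i * (E k * E l) := fun i => by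
    rw [Finset.sum_mul_sum]
    exact Finset.sum_congr rfl fun k _ => Finset.sum_congr rfl fun l _ => by ring
  simp only [h, Finset.sum_mul]
  rw [Finset.sum_comm]
  exact Finset.sum_congr rfl fun k _ => Finset.sum_comm

variable {α β K : Type*} [Fintype α] [Fintype β] [Fintype K] [Nonempty K]
  {U : K → α ⊕ β → ℝ}

/-- Let `Q k l` be the difference of covariances, `E k` the exponentials and `S` their sum. The left
side is `s` times `-(1 - s) S^(s-2) ∑ Q k l E k E l + S^(s-1) ∑ Q k k E k`. With `Q k l ≥ -B²` and
`Q k k = -B²` the bracket is at most `(1 - s) B² S^s - B² S^s = -s B² S^s`. -/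
theorem sum_expSumDeriv2_sub_le {B s : ℝ} (hs0 : 0 ≤ s) (hs : s ≤ 1)
    (hQ : ∀ k l, -B ^ 2 ≤ ∑ i, U k (Sum.inl i) * U l (Sum.inl i) -
      ∑ j, U k (Sum.inr j) * U l (Sum.inr j))
    (hQ' : ∀ k, ∑ i, U k (Sum.inl i) * U k (Sum.inl i) -
      ∑ j, U k (Sum.inr j) * U k (Sum.inr j) = -B ^ 2) (z : α ⊕ β → ℝ) :
    ∑ i, expSumDeriv2 U s (Sum.inl i) z - ∑ j, expSumDeriv2 U s (Sum.inr j) z ≤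
      -(s * B) ^ 2 * expSum U z ^ s := by
  set E : K → ℝ := fun k => Real.exp (∑ i, U k i * z i) with hE
  have hE0 : ∀ k, 0 < E k := fun k => Real.exp_pos _
  set S := expSum U z with hS
  have hSE : S = ∑ k, E k := rfl
  have hSp : 0 < S := expSum_pos z
  have h1 : (∑ i, (∑ k, U k (Sum.inl i) * E k) * ∑ k, U k (Sum.inl i) * E k) -
      (∑ j, (∑ k, U k (Sum.inr j) * E k) * ∑ k, U k (Sum.inr j) * E k) =
      ∑ k, ∑ l, (∑ i, U k (Sum.inl i) * U l (Sum.inl i) -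
        ∑ j, U k (Sum.inr j) * U l (Sum.inr j)) * (E k * E l) := by
    rw [sum_sum_mul_sq (fun k i => U k (Sum.inl i)), sum_sum_mul_sq (fun k i => U k (Sum.inr i)), ← Finset.sum_sub_distrib]
    refine Finset.sum_congr rfl fun k _ => ?_
    rw [← Finset.sum_sub_distrib]
    exact Finset.sum_congr rfl fun l _ => by rw [sub_mul]
  have h2 : (∑ i, ∑ k, U k (Sum.inl i) * U k (Sum.inl i) * E k) -
      (∑ j, ∑ k, U k (Sum.inr j) * U k (Sum.inr j) * E k) = -B ^ 2 * S := by
    rw [Finset.sum_comm, Finset.sum_comm (s := (Finset.univ : Finset β)), hSE, Finset.mul_sum,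
      ← Finset.sum_sub_distrib]
    refine Finset.sum_congr rfl fun k _ => ?_
    rw [← Finset.sum_mul, ← Finset.sum_mul, ← sub_mul, hQ']
  have h3 : -B ^ 2 * (S * S) ≤ ∑ k, ∑ l, (∑ i, U k (Sum.inl i) * U l (Sum.inl i) -
        ∑ j, U k (Sum.inr j) * U l (Sum.inr j)) * (E k * E l) := by
    rw [hSE, Finset.sum_mul_sum, Finset.mul_sum]
    refine Finset.sum_le_sum fun k _ => ?_
    rw [Finset.mul_sum]
    exact Finset.sum_le_sum fun l _ =>
      mul_le_mul_of_nonneg_right (hQ k l) (mul_pos (hE0 k) (hE0 l)).le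
  have h4 : ∑ i, expSumDeriv2 U s (Sum.inl i) z - ∑ j, expSumDeriv2 U s (Sum.inr j) z =
      s * ((s - 1) * S ^ (s - 2) * ((∑ i, (∑ k, U k (Sum.inl i) * E k) *
          ∑ k, U k (Sum.inl i) * E k) -
        (∑ j, (∑ k, U k (Sum.inr j) * E k) * ∑ k, U k (Sum.inr j) * E k)) +
      S ^ (s - 1) * ((∑ i, ∑ k, U k (Sum.inl i) * U k (Sum.inl i) * E k) -
        (∑ j, ∑ k, U k (Sum.inr j) * U k (Sum.inr j) * E k))) := by
    simp only [expSumDeriv2, ← Finset.mul_sum, Finset.sum_add_distrib]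
    ring
  have h5 : S ^ (s - 2) * (S * S) = S ^ s := by
    rw [← sq, ← Real.rpow_natCast S 2, ← Real.rpow_add hSp]; norm_num
  have h6 : S ^ (s - 1) * S = S ^ s := by
    rw [Real.rpow_sub_one hSp.ne', div_mul_cancel₀ _ hSp.ne']
  rw [h4, h1, h2]
  set T := ∑ k, ∑ l, (∑ i, U k (Sum.inl i) * U l (Sum.inl i) -
        ∑ j, U k (Sum.inr j) * U l (Sum.inr j)) * (E k * E l)
  have h7 : 0 ≤ s * (1 - s) * S ^ (s - 2) * (T + B ^ 2 * (S * S)) := by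
    have : 0 ≤ 1 - s := by linarith
    have : 0 ≤ T + B ^ 2 * (S * S) := by linarith
    positivity
  have h8 : -(s * B) ^ 2 * S ^ s - s * ((s - 1) * S ^ (s - 2) * T + S ^ (s - 1) * (-B ^ 2 * S)) =
      s * (1 - s) * S ^ (s - 2) * (T + B ^ 2 * (S * S)) +
        s * B ^ 2 * (S ^ (s - 1) * S - S ^ s) +
        s * (1 - s) * B ^ 2 * (S ^ s - S ^ (s - 2) * (S * S)) := by ring
  rw [h5, h6] at h8
  linarith

/-- The scaling of the left coordinates by `sin θ` and of the right ones by `cos θ`. -/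
noncomputable def sinCosScale (α β : Type*) (θ : ℝ) : α ⊕ β → ℝ :=
  Sum.elim (fun _ => Real.sin θ) fun _ => Real.cos θ

/-- Rotating from the right coordinates (`θ = 0`) to the left ones (`θ = π/2`), the average `φ`
satisfies `φ' ≤ -(s B)² sin θ cos θ φ`. Multiplied by the integrating factor `exp ((s B)² sin² θ /
2)` it is therefore nonincreasing. -/
theorem exp_mul_integral_expSum_rpow_le {B s : ℝ} (hs0 : 0 ≤ s) (hs : s ≤ 1)
    (hQ : ∀ k l, -B ^ 2 ≤ ∑ i, U k (Sum.inl i) * U l (Sum.inl i) -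
      ∑ j, U k (Sum.inr j) * U l (Sum.inr j))
    (hQ' : ∀ k, ∑ i, U k (Sum.inl i) * U k (Sum.inl i) -
      ∑ j, U k (Sum.inr j) * U k (Sum.inr j) = -B ^ 2) :
    Real.exp ((s * B) ^ 2 / 2) *
        ∫ x, expSum U (sinCosScale α β (Real.pi / 2) * x) ^ s ∂gaussPi (α ⊕ β) ≤
      ∫ x, expSum U (sinCosScale α β 0 * x) ^ s ∂gaussPi (α ⊕ β) := by
  classical
  set w' : ℝ → α ⊕ β → ℝ := fun θ => Sum.elim (fun _ => Real.cos θ) fun _ => -Real.sin θ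
  have hw1 : ∀ θ c, |sinCosScale α β θ c| ≤ 1 := by
    rintro θ (c | c)
    · exact Real.abs_sin_le_one θ
    · exact Real.abs_cos_le_one θ
  have hd : ∀ θ, HasDerivAt (fun θ => ∫ x, expSum U (sinCosScale α β θ * x) ^ s ∂gaussPi (α ⊕ β))
      (∑ c, sinCosScale α β θ c * w' θ c * ∫ x, expSumDeriv2 U s c (sinCosScale α β θ * x)
        ∂gaussPi (α ⊕ β)) θ := fun θ =>
    hasDerivAt_integral_gaussPi_scale (f := fun z => expSum U z ^ s) (f1 := expSumDeriv U s)
      (f2 := expSumDeriv2 U s) (w := sinCosScale α β) (w' := w')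
      (differentiable_expSum.rpow_const fun z => Or.inl (expSum_pos z).ne')
      (ExpGrowth.expSum_rpow hs) (continuous_expSumDeriv s) (continuous_expSumDeriv2 s)
      (ExpGrowth.expSumDeriv hs) (ExpGrowth.expSumDeriv2 hs) (hasDerivAt_expSum_rpow s)
      (hasDerivAt_expSumDeriv s)
      (fun θ c => by
        rcases c with c | c
        · exact Real.hasDerivAt_sin θ
        · exact Real.hasDerivAt_cos θ) hw1
      (fun θ c => by
        rcases c with c | c
        · exact Real.abs_cos_le_one θ
        · simpa [w'] using Real.abs_sin_le_one θ) θ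
  have hgrow : ∀ θ (f : (α ⊕ β → ℝ) → ℝ), Continuous f → ExpGrowth f →
      Integrable (fun x => f (sinCosScale α β θ * x)) (gaussPi (α ⊕ β)) := fun θ f hc hg =>
    (hg.comp 1 0 fun x => by
      rw [one_mul, add_zero]
      refine Finset.sum_le_sum fun i _ => ?_
      rw [Pi.mul_apply, abs_mul]
      exact mul_le_of_le_one_left (abs_nonneg _) (hw1 θ i)).integrable_of_continuous
      (hc.comp (continuous_const.mul continuous_id))
  have hle : ∀ θ, 0 ≤ Real.sin θ * Real.cos θ →
      (∑ c, sinCosScale α β θ c * w' θ c * ∫ x, expSumDeriv2 U s c (sinCosScale α β θ * x)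
        ∂gaussPi (α ⊕ β)) ≤ -(s * B) ^ 2 * (Real.sin θ * Real.cos θ) *
          ∫ x, expSum U (sinCosScale α β θ * x) ^ s ∂gaussPi (α ⊕ β) := fun θ hθ => by
    have hi := fun c => hgrow θ _ (continuous_expSumDeriv2 (U := U) s c) (ExpGrowth.expSumDeriv2 hs c)
    have hI : (∑ c, sinCosScale α β θ c * w' θ c *
        ∫ x, expSumDeriv2 U s c (sinCosScale α β θ * x) ∂gaussPi (α ⊕ β)) =
        (Real.sin θ * Real.cos θ) * ∫ x, (∑ i, expSumDeriv2 U s (Sum.inl i) (sinCosScale α β θ * x) -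
          ∑ j, expSumDeriv2 U s (Sum.inr j) (sinCosScale α β θ * x)) ∂gaussPi (α ⊕ β) := by
      rw [integral_sub (integrable_finsetSum _ fun i _ => hi _)
        (integrable_finsetSum _ fun i _ => hi _), integral_finsetSum _ fun i _ => hi _,
        integral_finsetSum _ fun i _ => hi _, Fintype.sum_sum_type, mul_sub, Finset.mul_sum,
        Finset.mul_sum, sub_eq_add_neg, ← Finset.sum_neg_distrib]
      congr 1
      refine Finset.sum_congr rfl fun j _ => ?_
      simp only [sinCosScale, w', Sum.elim_inr]
      ring
    have hmono := integral_mono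
      ((integrable_finsetSum Finset.univ fun i _ => hi (Sum.inl i)).sub
        (integrable_finsetSum Finset.univ fun i _ => hi (Sum.inr i)))
      ((hgrow θ _ (continuous_expSum_rpow s) (ExpGrowth.expSum_rpow hs)).const_mul (-(s * B) ^ 2))
      fun x => sum_expSumDeriv2_sub_le hs0 hs hQ hQ' (sinCosScale α β θ * x)
    rw [integral_const_mul] at hmono
    rw [hI]
    refine (mul_le_mul_of_nonneg_left hmono hθ).trans_eq ?_
    ring
  have hpi := Real.pi_pos
  have hG : ∀ θ, HasDerivAt (fun θ => Real.exp ((s * B) ^ 2 / 2 * Real.sin θ ^ 2) *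
      ∫ x, expSum U (sinCosScale α β θ * x) ^ s ∂gaussPi (α ⊕ β)) _ θ := fun θ =>
    ((((Real.hasDerivAt_sin θ).pow 2).const_mul ((s * B) ^ 2 / 2)).exp).mul (hd θ)
  have hanti := antitoneOn_of_deriv_nonpos (convex_Icc 0 (Real.pi / 2))
    (fun θ _ => (hG θ).continuousAt.continuousWithinAt)
    (fun θ _ => (hG θ).differentiableAt.differentiableWithinAt) (fun θ hθ => ?_)
    (Set.left_mem_Icc.2 (by positivity)) (Set.right_mem_Icc.2 (by positivity)) (by positivity)
  · simpa using hanti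
  · rw [interior_Icc] at hθ
    have hsin : 0 < Real.sin θ := Real.sin_pos_of_pos_of_lt_pi hθ.1 (by linarith [hθ.2])
    have hcos : 0 < Real.cos θ := Real.cos_pos_of_mem_Ioo ⟨by linarith [hθ.1], hθ.2⟩
    rw [(hG θ).deriv]
    have h := mul_le_mul_of_nonneg_left (hle θ (mul_pos hsin hcos).le)
      (Real.exp_pos ((s * B) ^ 2 / 2 * Real.sin θ ^ 2)).le
    refine (add_le_add_right h _).trans_eq ?_
    simp only [Pi.pow_apply]
    push_cast
    ring

end Comparison

/-! ### The operator norm through unit vectors. -/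

section OperatorNorm

variable {m n : Type*} [Fintype m] [Fintype n] [DecidableEq n]

theorem l2_opNorm_le_of_forall {𝕜 : Type*} [RCLike 𝕜] (A : Matrix m n 𝕜) {C : ℝ} (hC : 0 ≤ C)
    (h : ∀ x : n → 𝕜, ∑ i, ‖A.mulVec x i‖ ^ 2 ≤ C ^ 2 * ∑ j, ‖x j‖ ^ 2) : ‖A‖ ≤ C := by
  rw [Matrix.l2_opNorm_def]
  refine ContinuousLinearMap.opNorm_le_bound _ hC fun x => ?_
  refine le_of_sq_le_sq ?_ (by positivity)
  rw [mul_pow, EuclideanSpace.norm_sq_eq, EuclideanSpace.norm_sq_eq]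
  exact h x

theorem sum_norm_mulVec_sq_le {𝕜 : Type*} [RCLike 𝕜] (A : Matrix m n 𝕜) (x : n → 𝕜) :
    ∑ i, ‖A.mulVec x i‖ ^ 2 ≤ ‖A‖ ^ 2 * ∑ j, ‖x j‖ ^ 2 := by
  have h := A.l2_opNorm_mulVec (WithLp.toLp 2 x)
  have h2 := pow_le_pow_left₀ (norm_nonneg _) h 2
  rw [mul_pow, EuclideanSpace.norm_sq_eq, EuclideanSpace.norm_sq_eq] at h2
  exact h2

theorem dotProduct_sq_le (x y : m → ℝ) : (∑ i, x i * y i) ^ 2 ≤ (∑ i, x i ^ 2) * ∑ i, y i ^ 2 :=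
  Finset.sum_mul_sq_le_sq_mul_sq _ _ _

theorem dotProduct_mulVec_le_norm (A : Matrix m n ℝ) {x : n → ℝ} {y : m → ℝ}
    (hx : ∑ j, x j ^ 2 = 1) (hy : ∑ i, y i ^ 2 = 1) : ∑ i, y i * A.mulVec x i ≤ ‖A‖ := by
  refine le_of_sq_le_sq ?_ (norm_nonneg _)
  have h := sum_norm_mulVec_sq_le A x
  simp only [Real.norm_eq_abs, sq_abs, hx, mul_one] at h
  exact (dotProduct_sq_le _ _).trans (by rwa [hy, one_mul])

theorem exists_unit_mul (x : m → ℝ) (hx : ∑ i, x i ^ 2 ≠ 0) :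
    ∃ (c : ℝ) (x' : m → ℝ), 0 < c ∧ c ^ 2 = ∑ i, x i ^ 2 ∧ ∑ i, x' i ^ 2 = 1 ∧ x = c • x' := by
  have h0 : 0 < ∑ i, x i ^ 2 := lt_of_le_of_ne (Finset.sum_nonneg fun i _ => sq_nonneg _) hx.symm
  have hs := Real.sqrt_pos.2 h0
  refine ⟨√(∑ i, x i ^ 2), (√(∑ i, x i ^ 2))⁻¹ • x, hs, Real.sq_sqrt h0.le, ?_, ?_⟩
  · simp only [Pi.smul_apply, smul_eq_mul, mul_pow, ← Finset.mul_sum]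
    rw [inv_pow, Real.sq_sqrt h0.le, inv_mul_cancel₀ hx]
  · rw [smul_smul, mul_inv_cancel₀ hs.ne', one_smul]

theorem l2_opNorm_le_of_forall_unit (A : Matrix m n ℝ) {C : ℝ} (hC : 0 ≤ C)
    (h : ∀ (x : n → ℝ) (y : m → ℝ), ∑ j, x j ^ 2 = 1 → ∑ i, y i ^ 2 = 1 → ∑ i, y i * A.mulVec x i ≤ C) :
    ‖A‖ ≤ C := by
  refine l2_opNorm_le_of_forall A hC fun x => ?_
  simp only [Real.norm_eq_abs, sq_abs]
  by_cases hx : ∑ j, x j ^ 2 = 0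
  · have : x = 0 := by
      ext j
      have := (Finset.sum_eq_zero_iff_of_nonneg fun i _ => sq_nonneg (x i)).1 hx j (Finset.mem_univ j)
      simpa using this
    simp [this]
  by_cases hy : ∑ i, A.mulVec x i ^ 2 = 0
  · rw [hy]; positivity
  obtain ⟨c, x', hc, hcx, hx', rfl⟩ := exists_unit_mul x hx
  obtain ⟨d, y', hd, hdy, hy', hA⟩ := exists_unit_mul _ hy
  rw [← hcx, ← hdy, ← mul_pow]
  refine pow_le_pow_left₀ hd.le ?_ 2
  have h1 := h x' y' hx' hy'
  rw [Matrix.mulVec_smul] at hA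
  have h2 : c * ∑ i, y' i * A.mulVec x' i = d := by
    rw [Finset.mul_sum, ← mul_one d, ← hy', Finset.mul_sum]
    refine Finset.sum_congr rfl fun i _ => ?_
    have := congrFun hA i
    simp only [Pi.smul_apply, smul_eq_mul] at this
    rw [mul_left_comm, this]; ring
  rw [← h2, mul_comm C]
  gcongr

theorem norm_of_le_sum (A : m × n → ℝ) :
    ‖(Matrix.of fun i j => A (i, j) : Matrix m n ℝ)‖ ≤ ∑ q, |A q| := by
  refine l2_opNorm_le_of_forall_unit _ (Finset.sum_nonneg fun _ _ => abs_nonneg _)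
    fun x y hx hy => ?_
  have hx' : ∀ j, |x j| ≤ 1 := fun j => by
    rw [← sq_le_one_iff_abs_le_one, ← hx]
    exact Finset.single_le_sum (f := fun j => x j ^ 2) (fun _ _ => sq_nonneg _) (Finset.mem_univ j)
  have hy' : ∀ j, |y j| ≤ 1 := fun j => by
    rw [← sq_le_one_iff_abs_le_one, ← hy]
    exact Finset.single_le_sum (f := fun j => y j ^ 2) (fun _ _ => sq_nonneg _) (Finset.mem_univ j)
  rw [Fintype.sum_prod_type]
  simp only [Matrix.mulVec, dotProduct, Matrix.of_apply, Finset.mul_sum]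
  refine Finset.sum_le_sum fun i _ => Finset.sum_le_sum fun j _ => (le_abs_self _).trans ?_
  rw [abs_mul, abs_mul]
  calc |y i| * (|A (i, j)| * |x j|) ≤ 1 * (|A (i, j)| * 1) := by
        gcongr
        · exact hy' i
        · exact hx' j
    _ = _ := by ring

theorem l2_opNorm_map_ofReal_le (A : Matrix m n ℝ) : ‖A.map Complex.ofReal‖ ≤ ‖A‖ := by
  refine l2_opNorm_le_of_forall _ (norm_nonneg _) fun x => ?_
  have hre : ∀ i, ((A.map Complex.ofReal).mulVec x i).re = A.mulVec (fun j => (x j).re) i :=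
    fun i => by simp [Matrix.mulVec, dotProduct]
  have him : ∀ i, ((A.map Complex.ofReal).mulVec x i).im = A.mulVec (fun j => (x j).im) i :=
    fun i => by simp [Matrix.mulVec, dotProduct]
  have h1 := sum_norm_mulVec_sq_le A fun j => (x j).re
  have h2 := sum_norm_mulVec_sq_le A fun j => (x j).im
  simp only [Real.norm_eq_abs, sq_abs] at h1 h2
  simp only [Complex.sq_norm, Complex.normSq_apply, hre, him, Finset.sum_add_distrib, ← sq]
  rw [mul_add]
  exact add_le_add h1 h2

end OperatorNorm

/-! ### Chevet's inequality for exponential moments. -/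

section Chevet

variable {m n : Type*} [Fintype m] [Fintype n]

theorem integral_gaussPi_inl {α β : Type*} [Fintype α] [Fintype β] {f : (α → ℝ) → ℝ}
    (hf : Continuous f) :
    ∫ z, f (fun a => z (Sum.inl a)) ∂gaussPi (α ⊕ β) = ∫ x, f x ∂gaussPi α := by
  have hc : Continuous fun z : α ⊕ β → ℝ => f (fun a => z (Sum.inl a)) := by fun_prop
  rw [integral_gaussPi_sum hc.stronglyMeasurable]
  simp only [Sum.elim_inl]
  rw [integral_fun_fst]
  simp

theorem integral_gaussPi_inr_mul {α β γ : Type*} [Fintype α] [Fintype β] [Fintype γ]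
    {f : (β → ℝ) → ℝ} {g : (γ → ℝ) → ℝ} (hf : Continuous f) (hg : Continuous g) :
    ∫ z, f (fun b => z (Sum.inr (Sum.inl b))) * g (fun c => z (Sum.inr (Sum.inr c)))
      ∂gaussPi (α ⊕ (β ⊕ γ)) = (∫ x, f x ∂gaussPi β) * ∫ x, g x ∂gaussPi γ := by
  have hc : Continuous fun z : α ⊕ (β ⊕ γ) → ℝ =>
      f (fun b => z (Sum.inr (Sum.inl b))) * g (fun c => z (Sum.inr (Sum.inr c))) := by fun_prop
  have hc' : Continuous fun z : β ⊕ γ → ℝ =>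
      f (fun b => z (Sum.inl b)) * g (fun c => z (Sum.inr c)) := by fun_prop
  rw [integral_gaussPi_sum hc.stronglyMeasurable]
  simp only [Sum.elim_inr]
  rw [integral_fun_snd (fun z : β ⊕ γ → ℝ =>
      f (fun b => z (Sum.inl b)) * g (fun c => z (Sum.inr c))),
    integral_gaussPi_sum hc'.stronglyMeasurable]
  simp only [Sum.elim_inr, Sum.elim_inl]
  rw [integral_prod_mul]
  simp

theorem ExpGrowth.exp_sqrt_sum_sq {l : ℝ} (hl : 0 ≤ l) :
    ExpGrowth fun g : n → ℝ => Real.exp (l * √(∑ i, g i ^ 2)) := by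
  refine ExpGrowth.of_le_add_exp 1 l 0 zero_le_one fun g => ?_
  rw [Real.norm_of_nonneg (Real.exp_pos _).le, one_mul, add_zero]
  refine Real.exp_le_exp.2 (mul_le_mul_of_nonneg_left ?_ hl)
  refine Real.sqrt_le_iff.2 ⟨Finset.sum_nonneg fun _ _ => abs_nonneg _, ?_⟩
  simp only [← sq_abs (g _)]
  exact Finset.sum_sq_le_sq_sum_of_nonneg fun _ _ => abs_nonneg _

/-- The coefficients of the forms compared in Chevet's inequality. -/
def chevetCoeff {K : Type*} (B : ℝ) (X : K → n → ℝ) (Y : K → m → ℝ) (k : K) :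
    m × n ⊕ (n ⊕ m) → ℝ :=
  Sum.elim (fun q => B * (Y k q.1 * X k q.2))
    (Sum.elim (fun j => B * X k j) fun i => B * Y k i)

variable {K : Type*} {X : K → n → ℝ} {Y : K → m → ℝ}

/-- Since `a b - a - b = (1 - a) (1 - b) - 1`, for unit vectors this is at least `-B²`, with
equality on the diagonal `k = l`: precisely the hypotheses of the comparison. -/
theorem chevetCoeff_form (B : ℝ) (k l : K) :
    ∑ i, chevetCoeff B X Y k (Sum.inl i) * chevetCoeff B X Y l (Sum.inl i) -
      ∑ j, chevetCoeff B X Y k (Sum.inr j) * chevetCoeff B X Y l (Sum.inr j) =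
    B ^ 2 * ((1 - ∑ j, X k j * X l j) * (1 - ∑ i, Y k i * Y l i) - 1) := by
  have h1 : ∑ i, chevetCoeff B X Y k (Sum.inl i) * chevetCoeff B X Y l (Sum.inl i) =
      B ^ 2 * ((∑ i, Y k i * Y l i) * ∑ j, X k j * X l j) := by
    rw [Fintype.sum_prod_type, Finset.sum_mul_sum, Finset.mul_sum]
    refine Finset.sum_congr rfl fun i _ => ?_
    rw [Finset.mul_sum]
    exact Finset.sum_congr rfl fun j _ => by simp only [chevetCoeff, Sum.elim_inl]; ring
  have h2 : ∑ j, chevetCoeff B X Y k (Sum.inr j) * chevetCoeff B X Y l (Sum.inr j) =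
      B ^ 2 * (∑ j, X k j * X l j + ∑ i, Y k i * Y l i) := by
    rw [Fintype.sum_sum_type, mul_add, Finset.mul_sum, Finset.mul_sum]
    congr 1 <;> exact Finset.sum_congr rfl fun j _ => by
      simp only [chevetCoeff, Sum.elim_inl, Sum.elim_inr]; ring
  rw [h1, h2]; ring

theorem sum_mul_le_one {x y : n → ℝ} (hx : ∑ j, x j ^ 2 = 1) (hy : ∑ j, y j ^ 2 = 1) :
    ∑ j, x j * y j ≤ 1 := by
  have h := dotProduct_sq_le x y
  rw [hx, hy, one_mul, sq_le_one_iff_abs_le_one] at h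
  exact (le_abs_self _).trans h

theorem expSum_chevet_pi_div_two [Fintype K] (B : ℝ) (z : m × n ⊕ (n ⊕ m) → ℝ) :
    expSum (chevetCoeff B X Y) (sinCosScale (m × n) (n ⊕ m) (Real.pi / 2) * z) =
      ∑ k, Real.exp (B * ∑ q : m × n, Y k q.1 * X k q.2 * z (Sum.inl q)) := by
  unfold expSum
  refine Finset.sum_congr rfl fun k _ => ?_
  rw [Fintype.sum_sum_type, Finset.mul_sum]
  simp [chevetCoeff, sinCosScale, mul_assoc]

theorem expSum_chevet_zero [Fintype K] (B : ℝ) (z : m × n ⊕ (n ⊕ m) → ℝ) :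
    expSum (chevetCoeff B X Y) (sinCosScale (m × n) (n ⊕ m) 0 * z) =
      ∑ k, Real.exp (B * (∑ j, X k j * z (Sum.inr (Sum.inl j)) +
        ∑ i, Y k i * z (Sum.inr (Sum.inr i)))) := by
  unfold expSum
  refine Finset.sum_congr rfl fun k _ => ?_
  rw [Fintype.sum_sum_type, Fintype.sum_sum_type, mul_add, Finset.mul_sum, Finset.mul_sum]
  simp [chevetCoeff, sinCosScale, mul_assoc]

theorem sum_mul_le_sqrt {x : n → ℝ} (hx : ∑ j, x j ^ 2 = 1) (g : n → ℝ) :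
    ∑ j, x j * g j ≤ √(∑ j, g j ^ 2) := by
  refine Real.le_sqrt_of_sq_le ?_
  have h := dotProduct_sq_le x g
  rwa [hx, one_mul] at h

/-- With `s B = l`, the power `s` of the sum of `exp (B · form)` dominates `exp (l · form)` for each
single form, hence dominates `F`. On the other side all forms are bounded by Cauchy–Schwarz, at the
price of the factor `card K ^ s`; there the two Gaussian vectors are independent and the average
factorises. -/
theorem exp_mul_integral_chevet_le_rpow_mul [Fintype K] [Nonempty K] {l : ℝ} (hl : 0 < l) (hX : ∀ k, ∑ j, X k j ^ 2 = 1)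
    (hY : ∀ k, ∑ i, Y k i ^ 2 = 1) {s : ℝ} (hs0 : 0 < s) (hs : s ≤ 1) {F : (m × n → ℝ) → ℝ}
    (hFc : Continuous F) (hFg : ExpGrowth F)
    (hF : ∀ A, ∃ k, F A = Real.exp (l * ∑ q : m × n, Y k q.1 * X k q.2 * A q)) :
    Real.exp (l ^ 2 / 2) * ∫ A, F A ∂gaussPi (m × n) ≤ (Fintype.card K : ℝ) ^ s *
      ((∫ g, Real.exp (l * √(∑ j, g j ^ 2)) ∂gaussPi n) *
        ∫ h, Real.exp (l * √(∑ i, h i ^ 2)) ∂gaussPi m) := by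
  set B := l / s with hB
  have hsB : s * B = l := mul_div_cancel₀ _ hs0.ne'
  have hBs : B * s = l := by rw [mul_comm, hsB]
  have key := exp_mul_integral_expSum_rpow_le (U := chevetCoeff B X Y) (B := B) hs0.le hs
    (fun k k' => by
      rw [chevetCoeff_form]
      have h1 := sum_mul_le_one (hX k) (hX k')
      have h2 := sum_mul_le_one (hY k) (hY k')
      have h3 := mul_nonneg (sq_nonneg B) (mul_nonneg (sub_nonneg.2 h1) (sub_nonneg.2 h2))
      linarith)
    (fun k => by
      rw [chevetCoeff_form]
      simp only [← sq, hX, hY]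
      ring)
  rw [hsB] at key
  simp only [expSum_chevet_pi_div_two, expSum_chevet_zero] at key
  have hc1 : Continuous fun A : m × n → ℝ =>
      (∑ k, Real.exp (B * ∑ q : m × n, Y k q.1 * X k q.2 * A q)) ^ s :=
    Continuous.rpow_const (by fun_prop) fun A => Or.inl
      (Finset.sum_pos (fun _ _ => Real.exp_pos _) Finset.univ_nonempty).ne'
  rw [integral_gaussPi_inl hc1] at key
  have hg1 : ExpGrowth fun A : m × n → ℝ =>
      (∑ k, Real.exp (B * ∑ q : m × n, Y k q.1 * X k q.2 * A q)) ^ s := by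
    have := ExpGrowth.expSum_rpow (U := fun (k : K) (q : m × n) => B * (Y k q.1 * X k q.2)) hs
    simpa only [expSum, Finset.mul_sum, mul_assoc] using this
  have hlow : ∫ A, F A ∂gaussPi (m × n) ≤ ∫ A : m × n → ℝ,
      (∑ k, Real.exp (B * ∑ q : m × n, Y k q.1 * X k q.2 * A q)) ^ s ∂gaussPi (m × n) := by
    refine integral_mono (hFg.integrable_of_continuous hFc) (hg1.integrable_of_continuous hc1)
      fun A => ?_
    obtain ⟨k, hk⟩ := hF A
    change F A ≤ _
    have he : Real.exp (l * ∑ q : m × n, Y k q.1 * X k q.2 * A q) =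
        Real.exp (B * ∑ q : m × n, Y k q.1 * X k q.2 * A q) ^ s := by
      rw [← Real.exp_mul, ← hBs]; ring_nf
    rw [hk, he]
    exact Real.rpow_le_rpow (Real.exp_pos _).le (Finset.single_le_sum
      (f := fun k => Real.exp (B * ∑ q : m × n, Y k q.1 * X k q.2 * A q))
      (fun _ _ => (Real.exp_pos _).le) (Finset.mem_univ k)) hs0.le
  have hup : ∫ z, (∑ k, Real.exp (B * (∑ j, X k j * z (Sum.inr (Sum.inl j)) +
        ∑ i, Y k i * z (Sum.inr (Sum.inr i))))) ^ s ∂gaussPi (m × n ⊕ (n ⊕ m)) ≤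
      ∫ z, (Fintype.card K : ℝ) ^ s * (Real.exp (l * √(∑ j, z (Sum.inr (Sum.inl j)) ^ 2)) *
        Real.exp (l * √(∑ i, z (Sum.inr (Sum.inr i)) ^ 2))) ∂gaussPi (m × n ⊕ (n ⊕ m)) := by
    refine integral_mono_of_nonneg (Filter.Eventually.of_forall fun z => ?_)
      (Integrable.const_mul ?_ _) (Filter.Eventually.of_forall fun z => ?_)
    · exact Real.rpow_nonneg (Finset.sum_nonneg fun _ _ => (Real.exp_pos _).le) _
    · have hg2 := (ExpGrowth.exp_sqrt_sum_sq (n := n) hl.le).comp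
        (T := fun (z : m × n ⊕ (n ⊕ m) → ℝ) j => z (Sum.inr (Sum.inl j))) 1 0 fun z => by
          simp only [Fintype.sum_sum_type]
          have h1 : 0 ≤ ∑ q, |z (Sum.inl q)| := Finset.sum_nonneg fun _ _ => abs_nonneg _
          have h2 : 0 ≤ ∑ q, |z (Sum.inr (Sum.inr q))| := Finset.sum_nonneg fun _ _ => abs_nonneg _
          linarith
      have hg3 := (ExpGrowth.exp_sqrt_sum_sq (n := m) hl.le).comp
        (T := fun (z : m × n ⊕ (n ⊕ m) → ℝ) j => z (Sum.inr (Sum.inr j))) 1 0 fun z => by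
          simp only [Fintype.sum_sum_type]
          have h1 : 0 ≤ ∑ q, |z (Sum.inl q)| := Finset.sum_nonneg fun _ _ => abs_nonneg _
          have h2 : 0 ≤ ∑ q, |z (Sum.inr (Sum.inl q))| := Finset.sum_nonneg fun _ _ => abs_nonneg _
          linarith
      exact (hg2.mul hg3).integrable_of_continuous (by fun_prop)
    · have hpos : 0 ≤ Real.exp (B * (√(∑ j, z (Sum.inr (Sum.inl j)) ^ 2) +
          √(∑ i, z (Sum.inr (Sum.inr i)) ^ 2))) := (Real.exp_pos _).le
      have he : Real.exp (l * √(∑ j, z (Sum.inr (Sum.inl j)) ^ 2)) *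
          Real.exp (l * √(∑ i, z (Sum.inr (Sum.inr i)) ^ 2)) =
          Real.exp (B * (√(∑ j, z (Sum.inr (Sum.inl j)) ^ 2) +
          √(∑ i, z (Sum.inr (Sum.inr i)) ^ 2))) ^ s := by
        rw [← Real.exp_add, ← Real.exp_mul, ← hBs]; ring_nf
      change _ ^ s ≤ _ * _
      rw [he, ← Real.mul_rpow (by positivity) hpos]
      refine Real.rpow_le_rpow (Finset.sum_nonneg fun _ _ => (Real.exp_pos _).le) ?_ hs0.le
      rw [← nsmul_eq_mul]
      refine Finset.sum_le_card_nsmul _ _ _ fun k _ => Real.exp_le_exp.2 ?_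
      have hB0 : 0 ≤ B := (div_pos hl hs0).le
      gcongr
      · exact sum_mul_le_sqrt (hX k) _
      · exact sum_mul_le_sqrt (hY k) _
  rw [integral_const_mul, integral_gaussPi_inr_mul (f := fun g => Real.exp (l * √(∑ j, g j ^ 2)))
    (g := fun g => Real.exp (l * √(∑ j, g j ^ 2))) (by fun_prop) (by fun_prop)] at hup
  calc _ ≤ _ := mul_le_mul_of_nonneg_left hlow (Real.exp_pos _).le
    _ ≤ _ := key
    _ ≤ _ := hup

/-- Taking `s = 1 / (N + 1)` and letting `N → ∞` removes the factor depending on the number of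
forms. -/
theorem exp_mul_integral_chevet_le [Fintype K] [Nonempty K] {l : ℝ} (hl : 0 < l)
    (hX : ∀ k, ∑ j, X k j ^ 2 = 1) (hY : ∀ k, ∑ i, Y k i ^ 2 = 1) {F : (m × n → ℝ) → ℝ}
    (hFc : Continuous F) (hFg : ExpGrowth F)
    (hF : ∀ A, ∃ k, F A = Real.exp (l * ∑ q : m × n, Y k q.1 * X k q.2 * A q)) :
    Real.exp (l ^ 2 / 2) * ∫ A, F A ∂gaussPi (m × n) ≤
      (∫ g, Real.exp (l * √(∑ j, g j ^ 2)) ∂gaussPi n) *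
        ∫ h, Real.exp (l * √(∑ i, h i ^ 2)) ∂gaussPi m := by
  set R := (∫ g, Real.exp (l * √(∑ j, g j ^ 2)) ∂gaussPi n) *
        ∫ h, Real.exp (l * √(∑ i, h i ^ 2)) ∂gaussPi m
  have hlim : Filter.Tendsto (fun N : ℕ => (Fintype.card K : ℝ) ^ (1 / ((N : ℝ) + 1)) * R)
      Filter.atTop (nhds ((Fintype.card K : ℝ) ^ (0 : ℝ) * R)) := by
    have h0 : (Fintype.card K : ℝ) ≠ 0 := by exact_mod_cast Fintype.card_ne_zero
    exact ((Real.continuousAt_const_rpow h0).tendsto.comp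
      tendsto_one_div_add_atTop_nhds_zero_nat).mul_const _
  rw [Real.rpow_zero, one_mul] at hlim
  refine ge_of_tendsto' hlim fun N => ?_
  exact exp_mul_integral_chevet_le_rpow_mul hl hX hY (by positivity)
    ((div_le_one (by positivity)).2 (by linarith [(Nat.cast_nonneg N : (0 : ℝ) ≤ N)])) hFc hFg hF

/-- Pairs of unit vectors. -/
abbrev UnitPair (m n : Type*) [Fintype m] [Fintype n] : Type _ :=
  {p : (n → ℝ) × (m → ℝ) // ∑ j, p.1 j ^ 2 = 1 ∧ ∑ i, p.2 i ^ 2 = 1}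

theorem nonempty_unitPair (m n : Type*) [Fintype m] [Fintype n] [Nonempty m] [Nonempty n] :
    Nonempty (UnitPair m n) := by
  classical
  obtain ⟨i⟩ := ‹Nonempty m›
  obtain ⟨j⟩ := ‹Nonempty n›
  exact ⟨⟨(Pi.single j 1, Pi.single i 1), by simp [Pi.single_apply], by simp [Pi.single_apply]⟩⟩

/-- Along a dense sequence of unit pairs, maxima over finite initial segments increase to the
supremum of the bilinear form, which is the norm. One sequence serves all matrices, so the
comparison for finite families applies. -/
theorem exists_seq_tendsto_norm (m n : Type*) [Fintype m] [Fintype n] [DecidableEq n] [Nonempty m]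
    [Nonempty n] : ∃ p : ℕ → UnitPair m n, ∀ A : Matrix m n ℝ,
      Filter.Tendsto (fun N => (Finset.univ : Finset (Fin (N + 1))).sup' Finset.univ_nonempty
        fun k => ∑ i, (p k).1.2 i * A.mulVec (p k).1.1 i) Filter.atTop (nhds ‖A‖) := by
  have := nonempty_unitPair m n
  refine ⟨TopologicalSpace.denseSeq (UnitPair m n), fun A => ?_⟩
  set p := TopologicalSpace.denseSeq (UnitPair m n)
  set φ : ℕ → ℝ := fun N => (Finset.univ : Finset (Fin (N + 1))).sup' Finset.univ_nonempty
        fun k => ∑ i, (p k).1.2 i * A.mulVec (p k).1.1 i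
  have hmono : Monotone φ := by
    intro N N' hN
    refine Finset.sup'_le _ _ fun k _ => ?_
    exact Finset.le_sup' (f := fun k : Fin (N' + 1) => ∑ i, (p k).1.2 i * A.mulVec (p k).1.1 i)
      (Finset.mem_univ (Fin.castLE (by omega) k))
  have hle : ∀ N, φ N ≤ ‖A‖ := fun N => Finset.sup'_le _ _ fun k _ =>
    dotProduct_mulVec_le_norm A (p k).2.1 (p k).2.2
  have hbdd : BddAbove (Set.range φ) := ⟨‖A‖, by rintro _ ⟨N, rfl⟩; exact hle N⟩
  have hlim := tendsto_atTop_ciSup hmono hbdd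
  convert hlim using 2
  refine le_antisymm ?_ (ciSup_le hle)
  have hk : ∀ k, ∑ i, (p k).1.2 i * A.mulVec (p k).1.1 i ≤ ⨆ N, φ N := fun k =>
    (Finset.le_sup' (f := fun k' : Fin (k + 1) => ∑ i, (p k').1.2 i * A.mulVec (p k').1.1 i)
      (Finset.mem_univ (Fin.last k))).trans (le_ciSup hbdd k)
  have hall : ∀ z : UnitPair m n, ∑ i, z.1.2 i * A.mulVec z.1.1 i ≤ ⨆ N, φ N := by
    have hcl : IsClosed {z : UnitPair m n | ∑ i, z.1.2 i * A.mulVec z.1.1 i ≤ ⨆ N, φ N} := by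
      refine isClosed_le (continuous_finsetSum _ fun i _ => Continuous.mul (by fun_prop) ?_)
        continuous_const
      exact (continuous_apply i).comp (Continuous.matrix_mulVec continuous_const (by fun_prop))
    intro z
    exact hcl.closure_subset_iff.2 (by rintro _ ⟨k, rfl⟩; exact hk k)
      (TopologicalSpace.denseRange_denseSeq (UnitPair m n) z)
  refine l2_opNorm_le_of_forall_unit A ?_ fun x y hx hy => hall ⟨(x, y), hx, hy⟩
  -- The supremum is nonnegative because it dominates the values at `(x, y)` and `(x, -y)`, which
  -- are opposite.
  obtain ⟨⟨⟨x, y⟩, hx, hy⟩⟩ := this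
  have h1 := hall ⟨(x, y), hx, hy⟩
  have h2 := hall ⟨(x, -y), hx, by simpa using hy⟩
  simp only [Pi.neg_apply, neg_mul, Finset.sum_neg_distrib] at h1 h2
  linarith

theorem sum_mul_mulVec_of (x : n → ℝ) (y : m → ℝ) (A : m × n → ℝ) :
    ∑ i, y i * (Matrix.of fun i j => A (i, j) : Matrix m n ℝ).mulVec x i =
      ∑ q : m × n, y q.1 * x q.2 * A q := by
  rw [Fintype.sum_prod_type]
  simp only [Matrix.mulVec, dotProduct, Matrix.of_apply, Finset.mul_sum]
  exact Finset.sum_congr rfl fun i _ => Finset.sum_congr rfl fun j _ => by ring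

theorem ExpGrowth.exp_norm_of [DecidableEq n] {l : ℝ} (hl : 0 ≤ l) :
    ExpGrowth fun A : m × n → ℝ => Real.exp (l * ‖(Matrix.of fun i j => A (i, j) : Matrix m n ℝ)‖) :=
  ExpGrowth.of_le_add_exp 1 l 0 zero_le_one fun A => by
    rw [Real.norm_of_nonneg (Real.exp_pos _).le, one_mul, add_zero]
    exact Real.exp_le_exp.2 (mul_le_mul_of_nonneg_left (norm_of_le_sum A) hl)

theorem continuous_norm_of [DecidableEq n] :
    Continuous fun A : m × n → ℝ => ‖(Matrix.of fun i j => A (i, j) : Matrix m n ℝ)‖ :=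
  Continuous.norm (continuous_matrix fun i j => by simp only [Matrix.of_apply]; fun_prop)

/-- Chevet's inequality for exponential moments. -/
theorem exp_mul_integral_exp_norm_le [DecidableEq n] [Nonempty m] [Nonempty n] {l : ℝ}
    (hl : 0 < l) :
    Real.exp (l ^ 2 / 2) * ∫ A, Real.exp (l * ‖(Matrix.of fun i j => A (i, j) : Matrix m n ℝ)‖)
        ∂gaussPi (m × n) ≤
      (∫ g, Real.exp (l * √(∑ j, g j ^ 2)) ∂gaussPi n) *
        ∫ h, Real.exp (l * √(∑ i, h i ^ 2)) ∂gaussPi m := by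
  obtain ⟨p, hp⟩ := exists_seq_tendsto_norm m n
  set φ : ℕ → (m × n → ℝ) → ℝ := fun N A =>
    (Finset.univ : Finset (Fin (N + 1))).sup' Finset.univ_nonempty
        fun k => ∑ q : m × n, (p k).1.2 q.1 * (p k).1.1 q.2 * A q with hφ
  have hφ' : ∀ N A, φ N A ≤ ‖(Matrix.of fun i j => A (i, j) : Matrix m n ℝ)‖ := fun N A =>
    Finset.sup'_le _ _ fun k _ => by
      rw [← sum_mul_mulVec_of]
      exact dotProduct_mulVec_le_norm _ (p k).2.1 (p k).2.2
  have hc : ∀ N, Continuous fun A => Real.exp (l * φ N A) := fun N =>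
    Real.continuous_exp.comp (continuous_const.mul
      (Continuous.finset_sup'_apply _ fun k _ => by fun_prop))
  have hb : ∀ N A, Real.exp (l * φ N A) ≤
      Real.exp (l * ‖(Matrix.of fun i j => A (i, j) : Matrix m n ℝ)‖) := fun N A =>
    Real.exp_le_exp.2 (mul_le_mul_of_nonneg_left (hφ' N A) hl.le)
  have hg : ∀ N, ExpGrowth fun A => Real.exp (l * φ N A) := fun N =>
    (ExpGrowth.exp_norm_of hl.le).of_norm_le fun A => by
      rw [Real.norm_of_nonneg (Real.exp_pos _).le, Real.norm_of_nonneg (Real.exp_pos _).le]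
      exact hb N A
  refine le_of_tendsto' (Filter.Tendsto.const_mul _ (tendsto_integral_of_dominated_convergence
    (F := fun N A => Real.exp (l * φ N A)) _ (fun N => (hc N).stronglyMeasurable.aestronglyMeasurable)
    ((ExpGrowth.exp_norm_of hl.le).integrable_of_continuous
      (Real.continuous_exp.comp (continuous_const.mul continuous_norm_of)))
    (fun N => Filter.Eventually.of_forall fun A => ?_)
    (Filter.Eventually.of_forall fun A => ?_))) fun N => ?_
  · rw [Real.norm_of_nonneg (Real.exp_pos _).le]
    exact hb N A
  · have h := hp (Matrix.of fun i j => A (i, j))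
    simp only [sum_mul_mulVec_of] at h
    exact (Real.continuous_exp.tendsto _).comp (h.const_mul l)
  · refine exp_mul_integral_chevet_le (K := Fin (N + 1)) (X := fun k => (p k).1.1)
      (Y := fun k => (p k).1.2) hl (fun k => (p k).2.1) (fun k => (p k).2.2) (hc N) (hg N)
      fun A => ?_
    obtain ⟨k, -, hk⟩ := Finset.exists_mem_eq_sup' (Finset.univ_nonempty (α := Fin (N + 1)))
      fun k => ∑ q : m × n, (p k).1.2 q.1 * (p k).1.1 q.2 * A q
    exact ⟨k, by rw [hφ]; simp only [hk]⟩

end Chevet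

/-! ### Exponential moments of the length of a Gaussian vector. -/

section ChiBound

theorem integrable_exp_mul_sq_gaussianReal {c : ℝ} (hc : c < 1 / 2) :
    Integrable (fun x => Real.exp (c * x ^ 2)) (gaussianReal 0 1) := by
  rw [gaussianReal_of_var_ne_zero _ one_ne_zero]
  rw [integrable_withDensity_iff (measurable_gaussianPDF _ _)
    (Filter.Eventually.of_forall fun x => gaussianPDF_lt_top)]
  have h := (integrable_exp_neg_mul_sq (b := 1 / 2 - c) (by linarith)).mul_const (√(2 * Real.pi))⁻¹
  refine h.congr (Filter.Eventually.of_forall fun x => ?_)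
  simp only [toReal_gaussianPDF, gaussianPDFReal, NNReal.coe_one, mul_one, sub_zero]
  rw [mul_left_comm, mul_comm, ← Real.exp_add]
  ring_nf

theorem integral_exp_mul_sq_gaussianReal {c : ℝ} (hc : c < 1 / 2) :
    ∫ x, Real.exp (c * x ^ 2) ∂gaussianReal 0 1 = (√(1 - 2 * c))⁻¹ := by
  rw [integral_gaussianReal_eq_integral_smul one_ne_zero]
  have h : ∀ x : ℝ, gaussianPDFReal 0 1 x • Real.exp (c * x ^ 2) =
      (√(2 * Real.pi))⁻¹ * Real.exp (-(1 / 2 - c) * x ^ 2) := fun x => by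
    simp only [gaussianPDFReal, NNReal.coe_one, mul_one, sub_zero, smul_eq_mul]
    rw [mul_assoc, ← Real.exp_add]
    ring_nf
  simp only [h]
  rw [integral_const_mul, integral_gaussian, ← Real.sqrt_inv, ← Real.sqrt_inv,
    ← Real.sqrt_mul (by positivity)]
  congr 1
  have : 1 / 2 - c ≠ 0 := by linarith
  have : 1 - 2 * c ≠ 0 := by linarith
  field_simp

variable {n : Type*} [Fintype n]

theorem exp_mul_sum_sq (c : ℝ) (g : n → ℝ) :
    Real.exp (c * ∑ i, g i ^ 2) = ∏ i, Real.exp (c * g i ^ 2) := by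
  rw [Finset.mul_sum, Real.exp_sum]

theorem integrable_exp_mul_sum_sq {c : ℝ} (hc : c < 1 / 2) :
    Integrable (fun g : n → ℝ => Real.exp (c * ∑ i, g i ^ 2)) (gaussPi n) := by
  simp only [exp_mul_sum_sq]
  exact Integrable.fintype_prod fun i => integrable_exp_mul_sq_gaussianReal hc

theorem integral_exp_mul_sum_sq {c : ℝ} (hc : c < 1 / 2) :
    ∫ g, Real.exp (c * ∑ i, g i ^ 2) ∂gaussPi n = (√(1 - 2 * c))⁻¹ ^ Fintype.card n := by
  simp only [exp_mul_sum_sq, gaussPi]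
  rw [integral_fintype_prod_eq_prod (f := fun _ x => Real.exp (c * x ^ 2))]
  simp [integral_exp_mul_sq_gaussianReal hc]

/-- Put `w = √n` and let `G` be the length. Completing the square bounds `w (ρ - τ) G` by `w² (ρ² -
1) / 2 + (1 - τ²) G² / 2`, and the Gaussian integral of the quadratic exponential is `ρ^n`. Finally
`log ρ ≤ sinh (log ρ) = (ρ - τ) / 2`; the exponents then differ by `w² (1 - τ) (ρ - τ) / 2 ≥ 0`. -/
theorem integral_exp_mul_sqrt_sum_sq_le_of_mul_eq_one {ρ τ : ℝ} (hρ : 1 ≤ ρ) (hρτ : ρ * τ = 1) :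
    ∫ g, Real.exp (√(Fintype.card n) * (ρ - τ) * √(∑ i, g i ^ 2)) ∂gaussPi n ≤
      Real.exp (√(Fintype.card n) * (ρ - τ) * √(Fintype.card n) +
        (√(Fintype.card n) * (ρ - τ)) ^ 2 / 2) := by
  set w := √(Fintype.card n : ℝ) with hw
  have hw0 : 0 ≤ w := Real.sqrt_nonneg _
  have hww : w ^ 2 = Fintype.card n := Real.sq_sqrt (Nat.cast_nonneg _)
  have hρ0 : 0 < ρ := by linarith
  have hτ : τ = ρ⁻¹ := eq_inv_of_mul_eq_one_right hρτ
  have hτ0 : 0 < τ := hτ ▸ inv_pos.2 hρ0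
  have hτ1 : τ ≤ 1 := hτ ▸ inv_le_one_of_one_le₀ hρ
  set c := (1 - τ ^ 2) / 2 with hc
  have hc2 : c < 1 / 2 := by rw [hc]; nlinarith
  have hinv : (√(1 - 2 * c))⁻¹ = ρ := by
    rw [hc, show 1 - 2 * ((1 - τ ^ 2) / 2) = τ ^ 2 by ring, Real.sqrt_sq hτ0.le, hτ, inv_inv]
  have hpt : ∀ g : n → ℝ, Real.exp (w * (ρ - τ) * √(∑ i, g i ^ 2)) ≤
      Real.exp (w ^ 2 * (ρ ^ 2 - 1) / 2) * Real.exp (c * ∑ i, g i ^ 2) := fun g => by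
    rw [← Real.exp_add]
    refine Real.exp_le_exp.2 ?_
    set G := √(∑ i, g i ^ 2)
    have hG : G ^ 2 = ∑ i, g i ^ 2 := Real.sq_sqrt (Finset.sum_nonneg fun _ _ => sq_nonneg _)
    rw [hc, ← hG]
    have h1 : w ^ 2 * (ρ ^ 2 - 1) / 2 + (1 - τ ^ 2) / 2 * G ^ 2 - w * (ρ - τ) * G =
        (1 - τ ^ 2) / 2 * (ρ * w - G) ^ 2 + (ρ * τ - 1) * (w ^ 2 * (ρ * τ + 1) / 2 - τ * w * G) := by
      ring
    rw [hρτ, sub_self, zero_mul, add_zero] at h1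
    have h2 : 0 ≤ (1 - τ ^ 2) / 2 * (ρ * w - G) ^ 2 :=
      mul_nonneg (by nlinarith) (sq_nonneg _)
    linarith
  have hlog : ρ ≤ Real.exp ((ρ - τ) / 2) := by
    have h := Real.self_le_sinh_iff.2 (Real.log_nonneg hρ)
    rw [Real.sinh_log hρ0, ← hτ] at h
    exact (Real.log_le_iff_le_exp hρ0).1 h
  calc _ ≤ ∫ g : n → ℝ, Real.exp (w ^ 2 * (ρ ^ 2 - 1) / 2) * Real.exp (c * ∑ i, g i ^ 2)
        ∂gaussPi n :=
        integral_mono_of_nonneg (Filter.Eventually.of_forall fun g => (Real.exp_pos _).le)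
          ((integrable_exp_mul_sum_sq hc2).const_mul _) (Filter.Eventually.of_forall hpt)
    _ = Real.exp (w ^ 2 * (ρ ^ 2 - 1) / 2) * ρ ^ Fintype.card n := by
        rw [integral_const_mul, integral_exp_mul_sum_sq hc2, hinv]
    _ ≤ Real.exp (w ^ 2 * (ρ ^ 2 - 1) / 2) * Real.exp ((ρ - τ) / 2) ^ Fintype.card n := by
        gcongr
    _ ≤ _ := by
        rw [← Real.exp_nat_mul, ← Real.exp_add, ← hww]
        refine Real.exp_le_exp.2 ?_
        have h1 : w * (ρ - τ) * w + (w * (ρ - τ)) ^ 2 / 2 -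
            (w ^ 2 * (ρ ^ 2 - 1) / 2 + w ^ 2 * ((ρ - τ) / 2)) =
            w ^ 2 * ((1 - τ) * (ρ - τ)) / 2 + (1 - ρ * τ) * w ^ 2 / 2 * (2 - 1) := by ring
        have h2 : 0 ≤ w ^ 2 * ((1 - τ) * (ρ - τ)) / 2 := by
          have : 0 ≤ 1 - τ := by linarith
          have : 0 ≤ ρ - τ := by linarith
          positivity
        rw [hρτ] at h1
        linarith

/-- The exponential moments of the norm of a standard Gaussian vector. -/
theorem integral_exp_mul_sqrt_sum_sq_le [Nonempty n] {l : ℝ} (hl : 0 ≤ l) :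
    ∫ g, Real.exp (l * √(∑ i, g i ^ 2)) ∂gaussPi n ≤
      Real.exp (l * √(Fintype.card n) + l ^ 2 / 2) := by
  have hw : 0 < √(Fintype.card n : ℝ) := Real.sqrt_pos.2 (by exact_mod_cast Fintype.card_pos)
  set w := √(Fintype.card n : ℝ)
  set d := l / w with hd
  have hd0 : 0 ≤ d := div_nonneg hl hw.le
  have hsq : √(d ^ 2 + 4) ^ 2 = d ^ 2 + 4 := Real.sq_sqrt (by positivity)
  have h2 : 2 ≤ √(d ^ 2 + 4) := Real.le_sqrt_of_sq_le (by nlinarith)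
  -- The solution of `ρ - τ = d`, `ρ τ = 1`, so that `w (ρ - τ) = l`.
  have h := integral_exp_mul_sqrt_sum_sq_le_of_mul_eq_one (n := n) (ρ := (√(d ^ 2 + 4) + d) / 2)
    (τ := (√(d ^ 2 + 4) - d) / 2) (by linarith) (by nlinarith)
  have e : w * ((√(d ^ 2 + 4) + d) / 2 - (√(d ^ 2 + 4) - d) / 2) = l := by
    rw [show (√(d ^ 2 + 4) + d) / 2 - (√(d ^ 2 + 4) - d) / 2 = d by ring, hd,
      mul_div_cancel₀ _ hw.ne']
  rwa [e] at h

end ChiBound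

/-! ### Exponential moments for rotated Gaussian matrices of any shape. -/

section GaussianMatrix

theorem integral_gaussPi_comp_equiv {κ κ' : Type*} [Fintype κ] [Fintype κ'] [DecidableEq κ]
    [DecidableEq κ'] (E : κ' ≃ κ) {ε : κ' → ℝ} (hε : ∀ i, ε i * ε i = 1) {F : (κ' → ℝ) → ℝ}
    (hF : Continuous F) :
    ∫ x, F x ∂gaussPi κ' = ∫ x, F (fun i => ε i * x (E i)) ∂gaussPi κ := by
  have key := gaussPi_map_mulVec_eq (Matrix.of fun i k => if E i = k then ε i else 0)
    (1 : Matrix κ' κ' ℝ) (by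
      ext i j
      simp only [Matrix.mul_apply, Matrix.of_apply, Matrix.transpose_apply, ite_mul, zero_mul,
        Finset.sum_ite_eq, Finset.mem_univ, if_true, Matrix.one_apply, Matrix.transpose_one]
      by_cases h : i = j
      · subst h; simp [hε]
      · have : E j ≠ E i := fun e => h (E.injective e).symm
        simp [h, this])
  have h1 : (fun x : κ → ℝ => (Matrix.of fun i k => if E i = k then ε i else 0).mulVec x) =
      fun x i => ε i * x (E i) := by
    ext x i
    simp [Matrix.mulVec, dotProduct]
  simp only [Matrix.one_mulVec, Measure.map_id'] at key
  rw [h1] at key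
  rw [← key, integral_map (Continuous.measurable (by fun_prop)).aemeasurable
    hF.stronglyMeasurable.aestronglyMeasurable]

theorem l2_opNorm_submatrix_equiv_le {m n m' n' : Type*} [Fintype m] [Fintype n] [DecidableEq n]
    [Fintype m'] [Fintype n'] [DecidableEq n'] (A : Matrix m n ℂ) (e : m' ≃ m) (f : n' ≃ n) :
    ‖A.submatrix e f‖ ≤ ‖A‖ := by
  refine l2_opNorm_le_of_forall _ (norm_nonneg _) fun x => ?_
  rw [Matrix.submatrix_mulVec_equiv]
  simp only [Function.comp_apply]
  rw [e.sum_comp (fun i => ‖A.mulVec (x ∘ f.symm) i‖ ^ 2), ← f.symm.sum_comp]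
  exact sum_norm_mulVec_sq_le A _

/-- At angle zero the matrix is real. The two vector bounds contribute `l²`, and the factor `exp (l²
/ 2)` in Chevet's inequality takes half of it away. -/
theorem integral_cosh_norm_rotScale_zero_le (m n : Type*) [Fintype m] [Fintype n] [DecidableEq n]
    {l : ℝ} (hl : 0 < l) :
    ∫ x, Real.cosh (l * ‖complexMatrix (rotScale (m × n) 0 * x)‖) ∂gaussPi (m × n ⊕ m × n) ≤
      Real.exp (l * (√(Fintype.card m) + √(Fintype.card n)) + l ^ 2 / 2) := by
  have htriv : (∀ A : Matrix m n ℂ, A = 0) →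
      ∫ x, Real.cosh (l * ‖complexMatrix (rotScale (m × n) 0 * x)‖) ∂gaussPi (m × n ⊕ m × n) ≤
      Real.exp (l * (√(Fintype.card m) + √(Fintype.card n)) + l ^ 2 / 2) := fun h => by
    have : ∀ x, complexMatrix (rotScale (m × n) 0 * x) = 0 := fun x => h _
    simp only [this, norm_zero, mul_zero, Real.cosh_zero, integral_const, probReal_univ, one_smul]
    exact Real.one_le_exp (by positivity)
  rcases isEmpty_or_nonempty m with hm | hm
  · exact htriv fun A => by ext i; exact hm.elim i
  rcases isEmpty_or_nonempty n with hn | hn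
  · exact htriv fun A => by ext i j; exact hn.elim j
  have hcm : ∀ x : m × n ⊕ m × n → ℝ, complexMatrix (rotScale (m × n) 0 * x) =
      (Matrix.of fun i j => x (Sum.inl (i, j)) : Matrix m n ℝ).map Complex.ofReal := fun x => by
    ext i j
    simp [complexMatrix, rotScale]
  have hint : Integrable (fun A : m × n → ℝ =>
      Real.exp (l * ‖(Matrix.of fun i j => A (i, j) : Matrix m n ℝ)‖)) (gaussPi (m × n)) :=
    (ExpGrowth.exp_norm_of hl.le).integrable_of_continuous
      (Real.continuous_exp.comp (continuous_const.mul continuous_norm_of))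
  have hchevet := exp_mul_integral_exp_norm_le (m := m) (n := n) hl
  have h1 : ∫ x, Real.cosh (l * ‖complexMatrix (rotScale (m × n) 0 * x)‖)
      ∂gaussPi (m × n ⊕ m × n) ≤ ∫ A, Real.exp
        (l * ‖(Matrix.of fun i j => A (i, j) : Matrix m n ℝ)‖) ∂gaussPi (m × n) := by
    have hc : Continuous fun A : m × n → ℝ =>
        Real.cosh (l * ‖(Matrix.of fun i j => A (i, j) : Matrix m n ℝ).map Complex.ofReal‖) :=
      Real.continuous_cosh.comp (continuous_const.mul (Continuous.norm
        (continuous_matrix fun i j => by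
          simp only [Matrix.map_apply, Matrix.of_apply]; fun_prop)))
    simp only [hcm]
    rw [integral_gaussPi_inl (β := m × n) (f := fun A : m × n → ℝ => Real.cosh
      (l * ‖(Matrix.of fun i j => A (i, j) : Matrix m n ℝ).map Complex.ofReal‖)) hc]
    refine integral_mono_of_nonneg (Filter.Eventually.of_forall fun A => (Real.cosh_pos _).le) hint
      (Filter.Eventually.of_forall fun A => ?_)
    have h2 : Real.cosh (l * ‖(Matrix.of fun i j => A (i, j) : Matrix m n ℝ).map Complex.ofReal‖) ≤
        Real.exp (l * ‖(Matrix.of fun i j => A (i, j) : Matrix m n ℝ).map Complex.ofReal‖) := by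
      have h0 : 0 ≤ l * ‖(Matrix.of fun i j => A (i, j) : Matrix m n ℝ).map Complex.ofReal‖ := by
        positivity
      have := Real.exp_le_exp.2 (show -(l * ‖(Matrix.of fun i j => A (i, j) :
        Matrix m n ℝ).map Complex.ofReal‖) ≤ _ from (neg_nonpos.2 h0).trans h0)
      rw [Real.cosh_eq]
      linarith
    exact h2.trans (Real.exp_le_exp.2 (mul_le_mul_of_nonneg_left (l2_opNorm_map_ofReal_le _) hl.le))
  refine h1.trans ?_
  rw [← mul_le_mul_iff_right₀ (Real.exp_pos (l ^ 2 / 2))]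
  calc _ ≤ _ := hchevet
    _ ≤ Real.exp (l * √(Fintype.card n) + l ^ 2 / 2) *
        Real.exp (l * √(Fintype.card m) + l ^ 2 / 2) :=
        mul_le_mul (integral_exp_mul_sqrt_sum_sq_le hl.le) (integral_exp_mul_sqrt_sum_sq_le hl.le)
          (integral_nonneg fun _ => (Real.exp_pos _).le) (Real.exp_pos _).le
    _ = _ := by
        rw [← Real.exp_add, ← Real.exp_add]
        ring_nf

theorem cosh_mul_le_cosh_mul {l y z : ℝ} (hl : 0 ≤ l) (hy : 0 ≤ y) (h : y ≤ z) :
    Real.cosh (l * y) ≤ Real.cosh (l * z) := by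
  rw [Real.cosh_le_cosh, abs_of_nonneg (by positivity),
    abs_of_nonneg (mul_nonneg hl (hy.trans h))]
  gcongr

theorem continuous_cosh_norm_rotScale {m n : Type*} [Fintype m] [Fintype n] [DecidableEq n]
    (l θ : ℝ) :
    Continuous fun x => Real.cosh (l * ‖complexMatrix (rotScale (m × n) θ * x)‖) :=
  Real.continuous_cosh.comp (continuous_const.mul (continuous_complexMatrix_rotScale θ).norm)

theorem integral_cosh_norm_rotScale_le_of_submatrix {m n m' n' : Type*} [Fintype m] [Fintype n]
    [Fintype m'] [Fintype n'] [DecidableEq m] [DecidableEq n] [DecidableEq m'] [DecidableEq n']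
    (E : (m' × n' ⊕ m' × n') ≃ (m × n ⊕ m × n)) {ε : m' × n' ⊕ m' × n' → ℝ}
    (hε : ∀ i, ε i * ε i = 1) {l θ : ℝ} (hl : 0 ≤ l)
    (h : ∀ x, ‖complexMatrix (rotScale (m' × n') θ * fun i => ε i * x (E i))‖ ≤
      ‖complexMatrix (rotScale (m × n) θ * x)‖) :
    ∫ x, Real.cosh (l * ‖complexMatrix (rotScale (m' × n') θ * x)‖) ∂gaussPi (m' × n' ⊕ m' × n') ≤
      ∫ x, Real.cosh (l * ‖complexMatrix (rotScale (m × n) θ * x)‖)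
        ∂gaussPi (m × n ⊕ m × n) := by
  rw [integral_gaussPi_comp_equiv E hε (continuous_cosh_norm_rotScale l θ)]
  exact integral_mono_of_nonneg (Filter.Eventually.of_forall fun x => (Real.cosh_pos _).le)
    (integrable_cosh_norm_rotScale θ l)
    (Filter.Eventually.of_forall fun x => cosh_mul_le_cosh_mul hl (norm_nonneg _) (h x))

/-- The exponential moments of the norm of `cos θ X + i sin θ Y`, where `X` and `Y` are
independent real Gaussian matrices. -/
theorem integral_cosh_norm_rotScale_le_exp (m n : Type*) [Fintype m] [Fintype n] [DecidableEq m]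
    [DecidableEq n] {l : ℝ} (hl : 0 < l) {θ : ℝ} (hθ : θ ∈ Set.Icc 0 (Real.pi / 4)) :
    ∫ x, Real.cosh (l * ‖complexMatrix (rotScale (m × n) θ * x)‖) ∂gaussPi (m × n ⊕ m × n) ≤
      Real.exp (l * (√(Fintype.card m) + √(Fintype.card n)) + l ^ 2 / 2) := by
  have hsplit : ∀ k k' : ℕ, k ≤ k' → k + (k' - k) = k' := fun _ _ h => Nat.add_sub_cancel' h
  rcases le_total (Fintype.card n) (Fintype.card m) with hc | hc
  -- The monotonicity is for matrices with at least as many rows as columns, indexed by `n ⊕ r`; a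
  -- tall matrix is of this shape after relabelling.
  · set r := Fin (Fintype.card m - Fintype.card n)
    have e : m ≃ n ⊕ r := Fintype.equivOfCardEq (by simp [r, hsplit _ _ hc])
    have h1 := integral_cosh_norm_rotScale_le_of_submatrix (m := n ⊕ r) (n := n) (m' := m)
      (n' := n) (Equiv.sumCongr (Equiv.prodCongr e (Equiv.refl n)) (Equiv.prodCongr e (Equiv.refl n)))
      (ε := fun _ => 1) (by simp) (θ := θ) hl.le fun x => by
        refine le_trans (le_of_eq ?_) (l2_opNorm_submatrix_equiv_le
          (complexMatrix (rotScale ((n ⊕ r) × n) θ * x)) e (Equiv.refl n))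
        congr 1
        ext i j
        simp [complexMatrix, rotScale]
    refine h1.trans ((integral_cosh_norm_rotScale_le l hθ).trans
      ((integral_cosh_norm_rotScale_zero_le (n ⊕ r) n hl).trans_eq ?_))
    have hcard : Fintype.card (n ⊕ r) = Fintype.card m := (Fintype.card_congr e).symm
    rw [hcard]
  -- A wide matrix is replaced by its conjugate transpose; the sign `-1` on the imaginary
  -- coordinates undoes the conjugation.
  · set r := Fin (Fintype.card n - Fintype.card m)
    have e : n ≃ m ⊕ r := Fintype.equivOfCardEq (by simp [r, hsplit _ _ hc])
    have h1 := integral_cosh_norm_rotScale_le_of_submatrix (m := m ⊕ r) (n := m) (m' := m)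
      (n' := n) (Equiv.sumCongr
        ((Equiv.prodComm m n).trans (Equiv.prodCongr e (Equiv.refl m)))
        ((Equiv.prodComm m n).trans (Equiv.prodCongr e (Equiv.refl m))))
      (ε := Sum.elim (fun _ => 1) fun _ => -1) (by rintro (i | i) <;> simp) (θ := θ) hl.le
      fun x => by
        rw [← Matrix.l2_opNorm_conjTranspose (complexMatrix (rotScale ((m ⊕ r) × m) θ * x))]
        refine le_trans (le_of_eq ?_) (l2_opNorm_submatrix_equiv_le
          (complexMatrix (rotScale ((m ⊕ r) × m) θ * x)).conjTranspose (Equiv.refl m) e)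
        congr 1
        ext i j
        simp [complexMatrix, rotScale, -Complex.ofReal_cos, -Complex.ofReal_sin]
    refine h1.trans ((integral_cosh_norm_rotScale_le l hθ).trans
      ((integral_cosh_norm_rotScale_zero_le (m ⊕ r) m hl).trans_eq ?_))
    have hcard : Fintype.card (m ⊕ r) = Fintype.card n := (Fintype.card_congr e).symm
    rw [hcard, add_comm (√(Fintype.card n : ℝ))]

end GaussianMatrix

/-! ### Decorrelating real and imaginary parts by a phase. -/

section PhaseNormalization

variable {κ : Type*} [Fintype κ]

/-- A family of phases can be rotated so that its real and imaginary parts are orthogonal, the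
real part being the larger one. -/
theorem exists_phase_rotation [Nonempty κ] {c : κ → ℂ} (hc : ∀ k, ‖c k‖ = 1) :
    ∃ ζ : ℂ, ‖ζ‖ = 1 ∧ ∃ θ ∈ Set.Icc 0 (Real.pi / 4),
      ∑ k, (ζ * c k).re * (ζ * c k).re = Fintype.card κ * Real.cos θ ^ 2 ∧
      ∑ k, (ζ * c k).im * (ζ * c k).im = Fintype.card κ * Real.sin θ ^ 2 ∧
      ∑ k, (ζ * c k).re * (ζ * c k).im = 0 := by
  set w := ∑ k, c k ^ 2 with hw
  set Q : ℝ := (Fintype.card κ : ℝ) with hQ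
  have hQ0 : 0 < Q := Nat.cast_pos.2 Fintype.card_pos
  -- Half the argument of `∑ c k ^ 2` is rotated away, so `∑ (ζ c k)²` becomes real and nonnegative:
  -- its imaginary part gives orthogonality, its real part the difference of the two squared
  -- lengths.
  set ζ : ℂ := Complex.exp ((-(w.arg / 2) : ℝ) * Complex.I) with hζ
  have hζ1 : ‖ζ‖ = 1 := Complex.norm_exp_ofReal_mul_I _
  have hζw : ζ ^ 2 * w = ‖w‖ := by
    conv_lhs => rw [← Complex.norm_mul_exp_arg_mul_I w]
    rw [hζ, ← Complex.exp_nat_mul, mul_left_comm, ← Complex.exp_add]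
    have : ((2 : ℕ) : ℂ) * ((-(w.arg / 2) : ℝ) * Complex.I) + w.arg * Complex.I = 0 := by
      push_cast; ring
    rw [this, Complex.exp_zero, mul_one]
  have hwQ : ‖w‖ ≤ Q := by
    refine (norm_sum_le _ _).trans (le_of_eq ?_)
    simp [hc, hQ]
  have hsum : ∑ k, (ζ * c k) ^ 2 = ‖w‖ := by
    simp only [mul_pow, ← Finset.mul_sum]
    exact hζw
  have hre := congrArg Complex.re hsum
  have him := congrArg Complex.im hsum
  rw [Complex.re_sum, Complex.ofReal_re] at hre
  rw [Complex.im_sum, Complex.ofReal_im] at him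
  simp only [sq, Complex.mul_re (ζ * _), Complex.mul_im (ζ * _)] at hre him
  have hnorm : ∑ k, ((ζ * c k).re * (ζ * c k).re + (ζ * c k).im * (ζ * c k).im) = Q := by
    have : ∀ k, (ζ * c k).re * (ζ * c k).re + (ζ * c k).im * (ζ * c k).im = 1 := fun k => by
      rw [← Complex.normSq_apply, ← Complex.sq_norm, norm_mul, hζ1, hc]; norm_num
    simp only [this]
    simp [hQ]
  rw [Finset.sum_sub_distrib] at hre
  rw [Finset.sum_add_distrib] at hnorm him
  -- This ratio is `cos 2θ`; lying in `[0, 1]`, it yields an angle in `[0, π/4]`.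
  set τ := ‖w‖ / Q with hτ
  have hτ0 : 0 ≤ τ := by positivity
  have hτ1 : τ ≤ 1 := (div_le_one hQ0).2 hwQ
  have hτQ : Q * τ = ‖w‖ := mul_div_cancel₀ _ hQ0.ne'
  have hcos : Real.cos (2 * (Real.arccos τ / 2)) = τ := by
    rw [mul_div_cancel₀ _ two_ne_zero, Real.cos_arccos (by linarith) hτ1]
  refine ⟨ζ, hζ1, Real.arccos τ / 2, ⟨by linarith [Real.arccos_nonneg τ], ?_⟩, ?_, ?_, ?_⟩
  · have := Real.arccos_le_pi_div_two.2 hτ0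
    linarith
  · rw [Real.cos_two_mul] at hcos
    nlinarith
  · rw [Real.cos_two_mul, ← Real.sin_sq_add_cos_sq (Real.arccos τ / 2)] at hcos
    have h1 := Real.sin_sq_add_cos_sq (Real.arccos τ / 2)
    nlinarith
  · have : ∑ k, (ζ * c k).im * (ζ * c k).re = ∑ k, (ζ * c k).re * (ζ * c k).im :=
      Finset.sum_congr rfl fun k _ => mul_comm _ _
    linarith

end PhaseNormalization

/-! ### The Gaussian law of a filter symbol and its tail. -/

section Symbol

variable {m n κ : Type*} [Fintype κ]

/-- The matrix `∑ₖ uₖ cₖ` of a filter bank at the frequency with phases `cₖ`. -/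
noncomputable def filterSymbol (c : κ → ℂ) (u : m × n × κ → ℝ) : Matrix m n ℂ :=
  Matrix.of fun i j => ∑ k, u (i, j, k) * c k

theorem continuous_filterSymbol (c : κ → ℂ) :
    Continuous (filterSymbol c : (m × n × κ → ℝ) → Matrix m n ℂ) := by
  refine continuous_matrix fun i j => ?_
  simp only [filterSymbol, Matrix.of_apply]
  fun_prop

theorem filterSymbol_smul (c : κ → ℂ) (σ : ℝ) (u : m × n × κ → ℝ) :
    filterSymbol c (σ • u) = (σ : ℂ) • filterSymbol c u := by
  ext i j
  simp [filterSymbol, Finset.mul_sum, mul_assoc]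

variable [Fintype m] [Fintype n] [DecidableEq m] [DecidableEq n]

/-- The real coordinates of a rotated filter symbol as a linear function of the weights. -/
noncomputable def symbolCoords (d : κ → ℂ) : Matrix (m × n ⊕ m × n) (m × n × κ) ℝ :=
  Matrix.of fun p r => if Sum.elim id id p = (r.1, r.2.1) then
    Sum.elim (fun _ => (d r.2.2).re) (fun _ => (d r.2.2).im) p else 0

theorem sum_symbolCoords (d : κ → ℂ) (p : m × n ⊕ m × n) (f : m × n × κ → ℝ) :
    ∑ r, symbolCoords d p r * f r = ∑ k, Sum.elim (fun _ => (d k).re) (fun _ => (d k).im) p *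
      f ((Sum.elim id id p).1, (Sum.elim id id p).2, k) := by
  obtain ⟨i, j, hp⟩ : ∃ i j, Sum.elim id id p = (i, j) := ⟨_, _, rfl⟩
  simp only [symbolCoords, Matrix.of_apply, hp, Prod.mk.injEq, ite_mul, zero_mul,
    Fintype.sum_prod_type]
  rw [Finset.sum_eq_single i (fun i' _ h => by simp [h.symm]) (by simp),
    Finset.sum_eq_single j (fun j' _ h => by simp [h.symm]) (by simp)]
  simp

/-- Different entries use different weights, and within an entry the real and imaginary parts are
orthogonal, so the covariance is diagonal. -/
theorem symbolCoords_mul_transpose {d : κ → ℂ} {ρ θ : ℝ}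
    (h1 : ∑ k, (d k).re * (d k).re = ρ ^ 2 * Real.cos θ ^ 2)
    (h2 : ∑ k, (d k).im * (d k).im = ρ ^ 2 * Real.sin θ ^ 2)
    (h3 : ∑ k, (d k).re * (d k).im = 0) :
    (symbolCoords (m := m) (n := n) d) * (symbolCoords (m := m) (n := n) d).transpose =
      Matrix.diagonal (fun p => ρ * rotScale (m × n) θ p) *
        (Matrix.diagonal fun p => ρ * rotScale (m × n) θ p).transpose := by
  have h4 : ∑ k, (d k).im * (d k).re = 0 := by rw [← h3]; exact Finset.sum_congr rfl fun k _ => mul_comm _ _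
  rw [Matrix.diagonal_transpose, Matrix.diagonal_mul_diagonal]
  ext p p'
  rw [Matrix.mul_apply]
  simp only [Matrix.transpose_apply, sum_symbolCoords, Matrix.diagonal_apply]
  rcases p with ⟨i, j⟩ | ⟨i, j⟩ <;> rcases p' with ⟨i', j'⟩ | ⟨i', j'⟩ <;>
    by_cases hij : i' = i ∧ j' = j <;>
    simp [symbolCoords, rotScale, hij, h1, h2, h3, h4, eq_comm (a := i), eq_comm (a := j)] <;> ring

theorem complexMatrix_symbolCoords (ζ : ℂ) (c : κ → ℂ) (u : m × n × κ → ℝ) :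
    complexMatrix ((symbolCoords fun k => ζ * c k).mulVec u) = ζ • filterSymbol c u := by
  have h : ∀ p, (symbolCoords fun k => ζ * c k).mulVec u p =
      ∑ k, Sum.elim (fun _ => (ζ * c k).re) (fun _ => (ζ * c k).im) p *
        u ((Sum.elim id id p).1, (Sum.elim id id p).2, k) := fun p => sum_symbolCoords _ p u
  ext i j
  simp only [complexMatrix, Matrix.of_apply, h, Sum.elim_inl, Sum.elim_inr, id, Matrix.smul_apply,
    filterSymbol, smul_eq_mul, Finset.mul_sum]
  push_cast
  rw [Finset.sum_mul, ← Finset.sum_add_distrib]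
  refine Finset.sum_congr rfl fun k _ => ?_
  conv_rhs => rw [mul_left_comm, ← Complex.re_add_im (ζ * c k)]
  ring

theorem gaussPi_map_symbolCoords {d : κ → ℂ} {ρ θ : ℝ}
    (h1 : ∑ k, (d k).re * (d k).re = ρ ^ 2 * Real.cos θ ^ 2)
    (h2 : ∑ k, (d k).im * (d k).im = ρ ^ 2 * Real.sin θ ^ 2)
    (h3 : ∑ k, (d k).re * (d k).im = 0) :
    (gaussPi (m × n × κ)).map (fun u => (symbolCoords d).mulVec u) =
      (gaussPi (m × n ⊕ m × n)).map fun x => ρ • (rotScale (m × n) θ * x) := by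
  rw [gaussPi_map_mulVec_eq _ _ (symbolCoords_mul_transpose h1 h2 h3)]
  congr 1
  ext x p
  simp [Matrix.mulVec_diagonal, mul_assoc]

/-- The normalising phase leaves the norm unchanged, and the rotated symbol has the law of `√(card
κ)` times the matrix `cos θ X + i sin θ Y`. -/
theorem integral_cosh_norm_filterSymbol [Nonempty κ] {c : κ → ℂ} (hc : ∀ k, ‖c k‖ = 1) (l : ℝ) :
    ∃ θ ∈ Set.Icc 0 (Real.pi / 4),
      ∫ u, Real.cosh (l * ‖(filterSymbol c u : Matrix m n ℂ)‖) ∂gaussPi (m × n × κ) =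
        ∫ x, Real.cosh (l * √(Fintype.card κ) * ‖complexMatrix (rotScale (m × n) θ * x)‖)
          ∂gaussPi (m × n ⊕ m × n) ∧
      Integrable (fun u => Real.cosh (l * ‖(filterSymbol c u : Matrix m n ℂ)‖))
        (gaussPi (m × n × κ)) := by
  obtain ⟨ζ, hζ, θ, hθ, h1, h2, h3⟩ := exists_phase_rotation hc
  have hρ : √(Fintype.card κ : ℝ) ^ 2 = Fintype.card κ := Real.sq_sqrt (Nat.cast_nonneg _)
  rw [← hρ] at h1 h2
  have hmap := gaussPi_map_symbolCoords (m := m) (n := n) h1 h2 h3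
  set ρ := √(Fintype.card κ : ℝ)
  have hF : Continuous fun y : m × n ⊕ m × n → ℝ => Real.cosh (l * ‖complexMatrix y‖) :=
    Real.continuous_cosh.comp (continuous_const.mul continuous_complexMatrix.norm)
  have hA : ∀ u : m × n × κ → ℝ, Real.cosh (l * ‖(filterSymbol c u : Matrix m n ℂ)‖) =
      Real.cosh (l * ‖complexMatrix ((symbolCoords fun k => ζ * c k).mulVec u)‖) := fun u => by
    rw [complexMatrix_symbolCoords, norm_smul, hζ, one_mul]
  have hB : ∀ x : m × n ⊕ m × n → ℝ, Real.cosh (l * ‖complexMatrix (ρ • (rotScale (m × n) θ * x))‖) =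
      Real.cosh (l * ρ * ‖complexMatrix (rotScale (m × n) θ * x)‖) := fun x => by
    rw [complexMatrix_smul, norm_smul, Complex.norm_real,
      Real.norm_of_nonneg (Real.sqrt_nonneg _), mul_assoc]
  have hm : Measurable fun x : m × n ⊕ m × n → ℝ => ρ • (rotScale (m × n) θ * x) :=
    Continuous.measurable (by fun_prop)
  refine ⟨θ, hθ, ?_, ?_⟩
  · simp only [hA, ← hB]
    rw [← integral_map (measurable_mulVec _).aemeasurable
      hF.stronglyMeasurable.aestronglyMeasurable (f := fun y => Real.cosh (l * ‖complexMatrix y‖)),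
      hmap, integral_map hm.aemeasurable hF.stronglyMeasurable.aestronglyMeasurable]
  · simp only [hA]
    have hi : Integrable (fun x : m × n ⊕ m × n → ℝ =>
        Real.cosh (l * ‖complexMatrix (ρ • (rotScale (m × n) θ * x))‖)) (gaussPi (m × n ⊕ m × n)) := by
      simp only [hB]
      exact integrable_cosh_norm_rotScale θ _
    have hi' := (integrable_map_measure (μ := gaussPi (m × n ⊕ m × n))
      hF.stronglyMeasurable.aestronglyMeasurable hm.aemeasurable).2 hi
    rw [← hmap] at hi'
    exact (integrable_map_measure hF.stronglyMeasurable.aestronglyMeasurable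
      (measurable_mulVec _).aemeasurable).1 hi'

theorem gaussPi_real_le_norm_filterSymbol [Nonempty κ] {c : κ → ℂ} (hc : ∀ k, ‖c k‖ = 1) {t : ℝ}
    (ht : 0 < t) :
    (gaussPi (m × n × κ)).real {u | √(Fintype.card κ) *
        (√(Fintype.card m) + √(Fintype.card n)) + t ≤ ‖(filterSymbol c u : Matrix m n ℂ)‖} ≤
      2 * Real.exp (-t ^ 2 / (2 * Fintype.card κ)) := by
  have hQ : (0 : ℝ) < Fintype.card κ := by exact_mod_cast Fintype.card_pos
  have hρ : √(Fintype.card κ : ℝ) ^ 2 = Fintype.card κ := Real.sq_sqrt hQ.le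
  have hρ0 : 0 < √(Fintype.card κ : ℝ) := Real.sqrt_pos.2 hQ
  set ρ := √(Fintype.card κ : ℝ)
  set M := √(Fintype.card m : ℝ) + √(Fintype.card n) with hM
  have hM0 : 0 ≤ M := by positivity
  -- The minimiser of `-l t + l² ρ² / 2`, the Chernoff exponent.
  set l := t / ρ ^ 2 with hl
  have hl0 : 0 < l := by positivity
  obtain ⟨θ, hθ, hint, hi⟩ := integral_cosh_norm_filterSymbol (m := m) (n := n) hc l
  have hb := integral_cosh_norm_rotScale_le_exp m n (mul_pos hl0 hρ0) hθ
  rw [← hint] at hb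
  have hmarkov := mul_meas_ge_le_integral_of_nonneg (μ := gaussPi (m × n × κ))
    (Filter.Eventually.of_forall fun u => (Real.cosh_pos (l * ‖(filterSymbol c u : Matrix m n ℂ)‖)).le)
    hi (Real.cosh (l * (ρ * M + t)))
  have hsub : (gaussPi (m × n × κ)).real {u | ρ * M + t ≤ ‖(filterSymbol c u : Matrix m n ℂ)‖} ≤
      (gaussPi (m × n × κ)).real {u | Real.cosh (l * (ρ * M + t)) ≤
        Real.cosh (l * ‖(filterSymbol c u : Matrix m n ℂ)‖)} :=
    measureReal_mono fun u hu => cosh_mul_le_cosh_mul hl0.le (by positivity) hu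
  have hcosh : Real.exp (l * (ρ * M + t)) / 2 ≤ Real.cosh (l * (ρ * M + t)) := by
    rw [Real.cosh_eq]
    linarith [Real.exp_pos (-(l * (ρ * M + t)))]
  have h1 : Real.exp (l * (ρ * M + t)) / 2 *
      (gaussPi (m × n × κ)).real {u | ρ * M + t ≤ ‖(filterSymbol c u : Matrix m n ℂ)‖} ≤
      Real.exp (l * ρ * M + (l * ρ) ^ 2 / 2) :=
    (mul_le_mul hcosh hsub measureReal_nonneg (Real.cosh_pos _).le).trans (hmarkov.trans hb)
  have h2 : Real.exp (l * ρ * M + (l * ρ) ^ 2 / 2) =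
      Real.exp (l * (ρ * M + t)) / 2 * (2 * Real.exp (-t ^ 2 / (2 * Fintype.card κ))) := by
    rw [show ∀ y z : ℝ, y / 2 * (2 * z) = y * z from fun y z => by ring, ← Real.exp_add, ← hρ, hl]
    congr 1
    field_simp
    ring
  rw [h2] at h1
  exact le_of_mul_le_mul_left h1 (by positivity)

end Symbol

/-! ### Fourier transform of convolutions on a finite abelian group. -/

section Fourier

variable {G : Type*} [AddCommGroup G] [Fintype G] [DecidableEq G]

theorem sum_norm_sq_fourier (F : G → ℝ) :
    ∑ χ : AddChar G ℂ, ‖∑ x, (F x : ℂ) * χ x‖ ^ 2 = Fintype.card G * ∑ x, F x ^ 2 := by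
  have h : ((∑ χ : AddChar G ℂ, ‖∑ x, (F x : ℂ) * χ x‖ ^ 2 : ℝ) : ℂ) =
      ((Fintype.card G * ∑ x, F x ^ 2 : ℝ) : ℂ) := by
    push_cast
    calc ∑ χ : AddChar G ℂ, ((‖∑ x, (F x : ℂ) * χ x‖ : ℂ)) ^ 2
        = ∑ χ : AddChar G ℂ, ∑ x, ∑ y, (F x : ℂ) * F y * χ (x - y) := by
          refine Finset.sum_congr rfl fun χ _ => ?_
          rw [← Complex.mul_conj', map_sum, Finset.sum_mul_sum]
          refine Finset.sum_congr rfl fun x _ => Finset.sum_congr rfl fun y _ => ?_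
          rw [map_mul, Complex.conj_ofReal, sub_eq_add_neg, AddChar.map_add_eq_mul,
            AddChar.map_neg_eq_conj]
          ring
      _ = ∑ x, ∑ y, (F x : ℂ) * F y * ∑ χ : AddChar G ℂ, χ (x - y) := by
          rw [Finset.sum_comm]
          refine Finset.sum_congr rfl fun x _ => ?_
          rw [Finset.sum_comm]
          exact Finset.sum_congr rfl fun y _ => by rw [Finset.mul_sum]
      _ = _ := by
          simp only [AddChar.sum_apply_eq_ite, sub_eq_zero, mul_ite, mul_zero, Finset.sum_ite_eq,
            Finset.mem_univ, if_true, Finset.mul_sum]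
          exact Finset.sum_congr rfl fun x _ => by ring
  exact_mod_cast h

variable {m n κ : Type*} [Fintype m] [Fintype n] [Fintype κ] [DecidableEq n]

/-- The matrix of the layer of convolutions on the group `G`, with taps at the points `s k`. -/
def groupConvMatrix (s : κ → G) (u : m × n × κ → ℝ) : Matrix (m × G) (n × G) ℝ :=
  Matrix.of fun r c => ∑ k, if c.2 = r.2 - s k then u (r.1, c.1, k) else 0

theorem groupConvMatrix_mulVec {m n κ : Type*} [Fintype n] [Fintype κ] (s : κ → G) (u : m × n × κ → ℝ) (F : n × G → ℝ) (i : m) (x : G) :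
    (groupConvMatrix s u).mulVec F (i, x) = ∑ j, ∑ k, u (i, j, k) * F (j, x - s k) := by
  simp only [groupConvMatrix, Matrix.mulVec, dotProduct, Matrix.of_apply,
    Fintype.sum_prod_type (α₁ := n), Finset.sum_mul]
  refine Finset.sum_congr rfl fun j _ => ?_
  rw [Finset.sum_comm]
  refine Finset.sum_congr rfl fun k _ => ?_
  simp

theorem fourier_groupConvMatrix {m n κ : Type*} [Fintype n] [Fintype κ] (s : κ → G) (u : m × n × κ → ℝ) (F : n × G → ℝ) (i : m)
    (χ : AddChar G ℂ) :
    ∑ x, ((groupConvMatrix s u).mulVec F (i, x) : ℂ) * χ x =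
      (filterSymbol (fun k => χ (s k)) u : Matrix m n ℂ).mulVec
        (fun j => ∑ x, (F (j, x) : ℂ) * χ x) i := by
  simp only [groupConvMatrix_mulVec]
  simp only [Matrix.mulVec, dotProduct, filterSymbol, Matrix.of_apply]
  push_cast
  simp only [Finset.sum_mul]
  rw [Finset.sum_comm]
  refine Finset.sum_congr rfl fun j _ => ?_
  rw [Finset.sum_comm]
  refine Finset.sum_congr rfl fun k _ => ?_
  -- Translating the summation variable by the tap brings out the factor `χ (s k)`.
  rw [← Equiv.sum_comp (Equiv.addRight (s k)), Finset.mul_sum]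
  refine Finset.sum_congr rfl fun x _ => ?_
  simp only [Equiv.coe_addRight, add_sub_cancel_right, AddChar.map_add_eq_mul]
  ring

/-- Parseval is applied on both sides; between them each frequency is acted on by its own symbol,
and bounding these one by one bounds the whole. -/
theorem norm_groupConvMatrix_le (s : κ → G) (u : m × n × κ → ℝ) {R : ℝ} (hR : 0 ≤ R)
    (h : ∀ χ : AddChar G ℂ, ‖(filterSymbol (fun k => χ (s k)) u : Matrix m n ℂ)‖ ≤ R) :
    ‖groupConvMatrix s u‖ ≤ R := by
  refine l2_opNorm_le_of_forall _ hR fun F => ?_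
  simp only [Real.norm_eq_abs, sq_abs]
  have hG : (0 : ℝ) < Fintype.card G := by exact_mod_cast Fintype.card_pos
  refine le_of_mul_le_mul_left ?_ hG
  calc (Fintype.card G : ℝ) * ∑ r, (groupConvMatrix s u).mulVec F r ^ 2
      = ∑ χ : AddChar G ℂ, ∑ i, ‖(filterSymbol (fun k => χ (s k)) u : Matrix m n ℂ).mulVec
          (fun j => ∑ x, (F (j, x) : ℂ) * χ x) i‖ ^ 2 := by
        rw [Fintype.sum_prod_type, Finset.mul_sum, Finset.sum_comm]
        refine Finset.sum_congr rfl fun i _ => ?_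
        rw [← sum_norm_sq_fourier]
        simp only [fourier_groupConvMatrix]
    _ ≤ ∑ χ : AddChar G ℂ, R ^ 2 * ∑ j, ‖∑ x, (F (j, x) : ℂ) * χ x‖ ^ 2 := by
        refine Finset.sum_le_sum fun χ _ => (sum_norm_mulVec_sq_le _ _).trans ?_
        gcongr
        exact h χ
    _ = _ := by
        rw [← Finset.mul_sum, Finset.sum_comm, Fintype.sum_prod_type, mul_left_comm]
        simp only [sum_norm_sq_fourier, Finset.mul_sum]

theorem exists_le_norm_filterSymbol (s : κ → G) (u : m × n × κ → ℝ) {C : ℝ}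
    (h : C ≤ ‖groupConvMatrix s u‖) :
    ∃ χ : AddChar G ℂ, C ≤ ‖(filterSymbol (fun k => χ (s k)) u : Matrix m n ℂ)‖ := by
  obtain ⟨χ, -, hχ⟩ := Finset.exists_max_image (Finset.univ : Finset (AddChar G ℂ))
    (fun χ => ‖(filterSymbol (fun k => χ (s k)) u : Matrix m n ℂ)‖) Finset.univ_nonempty
  exact ⟨χ, h.trans (norm_groupConvMatrix_le s u (norm_nonneg _) fun χ' => hχ χ' (Finset.mem_univ _))⟩

end Fourier

/-! ### The tail bound for the convolutional layer. -/

theorem map_eq_gaussPi_map_smul {Ω ι : Type*} [MeasurableSpace Ω] [Fintype ι] {P : Measure Ω}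
    [IsProbabilityMeasure P] {u : ι → Ω → ℝ} {σ : ℝ} (hu_indep : iIndepFun u P)
    (hu_law : ∀ k, HasLaw (u k) (gaussianReal 0 (Real.toNNReal (σ ^ 2))) P) :
    P.map (fun ω k => u k ω) = (gaussPi ι).map (fun x => σ • x) := by
  rw [(iIndepFun_iff_map_fun_eq_pi_map fun k => (hu_law k).aemeasurable).1 hu_indep]
  have h : (gaussianReal 0 1).map (σ * ·) = gaussianReal 0 (Real.toNNReal (σ ^ 2)) := by
    rw [gaussianReal_map_const_mul, mul_zero, mul_one]
    congr 1
    ext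
    simp [sq_nonneg]
  have hpi := Measure.pi_map_pi (μ := fun _ : ι => gaussianReal 0 1) (f := fun _ x => σ * x)
    fun _ => (measurable_const_mul σ).aemeasurable
  simp only [h] at hpi
  simp only [(hu_law _).map_eq]
  exact hpi.symm

/-- The tap positions are reduced modulo `N` and need not be distinct, so filters larger than the
feature map are included. -/
theorem convLayerMatrix_eq_groupConvMatrix {a b q N : ℕ} [NeZero N]
    (u : Fin b × Fin a × (Fin q × Fin q) → ℝ) :
    convLayerMatrix N u = groupConvMatrix
      (fun k : Fin q × Fin q => (((k.1 : ℕ) : ZMod N), ((k.2 : ℕ) : ZMod N))) u := rfl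

/-- The tail of the norm of the matrix of a layer at one frequency. -/
theorem measureReal_le_norm_filterSymbol {Ω m n κ : Type*} [MeasurableSpace Ω] [Fintype m]
    [Fintype n] [Fintype κ] [DecidableEq m] [DecidableEq n] [Nonempty κ] {P : Measure Ω}
    [IsProbabilityMeasure P] {u : m × n × κ → Ω → ℝ} {σ : ℝ} (hσ : 0 < σ)
    (hu_indep : iIndepFun u P)
    (hu_law : ∀ k, HasLaw (u k) (gaussianReal 0 (Real.toNNReal (σ ^ 2))) P)
    {c : κ → ℂ} (hc : ∀ k, ‖c k‖ = 1) {t : ℝ} (ht : 0 < t) :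
    P.real {ω | σ * (√(Fintype.card κ) * (√(Fintype.card m) + √(Fintype.card n)) + t) ≤
        ‖(filterSymbol c (fun k => u k ω) : Matrix m n ℂ)‖} ≤
      2 * Real.exp (-t ^ 2 / (2 * Fintype.card κ)) := by
  set C := √(Fintype.card κ : ℝ) * (√(Fintype.card m) + √(Fintype.card n)) + t
  have hS : MeasurableSet {x : m × n × κ → ℝ | σ * C ≤ ‖(filterSymbol c x : Matrix m n ℂ)‖} :=
    (isClosed_le continuous_const (continuous_filterSymbol c).norm).measurableSet
  have hum : AEMeasurable (fun ω k => u k ω) P :=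
    aemeasurable_pi_lambda _ fun k => (hu_law k).aemeasurable
  have h1 : P.real {ω | σ * C ≤ ‖(filterSymbol c (fun k => u k ω) : Matrix m n ℂ)‖} =
      (P.map fun ω k => u k ω).real {x | σ * C ≤ ‖(filterSymbol c x : Matrix m n ℂ)‖} := by
    rw [measureReal_def, measureReal_def, Measure.map_apply_of_aemeasurable hum hS]
    rfl
  rw [h1, map_eq_gaussPi_map_smul hu_indep hu_law, measureReal_def,
    Measure.map_apply (measurable_const_smul σ) hS, ← measureReal_def]
  refine le_trans (le_of_eq ?_) (gaussPi_real_le_norm_filterSymbol (m := m) (n := n) hc ht)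
  congr 1
  ext x
  simp only [Set.mem_preimage, Set.mem_ofPred_eq, filterSymbol_smul, norm_smul, Complex.norm_real,
    Real.norm_of_nonneg hσ.le]
  exact mul_le_mul_iff_right₀ hσ

theorem theorem3p3 {Ω : Type*} [MeasurableSpace Ω] (P : Measure Ω) [IsProbabilityMeasure P]
    (a b q N : ℕ) [NeZero N] (hq : 0 < q) (σ : ℝ) (hσ : 0 < σ)
    (u : Fin b × Fin a × (Fin q × Fin q) → Ω → ℝ)
    (hu_indep : iIndepFun u P)
    (hu_law : ∀ k, HasLaw (u k) (gaussianReal 0 (Real.toNNReal (σ ^ 2))) P)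
    (t : ℝ) (ht : 0 ≤ t) :
    P.real {ω | σ * (q * (√a + √b) + t) ≤ ‖convLayerMatrix N (fun k => u k ω)‖} ≤
      2 * (N : ℝ) ^ 2 * Real.exp (-t ^ 2 / (2 * (q : ℝ) ^ 2)) := by
  -- The Chernoff parameter must be positive; at `t = 0` the right-hand side is already at least
  -- `1`.
  rcases ht.eq_or_lt with rfl | ht
  · have hN : (1 : ℝ) ≤ N := by exact_mod_cast Nat.one_le_iff_ne_zero.2 (NeZero.ne N)
    have h : (1 : ℝ) ≤ 2 * (N : ℝ) ^ 2 * Real.exp (-0 ^ 2 / (2 * (q : ℝ) ^ 2)) := by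
      simp only [ne_eq, OfNat.ofNat_ne_zero, not_false_eq_true, zero_pow, neg_zero, zero_div,
        Real.exp_zero, mul_one]
      nlinarith
    exact measureReal_le_one.trans h
  have : NeZero q := ⟨hq.ne'⟩
  set s : Fin q × Fin q → ZMod N × ZMod N := fun k => (((k.1 : ℕ) : ZMod N), ((k.2 : ℕ) : ZMod N))
  have hsqrt : √(Fintype.card (Fin q × Fin q) : ℝ) = q := by
    rw [Fintype.card_prod, Fintype.card_fin, Nat.cast_mul, Real.sqrt_mul_self (Nat.cast_nonneg q)]
  have hcard : ((Fintype.card (Fin q × Fin q) : ℕ) : ℝ) = (q : ℝ) ^ 2 := by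
    rw [Fintype.card_prod, Fintype.card_fin, Nat.cast_mul, sq]
  have htail : ∀ χ : AddChar (ZMod N × ZMod N) ℂ,
      P.real {ω | σ * (q * (√a + √b) + t) ≤
        ‖(filterSymbol (fun k => χ (s k)) (fun k => u k ω) : Matrix (Fin b) (Fin a) ℂ)‖} ≤
      2 * Real.exp (-t ^ 2 / (2 * (q : ℝ) ^ 2)) := fun χ => by
    have h := measureReal_le_norm_filterSymbol hσ hu_indep hu_law (c := fun k => χ (s k))
      (fun k => AddChar.norm_apply χ (s k)) ht
    rwa [hsqrt, hcard, Fintype.card_fin, Fintype.card_fin, add_comm (√(b : ℝ))] at h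
  have hsub : {ω | σ * (q * (√a + √b) + t) ≤ ‖convLayerMatrix N (fun k => u k ω)‖} ⊆
      ⋃ χ : AddChar (ZMod N × ZMod N) ℂ, {ω | σ * (q * (√a + √b) + t) ≤
        ‖(filterSymbol (fun k => χ (s k)) (fun k => u k ω) : Matrix (Fin b) (Fin a) ℂ)‖} := by
    intro ω hω
    rw [Set.mem_ofPred_eq, convLayerMatrix_eq_groupConvMatrix] at hω
    exact Set.mem_iUnion.2 (exists_le_norm_filterSymbol s (fun k => u k ω) hω)
  calc _ ≤ _ := measureReal_mono hsub
    _ ≤ ∑ χ : AddChar (ZMod N × ZMod N) ℂ, P.real {ω | σ * (q * (√a + √b) + t) ≤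
        ‖(filterSymbol (fun k => χ (s k)) (fun k => u k ω) : Matrix (Fin b) (Fin a) ℂ)‖} :=
        measureReal_iUnion_fintype_le _
    _ ≤ ∑ _χ : AddChar (ZMod N × ZMod N) ℂ, 2 * Real.exp (-t ^ 2 / (2 * (q : ℝ) ^ 2)) :=
        Finset.sum_le_sum fun χ _ => htail χ
    _ = _ := by
        -- A finite abelian group has as many characters as elements, here `N ^ 2`.
        rw [Finset.sum_const, Finset.card_univ, AddChar.card_eq, Fintype.card_prod, ZMod.card,
          nsmul_eq_mul, Nat.cast_mul]
        ring
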